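/- A graph sequence $(G,\tau)$ consists of a finite loopless undirected graph $G=(V,E)$ (parallel edges allowed), a ground set $\mathcal T=\{1,\dots,t_{\max}\}$ of time stamps, and for each edge $e$ a nonempty interval $\tau(e)=\{a_e,a_e+1,\dots,b_e\}\subseteq\mathcal T$ of time stamps at which $e$ is active; an edge that is active during several intervals is represented by several parallel edges. For $t\in\mathcal T$ let $G_t$ be the graph on $V$ whose edges are those active at $t$. Fix $s\in\{2,3\}$. A set $U\subseteq V$ is two-vertex connected in $G_t$ if $|U|\ge s$, the induced subgraph $G_t[U]$ is connected, and $G_t[U\setminus\{v\}]$ is connected for every $v\in U$ (for $s=2$ a single edge counts as two-vertex connected, for $s=3$ it does not). $U$ is two-vertex connected on a time stamp set $T$ if it is so in $G_t$ for every $t\in T$. $U$ is a closed two-vertex connected vertex subset of $(G,\tau)$ if there is a nonempty interval $T=\{t,\dots,t+\ell\}\subseteq\mathcal T$ such that $U$ is two-vertex connected on $T$ and no proper superset of $U$ is two-vertex connected on $T$. Theorem. In a graph sequence $(G,\tau)$, all closed two-vertex connected vertex subsets can be enumerated in $O(|V|^2|E|^3)$ time. That is, for each $s\in\{2,3\}$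 there are a fixed program for the word RAM and constants $C,c$ such that on every graph sequence, given by the numbers $|V|,|E|,t_{\max}$ and, for each edge, its two end vertices and the two ends of its interval, and for every word length $w$ with $2^w\ge c\,(|V|+|E|+t_{\max}+1)^c$ (so words of $O(\log(|V|+|E|+t_{\max}+1))$ bits suffice), the program halts after at most $C(|V|^2|E|^3+1)$ elementary steps and has then output every closed two-vertex connected vertex subset exactly once, as a list of its vertices without repetition, and nothing else. -/

import Mathlib

/-! ### Graph sequences -/

/-- A graph sequence `(G, τ)` under the interval assumption. The vertex set of `G` is `Fin n`, the
edges are indexed by `Fin m` (parallel edges are allowed, loops are not), the ground time stamp set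
is `{1, …, tmax}`, and edge `e` is active exactly during the nonempty interval
`{first e, …, last e}`. An edge that is active during several intervals is given as several
parallel edges. -/
structure GraphSequence where
  n : ℕ
  m : ℕ
  tmax : ℕ
  tail : Fin m → Fin n
  head : Fin m → Fin n
  first : Fin m → ℕ
  last : Fin m → ℕ
  tail_ne_head : ∀ e, tail e ≠ head e
  one_le_first : ∀ e, 1 ≤ first e
  first_le_last : ∀ e, first e ≤ last e
  last_le_tmax : ∀ e, last e ≤ tmax

/-- `U` is a two-vertex connected vertex subset of `H`: it has at least `s` vertices, the subgraph
induced by `U` is connected, and it stays connected when any one vertex is deleted. The threshold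
`s` fixes the convention: with `s = 2` a single edge counts as two-vertex connected, with `s = 3`
it does not. -/
def TwoVertexConnected {V : Type*} [DecidableEq V] (s : ℕ) (H : SimpleGraph V) (U : Finset V) :
    Prop :=
  s ≤ U.card ∧ (H.induce (U : Set V)).Connected ∧
    ∀ v ∈ U, (H.induce (U.erase v : Set V)).Connected

/-- A time stamp set is an interval if it has the form `{t, t + 1, …, t + ℓ}` with `0 ≤ ℓ`. -/
def IsTimeInterval (T : Finset ℕ) : Prop :=
  ∃ t l : ℕ, T = Finset.Icc t (t + l)

namespace GraphSequence

/-- The ground time stamp set. -/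
def stamps (G : GraphSequence) : Finset ℕ := Finset.Icc 1 G.tmax

/-- The active time stamp set of an edge. -/
def τ (G : GraphSequence) (e : Fin G.m) : Finset ℕ := Finset.Icc (G.first e) (G.last e)

/-- The graph `G_t` of all edges that are active at time stamp `t`. -/
def snapshot (G : GraphSequence) (t : ℕ) : SimpleGraph (Fin G.n) where
  Adj u v := ∃ e, t ∈ G.τ e ∧
    ((G.tail e = u ∧ G.head e = v) ∨ (G.tail e = v ∧ G.head e = u))
  symm := ⟨by
    rintro u v ⟨e, he, h⟩
    exact ⟨e, he, h.symm⟩⟩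
  loopless := ⟨by
    rintro u ⟨e, _, h⟩
    rcases h with ⟨h1, h2⟩ | ⟨h1, h2⟩ <;> exact G.tail_ne_head e (h1.trans h2.symm)⟩

open Classical in
/-- The set of all time stamps at which `U` is two-vertex connected. -/
noncomputable def γ (G : GraphSequence) (s : ℕ) (U : Finset (Fin G.n)) : Finset ℕ :=
  G.stamps.filter fun t => TwoVertexConnected s (G.snapshot t) U

/-- `U` is two-vertex connected on the time stamp set `T`, that is, at every time stamp of `T`. -/
def ConnectedOn (G : GraphSequence) (s : ℕ) (T : Finset ℕ) (U : Finset (Fin G.n)) : Prop :=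
  T ⊆ G.γ s U

/-- `U` is a closed two-vertex connected vertex subset on `T`: it is two-vertex connected on `T`
and no proper superset of it is. -/
def ClosedOn (G : GraphSequence) (s : ℕ) (T : Finset ℕ) (U : Finset (Fin G.n)) : Prop :=
  G.ConnectedOn s T U ∧ ∀ U' : Finset (Fin G.n), U ⊂ U' → ¬ G.ConnectedOn s T U'

/-- `U` is a closed two-vertex connected vertex subset of the graph sequence: it is so on some
interval time stamp set. -/
def IsClosedSubset (G : GraphSequence) (s : ℕ) (U : Finset (Fin G.n)) : Prop :=
  ∃ T : Finset ℕ, IsTimeInterval T ∧ T ⊆ G.stamps ∧ G.ClosedOn s T U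

/-- No proper superset of a closed subset is two-vertex connected at exactly the same time
stamps. -/
theorem ClosedOn.gamma_ne {G : GraphSequence} {s : ℕ} {T : Finset ℕ} {U U' : Finset (Fin G.n)}
    (h : G.ClosedOn s T U) (hU : U ⊂ U') : G.γ s U ≠ G.γ s U' := fun he =>
  h.2 U' hU (by unfold ConnectedOn; rw [← he]; exact h.1)

end GraphSequence

/-! ### A word RAM with a step count

Programs work on registers, on arrays with random access, and on an output tape that can only be
appended to. Registers and arrays are named by natural numbers; a fixed program mentions only
finitely many names. All values are words of `w` bits, and every elementary operation costs one
step. -/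

namespace WordRAM

/-- Expressions. -/
inductive Expr where
  | const (k : ℕ)
  | reg (x : ℕ)
  | get (A : ℕ) (i : Expr)
  | add (a b : Expr)
  | sub (a b : Expr)
  | mul (a b : Expr)
  | lt (a b : Expr)
  | eq (a b : Expr)

/-- Programs: register assignment, array update, output of a word, sequencing, branching and
while loops. -/
inductive Cmd where
  | skip
  | set (x : ℕ) (e : Expr)
  | put (A : ℕ) (i e : Expr)
  | emit (e : Expr)
  | seq (c d : Cmd)
  | ite (e : Expr) (c d : Cmd)
  | loop (e : Expr) (c : Cmd)

/-- The registers, the arrays, and the output written so far. -/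
structure State where
  reg : ℕ → ℕ
  arr : ℕ → ℕ → ℕ
  out : List ℕ

/-- The value of an expression for word length `w`: addition and multiplication are modulo `2 ^ w`,
subtraction is truncated at `0`, and a comparison has the value `1` or `0`. -/
def Expr.eval (w : ℕ) (σ : State) : Expr → ℕ
  | .const k => k % 2 ^ w
  | .reg x => σ.reg x
  | .get A i => σ.arr A (i.eval w σ)
  | .add a b => (a.eval w σ + b.eval w σ) % 2 ^ w
  | .sub a b => a.eval w σ - b.eval w σ
  | .mul a b => (a.eval w σ * b.eval w σ) % 2 ^ w
  | .lt a b => if a.eval w σ < b.eval w σ then 1 else 0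
  | .eq a b => if a.eval w σ = b.eval w σ then 1 else 0

/-- The number of elementary operations in the evaluation of an expression. -/
def Expr.cost : Expr → ℕ
  | .const _ => 1
  | .reg _ => 1
  | .get _ i => i.cost + 1
  | .add a b => a.cost + b.cost + 1
  | .sub a b => a.cost + b.cost + 1
  | .mul a b => a.cost + b.cost + 1
  | .lt a b => a.cost + b.cost + 1
  | .eq a b => a.cost + b.cost + 1

/-- Write `v` into register `x`. -/
def State.setReg (σ : State) (x v : ℕ) : State :=
  { σ with reg := Function.update σ.reg x v }

/-- Write `v` into cell `i` of array `A`. -/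
def State.setArr (σ : State) (A i v : ℕ) : State :=
  { σ with arr := Function.update σ.arr A (Function.update (σ.arr A) i v) }

/-- Append `v` to the output. -/
def State.write (σ : State) (v : ℕ) : State :=
  { σ with out := σ.out ++ [v] }

/-- `Exec w c σ k σ'`: with word length `w`, program `c` started in state `σ` halts in state `σ'`
after exactly `k` steps. -/
inductive Exec (w : ℕ) : Cmd → State → ℕ → State → Prop where
  | skip (σ : State) : Exec w .skip σ 1 σ
  | set (σ : State) (x : ℕ) (e : Expr) :
      Exec w (.set x e) σ (e.cost + 1) (σ.setReg x (e.eval w σ))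
  | put (σ : State) (A : ℕ) (i e : Expr) :
      Exec w (.put A i e) σ (i.cost + e.cost + 1) (σ.setArr A (i.eval w σ) (e.eval w σ))
  | emit (σ : State) (e : Expr) :
      Exec w (.emit e) σ (e.cost + 1) (σ.write (e.eval w σ))
  | seq {c d : Cmd} {σ σ₁ σ₂ : State} {k l : ℕ} :
      Exec w c σ k σ₁ → Exec w d σ₁ l σ₂ → Exec w (.seq c d) σ (k + l) σ₂
  | ite_true {e : Expr} {c d : Cmd} {σ σ₁ : State} {k : ℕ} :
      e.eval w σ ≠ 0 → Exec w c σ k σ₁ → Exec w (.ite e c d) σ (e.cost + 1 + k) σ₁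
  | ite_false {e : Expr} {c d : Cmd} {σ σ₁ : State} {k : ℕ} :
      e.eval w σ = 0 → Exec w d σ k σ₁ → Exec w (.ite e c d) σ (e.cost + 1 + k) σ₁
  | loop_true {e : Expr} {c : Cmd} {σ σ₁ σ₂ : State} {k l : ℕ} :
      e.eval w σ ≠ 0 → Exec w c σ k σ₁ → Exec w (.loop e c) σ₁ l σ₂ →
      Exec w (.loop e c) σ (e.cost + 1 + k + l) σ₂
  | loop_false {e : Expr} {c : Cmd} {σ : State} :
      e.eval w σ = 0 → Exec w (.loop e c) σ (e.cost + 1) σ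

/-- Runs are deterministic: the final state and the number of steps are determined by the program
and the initial state. -/
theorem Exec.deterministic {w : ℕ} {c : Cmd} {σ σ₁ σ₂ : State} {k₁ k₂ : ℕ}
    (h₁ : Exec w c σ k₁ σ₁) (h₂ : Exec w c σ k₂ σ₂) : k₁ = k₂ ∧ σ₁ = σ₂ := by
  induction h₁ generalizing k₂ σ₂ with
  | skip | set | put | emit => cases h₂; exact ⟨rfl, rfl⟩
  | seq _ _ ih₁ ih₂ =>
    cases h₂ with
    | seq a b =>
      obtain ⟨rfl, rfl⟩ := ih₁ a
      obtain ⟨rfl, rfl⟩ := ih₂ b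
      exact ⟨rfl, rfl⟩
  | ite_true he _ ih =>
    cases h₂ with
    | ite_true _ a => obtain ⟨rfl, rfl⟩ := ih a; exact ⟨rfl, rfl⟩
    | ite_false h0 _ => exact absurd h0 he
  | ite_false he _ ih =>
    cases h₂ with
    | ite_true h0 _ => exact absurd he h0
    | ite_false _ a => obtain ⟨rfl, rfl⟩ := ih a; exact ⟨rfl, rfl⟩
  | loop_true he _ _ ih₁ ih₂ =>
    cases h₂ with
    | loop_true _ a b =>
      obtain ⟨rfl, rfl⟩ := ih₁ a
      obtain ⟨rfl, rfl⟩ := ih₂ b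
      exact ⟨rfl, rfl⟩
    | loop_false h0 => exact absurd h0 he
  | loop_false he =>
    cases h₂ with
    | loop_true h0 _ _ => exact absurd he h0
    | loop_false _ => exact ⟨rfl, rfl⟩

end WordRAM

/-! ### Input and output conventions -/

namespace GraphSequence

/-- The number by which a vertex is represented in the machine: the vertices are `1, …, n`. -/
def code {n : ℕ} (v : Fin n) : ℕ := v.val + 1

/-- Store a finite sequence in the cells `0, …, m - 1` of an array whose other cells are `0`. -/
def toArray {m : ℕ} (f : Fin m → ℕ) (i : ℕ) : ℕ := if h : i < m then f ⟨i, h⟩ else 0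

/-- The initial state of the machine on the graph sequence `G`: registers `0, 1, 2` hold the number
of vertices, the number of edges and the last time stamp; arrays `0, 1, 2, 3` hold, for each edge,
its two end vertices and the two ends of its time interval; everything else is `0`, and the output
is empty. -/
def input (G : GraphSequence) : WordRAM.State where
  reg x := match x with
    | 0 => G.n
    | 1 => G.m
    | 2 => G.tmax
    | _ => 0
  arr A := match A with
    | 0 => toArray fun e => code (G.tail e)
    | 1 => toArray fun e => code (G.head e)
    | 2 => toArray G.first
    | 3 => toArray G.last
    | _ => fun _ => 0
  out := []

/-- The output of a list of vertex lists: each vertex list is followed by the end mark `0`. -/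
def encode {n : ℕ} (L : List (List (Fin n))) : List ℕ :=
  L.flatMap fun l => l.map code ++ [0]

/-- The output `o` lists every closed two-vertex connected vertex subset of `G` exactly once, and
nothing else; each subset is written as a list of its vertices without repetition. -/
def Enumerates (G : GraphSequence) (s : ℕ) (o : List ℕ) : Prop :=
  ∃ L : List (List (Fin G.n)), o = encode L ∧ (∀ l ∈ L, l.Nodup) ∧
    (L.map List.toFinset).Nodup ∧
    ∀ U : Finset (Fin G.n), U ∈ L.map List.toFinset ↔ G.IsClosedSubset s U

end GraphSequence

/-! Extending a time interval to the left for as long as `U` stays two-vertex connected, one may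
assume that it begins when some edge becomes active (`IsClosedSubset.exists_start`). So at most |E|
start stamps `a` matter. For each of them the whole vertex set is refined as follows. Given a set
`U`, let `t ≥ a` be the first stamp at which `U` is not two-vertex connected. Some search in `U`,
with at most one vertex `v` deleted, reaches only a part `S` of what remains. A set that is
two-vertex connected at `t` cannot meet both `S` and `U \ (S ∪ {v})`, because it stays connected
without `v`. Hence every such subset of `U` lies in `S ∪ {v}` or in `U \ S`
(`splits_of_separation`), and these two sets replace `U`.

Every set in the work list carries a bar: the largest of `a` and the stamps at which its ancestors
were split. The invariant `Item.Valid` says that a set which is two-vertex connected on `[a, bar]`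
and shares two vertices with `U` lies in `U`; it is inherited because the two parts share at most
one vertex (`Item.Valid.child`). Hence, if `bar < t`, then `U` is closed on `[a, t - 1]`
(`Item.Valid.isClosedSubset`). Conversely, let `U` be closed on `[a, b]`. It stays inside an item
with start `a` and bar at most `b`: a proper superset fails at some `t ≤ b` by maximality of `U`,
and `U` passes into one of the parts. When the item is `U` itself, the first failure comes after `b`
and `U` is recorded (`Progress.split`). Different starts can yield the same set. Vertex lists are
always increasing, so a trie of lists recognises repetitions.

For the running time, an item with `k` vertices has weight `3k² - 2`. Splitting lowers the total
weight by at least `k` (`weight_add_weight_le`), so the sizes of all processed items add up to at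
most `3|V|²|E|`. A set can fail for the first time only at `a` or right after the last stamp of an
edge, so at most |E| + 2 tests are made per item. A test makes at most |U| + 1 searches, and a
search takes O(|E| + 1) steps, as marks carry increasing numbers and are never cleared. Processing
`U` thus costs O(|U|(|E| + 1)²) (`process_spec`), and the sum is O(|V|²|E|³). The word length enters
only through `Capacity`, which keeps all addresses, marks and node numbers below `2 ^ w`. -/

namespace WordRAM

/-! ### Weakest preconditions with exact cost -/

/-- Program `c` halts from `σ`, and its cost and final state satisfy `Q`. -/
def WP (w : ℕ) (c : Cmd) (Q : ℕ → State → Prop) (σ : State) : Prop :=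
  ∃ k σ', Exec w c σ k σ' ∧ Q k σ'

theorem WP.mono {w : ℕ} {c : Cmd} {Q R : ℕ → State → Prop} {σ : State} (h : WP w c Q σ)
    (hQR : ∀ k σ', Q k σ' → R k σ') : WP w c R σ := by
  obtain ⟨k, σ', he, hq⟩ := h
  exact ⟨k, σ', he, hQR _ _ hq⟩

theorem wp_skip {w : ℕ} {Q : ℕ → State → Prop} {σ : State} :
    WP w .skip Q σ ↔ Q 1 σ := by
  constructor
  · rintro ⟨k, σ', he, hq⟩
    cases he
    exact hq
  · exact fun h => ⟨_, _, .skip σ, h⟩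

theorem wp_set {w x : ℕ} {e : Expr} {Q : ℕ → State → Prop} {σ : State} :
    WP w (.set x e) Q σ ↔ Q (e.cost + 1) (σ.setReg x (e.eval w σ)) := by
  constructor
  · rintro ⟨k, σ', he, hq⟩
    cases he
    exact hq
  · exact fun h => ⟨_, _, .set σ x e, h⟩

theorem wp_put {w A : ℕ} {i e : Expr} {Q : ℕ → State → Prop} {σ : State} :
    WP w (.put A i e) Q σ ↔
      Q (i.cost + e.cost + 1) (σ.setArr A (i.eval w σ) (e.eval w σ)) := by
  constructor
  · rintro ⟨k, σ', he, hq⟩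
    cases he
    exact hq
  · exact fun h => ⟨_, _, .put σ A i e, h⟩

theorem wp_emit {w : ℕ} {e : Expr} {Q : ℕ → State → Prop} {σ : State} :
    WP w (.emit e) Q σ ↔ Q (e.cost + 1) (σ.write (e.eval w σ)) := by
  constructor
  · rintro ⟨k, σ', he, hq⟩
    cases he
    exact hq
  · exact fun h => ⟨_, _, .emit σ e, h⟩

theorem wp_seq {w : ℕ} {c d : Cmd} {Q : ℕ → State → Prop} {σ : State} :
    WP w (.seq c d) Q σ ↔ WP w c (fun k σ₁ => WP w d (fun l => Q (k + l)) σ₁) σ := by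
  constructor
  · rintro ⟨k, σ', he, hq⟩
    cases he with
    | seq a b => exact ⟨_, _, a, _, _, b, hq⟩
  · rintro ⟨k, σ₁, a, l, σ₂, b, hq⟩
    exact ⟨_, _, .seq a b, hq⟩

theorem wp_ite {w : ℕ} {e : Expr} {c d : Cmd} {Q : ℕ → State → Prop} {σ : State} :
    WP w (.ite e c d) Q σ ↔
      (e.eval w σ ≠ 0 → WP w c (fun k => Q (e.cost + 1 + k)) σ) ∧
      (e.eval w σ = 0 → WP w d (fun k => Q (e.cost + 1 + k)) σ) := by
  constructor
  · rintro ⟨k, σ', he, hq⟩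
    cases he with
    | ite_true h a => exact ⟨fun _ => ⟨_, _, a, hq⟩, fun h' => absurd h' h⟩
    | ite_false h a => exact ⟨fun h' => absurd h h', fun _ => ⟨_, _, a, hq⟩⟩
  · rintro ⟨h₁, h₂⟩
    by_cases h : e.eval w σ = 0
    · obtain ⟨k, σ', a, hq⟩ := h₂ h
      exact ⟨_, _, .ite_false h a, hq⟩
    · obtain ⟨k, σ', a, hq⟩ := h₁ h
      exact ⟨_, _, .ite_true h a, hq⟩

/-! ### What a program leaves unchanged -/

/-- The registers a program may write to. -/
def Cmd.regs : Cmd → List ℕ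
  | .set x _ => [x]
  | .seq c d => c.regs ++ d.regs
  | .ite _ c d => c.regs ++ d.regs
  | .loop _ c => c.regs
  | _ => []

/-- The arrays a program may write to. -/
def Cmd.arrs : Cmd → List ℕ
  | .put A _ _ => [A]
  | .seq c d => c.arrs ++ d.arrs
  | .ite _ c d => c.arrs ++ d.arrs
  | .loop _ c => c.arrs
  | _ => []

/-- Whether a program contains no output command. -/
def Cmd.quiet : Cmd → Bool
  | .emit _ => false
  | .seq c d => c.quiet && d.quiet
  | .ite _ c d => c.quiet && d.quiet
  | .loop _ c => c.quiet
  | _ => true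

/-- `σ'` differs from `σ` at most in the places that `c` may write to. -/
structure Frame (c : Cmd) (σ σ' : State) : Prop where
  reg : ∀ x, x ∉ c.regs → σ'.reg x = σ.reg x
  arr : ∀ A, A ∉ c.arrs → σ'.arr A = σ.arr A
  out : c.quiet = true → σ'.out = σ.out

theorem Frame.refl (c : Cmd) (σ : State) : Frame c σ σ :=
  ⟨fun _ _ => rfl, fun _ _ => rfl, fun _ => rfl⟩

theorem Frame.trans {c : Cmd} {σ₁ σ₂ σ₃ : State} (h : Frame c σ₁ σ₂) (h' : Frame c σ₂ σ₃) :
    Frame c σ₁ σ₃ :=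
  ⟨fun x hx => (h'.reg x hx).trans (h.reg x hx), fun A hA => (h'.arr A hA).trans (h.arr A hA),
    fun hq => (h'.out hq).trans (h.out hq)⟩

theorem Frame.mono {c d : Cmd} {σ σ' : State} (h : Frame c σ σ') (hr : c.regs ⊆ d.regs)
    (ha : c.arrs ⊆ d.arrs) (hq : d.quiet = true → c.quiet = true) : Frame d σ σ' :=
  ⟨fun x hx => h.reg x fun hx' => hx (hr hx'), fun A hA => h.arr A fun hA' => hA (ha hA'),
    fun hd => h.out (hq hd)⟩

/-- The write sets are computed from the program text. Everything a loop body does not mention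
therefore survives it without being carried in the invariant, and the side conditions for concrete
programs are decidable. -/
theorem Exec.frame {w : ℕ} {c : Cmd} {σ σ' : State} {k : ℕ} (h : Exec w c σ k σ') :
    Frame c σ σ' := by
  induction h with
  | skip σ => exact Frame.refl _ _
  | set σ x e =>
    refine ⟨fun y hy => ?_, fun _ _ => rfl, fun _ => rfl⟩
    have : y ≠ x := by simpa [Cmd.regs] using hy
    simp [State.setReg, this]
  | put σ A i e =>
    refine ⟨fun _ _ => rfl, fun B hB => ?_, fun _ => rfl⟩
    have : B ≠ A := by simpa [Cmd.arrs] using hB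
    simp [State.setArr, this]
  | emit σ e => exact ⟨fun _ _ => rfl, fun _ _ => rfl, fun h => by simp [Cmd.quiet] at h⟩
  | seq _ _ ih₁ ih₂ =>
    refine Frame.trans (ih₁.mono ?_ ?_ ?_) (ih₂.mono ?_ ?_ ?_) <;>
      simp +contextual [Cmd.regs, Cmd.arrs, Cmd.quiet]
  | ite_true _ _ ih => refine ih.mono ?_ ?_ ?_ <;> simp +contextual [Cmd.regs, Cmd.arrs, Cmd.quiet]
  | ite_false _ _ ih => refine ih.mono ?_ ?_ ?_ <;> simp +contextual [Cmd.regs, Cmd.arrs, Cmd.quiet]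
  | loop_true _ _ _ ih₁ ih₂ =>
    exact Frame.trans (ih₁.mono (by simp [Cmd.regs]) (by simp [Cmd.arrs]) (by simp [Cmd.quiet])) ih₂
  | loop_false _ => exact Frame.refl _ _

theorem WP.frame {w : ℕ} {c : Cmd} {Q : ℕ → State → Prop} {σ : State} (h : WP w c Q σ) :
    WP w c (fun k σ' => Q k σ' ∧ Frame c σ σ') σ := by
  obtain ⟨k, σ', he, hq⟩ := h
  exact ⟨k, σ', he, hq, he.frame⟩

/-! ### Loops -/

/-- A while loop, with an invariant that carries ghost data `a : α` and a potential that pays for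
the remaining iterations. -/
theorem wp_loop {α : Type*} {w : ℕ} {e : Expr} {c : Cmd} {σ : State} (I : α → State → Prop)
    (pot : α → ℕ) (a : α) (h0 : I a σ)
    (hstep : ∀ a σ', Frame (.loop e c) σ σ' → I a σ' → e.eval w σ' ≠ 0 →
      WP w c (fun k σ'' => ∃ b, I b σ'' ∧ k + e.cost + 1 + pot b ≤ pot a) σ') :
    WP w (.loop e c) (fun k σ' => k ≤ pot a + e.cost + 1 ∧ (∃ b, I b σ') ∧ e.eval w σ' = 0 ∧
      Frame (.loop e c) σ σ') σ := by
  -- Induction on a bound for the potential. Each round consumes at least one unit, for the guard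
  -- alone, so potential 0 leaves no further round and termination comes with the cost bound.
  suffices H : ∀ N a σ', pot a ≤ N → Frame (.loop e c) σ σ' → I a σ' →
      WP w (.loop e c) (fun k σ'' => k ≤ pot a + e.cost + 1 ∧ (∃ b, I b σ'') ∧
        e.eval w σ'' = 0) σ' by
    refine (H _ a σ le_rfl (Frame.refl _ _) h0).frame.mono ?_
    rintro k σ' ⟨⟨h₁, h₂, h₃⟩, h₄⟩
    exact ⟨h₁, h₂, h₃, h₄⟩
  intro N
  induction N with
  | zero =>
    intro a σ' hN hF hI
    by_cases he : e.eval w σ' = 0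
    · exact ⟨_, _, .loop_false he, by omega, ⟨a, hI⟩, he⟩
    · obtain ⟨k, σ'', hx, b, hb, hk⟩ := hstep a σ' hF hI he
      omega
  | succ N ih =>
    intro a σ' hN hF hI
    by_cases he : e.eval w σ' = 0
    · exact ⟨_, _, .loop_false he, by omega, ⟨a, hI⟩, he⟩
    · obtain ⟨k, σ'', hx, b, hb, hk⟩ := hstep a σ' hF hI he
      have hF' : Frame (.loop e c) σ σ'' :=
        hF.trans (hx.frame.mono (by simp [Cmd.regs]) (by simp [Cmd.arrs]) (by simp [Cmd.quiet]))
      obtain ⟨l, σ₃, hl, h₁, h₂, h₃⟩ := ih b σ'' (by omega) hF' hb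
      exact ⟨_, _, .loop_true he hx hl, by omega, h₂, h₃⟩

/-- Run `c` for `x = 0, …, N - 1`. -/
def Cmd.for (x : ℕ) (N : Expr) (c : Cmd) : Cmd :=
  .seq (.set x (.const 0))
    (.loop (.lt (.reg x) N) (.seq c (.set x (.add (.reg x) (.const 1)))))

/-- Besides the body, a round pays `N.cost + 3` for the guard and 4 for the increment;
initialisation and the last guard pay `N.cost + 5`. The counter does not wrap because `n < 2 ^ w`.
The invariant is required after the increment, so it may mention the counter. -/
theorem wp_for {w x : ℕ} {N : Expr} {c : Cmd} {σ : State} (I : ℕ → State → Prop) (K n : ℕ)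
    (hn : n < 2 ^ w) (hx : x ∉ c.regs)
    (hN : ∀ σ', Frame (.for x N c) σ σ' → N.eval w σ' = n)
    (h0 : I 0 (σ.setReg x 0))
    (hstep : ∀ i, i < n → ∀ σ', Frame (.for x N c) σ σ' → σ'.reg x = i → I i σ' →
      WP w c (fun k σ'' => k ≤ K ∧ I (i + 1) (σ''.setReg x (i + 1))) σ') :
    WP w (.for x N c) (fun k σ' => k ≤ n * (K + N.cost + 7) + N.cost + 5 ∧ I n σ' ∧
      Frame (.for x N c) σ σ') σ := by
  have hF0 : Frame (.for x N c) σ (σ.setReg x 0) := by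
    refine ⟨fun y hy => ?_, fun _ _ => rfl, fun _ => rfl⟩
    have : y ≠ x := by
      rintro rfl
      exact hy (by simp [Cmd.for, Cmd.regs])
    simp [State.setReg, this]
  have hsub : ∀ σ', Frame (.loop (.lt (.reg x) N) (.seq c (.set x (.add (.reg x) (.const 1)))))
      (σ.setReg x 0) σ' → Frame (.for x N c) σ σ' := fun σ' h =>
    hF0.trans (h.mono (by simp [Cmd.for, Cmd.regs]) (by simp [Cmd.for, Cmd.arrs])
      (by simp [Cmd.for, Cmd.quiet]))
  rw [Cmd.for, wp_seq, wp_set]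
  have hc0 : (Expr.const 0).eval w σ = 0 := by simp [Expr.eval]
  rw [hc0]
  refine (wp_loop (fun i σ' => i ≤ n ∧ σ'.reg x = i ∧ I i σ')
    (fun i => (n - i) * (K + N.cost + 7)) 0 ⟨Nat.zero_le _, by simp [State.setReg], h0⟩ ?_).mono ?_
  · rintro i σ' hF ⟨hi, hxi, hI⟩ he
    have hNe := hN σ' (hsub _ hF)
    have hlt : i < n := by
      by_contra hge
      exact he (by simp [Expr.eval, hNe, hxi, hge])
    rw [wp_seq]
    refine (hstep i hlt σ' (hsub _ hF) hxi hI).frame.mono ?_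
    rintro k σ'' ⟨⟨hk, hI'⟩, hF'⟩
    have hx' : σ''.reg x = i := by rw [hF'.reg x hx, hxi]
    have h1 : (i + 1 % 2 ^ w) % 2 ^ w = i + 1 := by
      rw [Nat.mod_eq_of_lt (a := 1) (by omega), Nat.mod_eq_of_lt (by omega)]
    rw [wp_set]
    refine ⟨i + 1, ⟨hlt, ?_, ?_⟩, ?_⟩
    · simp [State.setReg, Expr.eval, hx', h1]
    · simpa [Expr.eval, hx', h1] using hI'
    · simp only [Expr.cost]
      obtain ⟨d, rfl⟩ : ∃ d, n = i + 1 + d := ⟨n - (i + 1), by omega⟩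
      have h2 : i + 1 + d - i = d + 1 := by omega
      have h3 : i + 1 + d - (i + 1) = d := by omega
      rw [h2, h3, Nat.succ_mul]
      omega
  · rintro k σ' ⟨hk, ⟨i, hi, hxi, hI⟩, he, hF⟩
    have hNe := hN σ' (hsub _ hF)
    have : i = n := by
      simp only [Expr.eval, hNe, hxi, ite_eq_right_iff, one_ne_zero, imp_false] at he
      omega
    subst this
    refine ⟨?_, hI, hsub _ hF⟩
    simp only [Expr.cost, Nat.sub_zero] at hk ⊢
    omega

/-! ### Reading updated states -/

theorem Expr.lt_eval_ne_zero {w : ℕ} {σ : State} {a b : Expr} :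
    (Expr.lt a b).eval w σ ≠ 0 ↔ a.eval w σ < b.eval w σ := by
  simp [Expr.eval]

theorem Expr.lt_eval_eq_zero {w : ℕ} {σ : State} {a b : Expr} :
    (Expr.lt a b).eval w σ = 0 ↔ b.eval w σ ≤ a.eval w σ := by
  simp [Expr.eval]

@[simp] theorem State.setReg_reg (σ : State) (x v y : ℕ) :
    (σ.setReg x v).reg y = if y = x then v else σ.reg y := by
  simp [State.setReg, Function.update_apply]

@[simp] theorem State.setReg_arr (σ : State) (x v : ℕ) : (σ.setReg x v).arr = σ.arr := rfl

@[simp] theorem State.setReg_out (σ : State) (x v : ℕ) : (σ.setReg x v).out = σ.out := rfl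

@[simp] theorem State.setArr_reg (σ : State) (A i v : ℕ) : (σ.setArr A i v).reg = σ.reg := rfl

@[simp] theorem State.setArr_out (σ : State) (A i v : ℕ) : (σ.setArr A i v).out = σ.out := rfl

theorem State.setArr_arr (σ : State) (A i v B : ℕ) :
    (σ.setArr A i v).arr B = if B = A then Function.update (σ.arr A) i v else σ.arr B := by
  simp [State.setArr, Function.update_apply]

theorem State.setArr_arr_self (σ : State) (A i v j : ℕ) :
    (σ.setArr A i v).arr A j = if j = i then v else σ.arr A j := by
  simp [State.setArr, Function.update_apply]

theorem State.setArr_arr_ne (σ : State) {A B : ℕ} (i v : ℕ) (h : B ≠ A) :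
    (σ.setArr A i v).arr B = σ.arr B := by
  simp [State.setArr, h]

@[simp] theorem State.write_out (σ : State) (v : ℕ) : (σ.write v).out = σ.out ++ [v] := rfl

end WordRAM

/-! ### Separations of graphs -/

section Separation

variable {V : Type*} {H : SimpleGraph V}

/-- `A` and `B` cover `U`, are proper nonempty subsets of it, share at most one vertex, and every
two-vertex connected subset of `U` lies in one of them. -/
structure Splits [DecidableEq V] (s : ℕ) (H : SimpleGraph V) (U A B : Finset V) : Prop where
  left : A ⊂ U
  right : B ⊂ U
  left_nonempty : A.Nonempty
  right_nonempty : B.Nonempty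
  inter : (A ∩ B).card ≤ 1
  refines : ∀ W ⊆ U, TwoVertexConnected s H W → W ⊆ A ∨ W ⊆ B

theorem Splits.not_connected [DecidableEq V] {s : ℕ} {U A B : Finset V} (h : Splits s H U A B) :
    ¬ TwoVertexConnected s H U := fun hU => by
  rcases h.refines U subset_rfl hU with h' | h'
  · exact h.left.2 h'
  · exact h.right.2 h'

theorem Splits.card_add_card_le [DecidableEq V] {s : ℕ} {U A B : Finset V} (h : Splits s H U A B) :
    A.card + B.card ≤ U.card + 1 := by
  have h₁ := Finset.card_union_add_card_inter A B
  have h₂ := Finset.card_le_card (Finset.union_subset h.left.1 h.right.1)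
  have h₃ := h.inter
  omega

/-- A connected set that meets both `S` and its complement contains an edge between them. -/
theorem exists_adj_of_connected {Z : Set V} (hZ : (H.induce Z).Connected) (S : Set V) {x y : V}
    (hx : x ∈ Z) (hxS : x ∈ S) (hy : y ∈ Z) (hyS : y ∉ S) :
    ∃ a ∈ Z, ∃ b ∈ Z, a ∈ S ∧ b ∉ S ∧ H.Adj a b := by
  obtain ⟨p⟩ := hZ.preconnected ⟨x, hx⟩ ⟨y, hy⟩
  obtain ⟨d, -, h₁, h₂⟩ := p.exists_boundary_dart (Subtype.val ⁻¹' S) hxS hyS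
  exact ⟨d.fst, d.fst.2, d.snd, d.snd.2, h₁, h₂, d.adj⟩

/-- A set `S` without edges to the rest of `U \ X`, where `X` has at most one vertex, splits `U`. -/
theorem splits_of_separation [DecidableEq V] {s : ℕ} {U S X : Finset V} (hX : X.card ≤ 1) (hXU : X ⊆ U)
    (hS : S ⊆ U) (hSX : Disjoint S X) (hSne : S.Nonempty) (hrest : ∃ y ∈ U, y ∉ S ∧ y ∉ X)
    (hno : ∀ x ∈ S, ∀ y ∈ U, y ∉ S → y ∉ X → ¬ H.Adj x y) :
    Splits s H U (S ∪ X) (U \ S) where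
  left := by
    obtain ⟨y, hy, hyS, hyX⟩ := hrest
    refine ⟨Finset.union_subset hS hXU, fun h => ?_⟩
    simpa [hyS, hyX] using h hy
  right := by
    obtain ⟨x, hx⟩ := hSne
    refine ⟨Finset.sdiff_subset, fun h => ?_⟩
    simpa [hx] using h (hS hx)
  left_nonempty := hSne.mono Finset.subset_union_left
  right_nonempty := by
    obtain ⟨y, hy, hyS, -⟩ := hrest
    exact ⟨y, by simp [hy, hyS]⟩
  inter := by
    refine (Finset.card_le_card fun z hz => ?_).trans hX
    simp only [Finset.mem_inter, Finset.mem_union, Finset.mem_sdiff] at hz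
    tauto
  refines := by
    intro W hWU hW
    by_contra! hcon
    obtain ⟨hA, hB⟩ := hcon
    obtain ⟨y, hyW, hy⟩ := Finset.not_subset.1 hA
    obtain ⟨x, hxW, hx⟩ := Finset.not_subset.1 hB
    have hyS : y ∉ S := fun h => hy (Finset.mem_union_left _ h)
    have hyX : y ∉ X := fun h => hy (Finset.mem_union_right _ h)
    have hxS : x ∈ S := by
      by_contra h
      exact hx (by simp [hWU hxW, h])
    have hxX : x ∉ X := Finset.disjoint_left.1 hSX hxS
    -- `Z` is `W` without the vertex of `X`, or `W` itself if it avoids `X`. Either way it is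
    -- connected and still contains `x` and `y`, so one of its edges leaves `S` without ending in
    -- `X`.
    obtain ⟨Z, hZ, hZW, hZX, hxZ, hyZ⟩ : ∃ Z : Set V, (H.induce Z).Connected ∧ Z ⊆ W ∧
        (∀ z ∈ Z, z ∉ X) ∧ x ∈ Z ∧ y ∈ Z := by
      by_cases hv : ∃ v ∈ W, v ∈ X
      · obtain ⟨v, hvW, hvX⟩ := hv
        refine ⟨_, hW.2.2 v hvW, by simp, ?_, ?_, ?_⟩
        · intro z hz hzX
          have hz' : z ≠ v := by
            simp only [Finset.coe_erase, Set.mem_sdiff, Set.mem_singleton_iff] at hz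
            exact hz.2
          exact hz' (Finset.card_le_one.1 hX z hzX v hvX)
        · simpa [hxW] using fun h : x = v => hxX (h ▸ hvX)
        · simpa [hyW] using fun h : y = v => hyX (h ▸ hvX)
      · push Not at hv
        exact ⟨W, hW.2.1, subset_rfl, fun z hz => hv z hz, hxW, hyW⟩
    obtain ⟨a, haZ, b, hbZ, haS, hbS, hab⟩ := exists_adj_of_connected hZ S hxZ hxS hyZ hyS
    exact hno a haS b (hWU (hZW hbZ)) hbS (hZX b hbZ) hab

/-- If every vertex of `Z` can be reached from a fixed one inside `Z`, then `Z` is connected. -/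
theorem connected_induce_of_reach {Z : Set V} {x : V} (hx : x ∈ Z)
    (h : ∀ y ∈ Z, Relation.ReflTransGen (fun a b => H.Adj a b ∧ b ∈ Z) x y) :
    (H.induce Z).Connected := by
  have key : ∀ y, Relation.ReflTransGen (fun a b => H.Adj a b ∧ b ∈ Z) x y →
      ∃ hy : y ∈ Z, (H.induce Z).Reachable ⟨x, hx⟩ ⟨y, hy⟩ := by
    intro y hy
    induction hy with
    | refl => exact ⟨hx, .refl _⟩
    | tail _ hbc ih =>
      obtain ⟨hb, hr⟩ := ih
      exact ⟨hbc.2, hr.trans (SimpleGraph.Adj.reachable (by simpa using hbc.1))⟩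
  rw [SimpleGraph.connected_iff_exists_forall_reachable]
  exact ⟨⟨x, hx⟩, fun ⟨y, hy⟩ => (key y (h y hy)).2⟩

end Separation

namespace GraphSequence

/-! ### Time stamps at which a set ceases to be two-vertex connected -/

theorem exists_adj_of_twoVertexConnected {V : Type*} [DecidableEq V] {s : ℕ} (hs : 2 ≤ s)
    {H : SimpleGraph V} {U : Finset V} (h : TwoVertexConnected s H U) : ∃ a b, H.Adj a b := by
  obtain ⟨x, hx, y, hy, hxy⟩ := Finset.one_lt_card.1 (lt_of_lt_of_le (by omega) (hs.trans h.1))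
  obtain ⟨a, -, b, -, -, -, hab⟩ := exists_adj_of_connected h.2.1 {x} hx rfl hy
    (by simpa using hxy.symm)
  exact ⟨a, b, hab⟩

theorem twoVertexConnected_mono {V : Type*} [DecidableEq V] {s : ℕ} {H H' : SimpleGraph V}
    {U : Finset V} (hH : ∀ a b, H.Adj a b → H'.Adj a b) (h : TwoVertexConnected s H U) :
    TwoVertexConnected s H' U := by
  have key : ∀ Z : Set V, (H.induce Z).Connected → (H'.induce Z).Connected := fun Z hZ =>
    hZ.mono fun a b hab => hH _ _ hab
  exact ⟨h.1, key _ h.2.1, fun v hv => key _ (h.2.2 v hv)⟩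

variable {G : GraphSequence} {s : ℕ}

/-- A two-vertex connected set has two vertices and hence an edge, and edges are active only at
ground stamps. So `tmax + 1` is a failing stamp for every set, and stamp 0 stops any extension to
the left. -/
theorem mem_stamps_of_twoVertexConnected (hs : 2 ≤ s) {t : ℕ} {U : Finset (Fin G.n)}
    (h : TwoVertexConnected s (G.snapshot t) U) : 1 ≤ t ∧ t ≤ G.tmax := by
  obtain ⟨a, b, e, he, -⟩ := exists_adj_of_twoVertexConnected hs h
  have h' : G.first e ≤ t ∧ t ≤ G.last e := by simpa [τ] using he
  exact ⟨(G.one_le_first e).trans h'.1, h'.2.trans (G.last_le_tmax e)⟩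

/-- `t` is the first time stamp from `a` on at which `U` is not two-vertex connected. -/
def FirstFailure (G : GraphSequence) (s : ℕ) (U : Finset (Fin G.n)) (a t : ℕ) : Prop :=
  a ≤ t ∧ (∀ t', a ≤ t' → t' < t → TwoVertexConnected s (G.snapshot t') U) ∧
    ¬ TwoVertexConnected s (G.snapshot t) U

/-- A set can only cease to be two-vertex connected right after the last time stamp of an edge. -/
theorem exists_last_of_failure {U : Finset (Fin G.n)} {t : ℕ}
    (h : TwoVertexConnected s (G.snapshot t) U)
    (h' : ¬ TwoVertexConnected s (G.snapshot (t + 1)) U) : ∃ e, G.last e = t := by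
  by_contra! hcon
  refine h' (twoVertexConnected_mono (fun a b hab => ?_) h)
  obtain ⟨e, he, hab⟩ := hab
  refine ⟨e, ?_, hab⟩
  have := hcon e
  simp only [τ, Finset.mem_Icc] at he ⊢
  omega

/-- The mirror image of `exists_last_of_failure`: if no edge starts at `t + 1`, every edge active at
`t + 1` is already active at `t`, and more edges do no harm. -/
theorem exists_first_of_onset {U : Finset (Fin G.n)} {t : ℕ}
    (h : ¬ TwoVertexConnected s (G.snapshot t) U)
    (h' : TwoVertexConnected s (G.snapshot (t + 1)) U) : ∃ e, G.first e = t + 1 := by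
  by_contra! hcon
  refine h (twoVertexConnected_mono (fun a b hab => ?_) h')
  obtain ⟨e, he, hab⟩ := hab
  refine ⟨e, ?_, hab⟩
  have := hcon e
  simp only [τ, Finset.mem_Icc] at he ⊢
  omega

/-- Walking forward from `a`, connectivity can be lost only at a stamp `last e + 1`. If `a` and all
such stamps before `t` pass the test, then nothing between them fails. -/
theorem firstFailure_of_candidates {U : Finset (Fin G.n)} {a t : ℕ} (hat : a ≤ t)
    (ht : ¬ TwoVertexConnected s (G.snapshot t) U)
    (ha : a < t → TwoVertexConnected s (G.snapshot a) U)
    (hc : ∀ e, a ≤ G.last e + 1 → G.last e + 1 < t →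
      TwoVertexConnected s (G.snapshot (G.last e + 1)) U) : G.FirstFailure s U a t := by
  refine ⟨hat, ?_, ht⟩
  intro t' hat' ht't
  induction t', hat' using Nat.le_induction with
  | base => exact ha ht't
  | succ t' hle ih =>
    by_contra hcon
    obtain ⟨e, rfl⟩ := exists_last_of_failure (ih (by omega)) hcon
    exact hcon (hc e (by omega) ht't)

/-- Every closed subset is closed on an interval that starts with the first time stamp of an
edge. -/
theorem IsClosedSubset.exists_start (hs : 2 ≤ s) {U : Finset (Fin G.n)}
    (h : G.IsClosedSubset s U) : ∃ e b, G.first e ≤ b ∧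
      (∀ t ∈ Finset.Icc (G.first e) b, TwoVertexConnected s (G.snapshot t) U) ∧
      ∀ U', U ⊂ U' →
        ¬ ∀ t ∈ Finset.Icc (G.first e) b, TwoVertexConnected s (G.snapshot t) U' := by
  classical
  obtain ⟨T, ⟨t₀, l, rfl⟩, hT, hU, hmax⟩ := h
  have hU' : ∀ t ∈ Finset.Icc t₀ (t₀ + l), TwoVertexConnected s (G.snapshot t) U := fun t ht => by
    have := hU ht
    simp only [γ, Finset.mem_filter] at this
    exact this.2
  have hex : ∃ a, ∀ t ∈ Finset.Icc a (t₀ + l), TwoVertexConnected s (G.snapshot t) U := ⟨t₀, hU'⟩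
  -- The earliest start of an interval with the given right end on which `U` is two-vertex
  -- connected. By minimality `U` fails at `a - 1`, so some edge starts at `a`.
  set a := Nat.find hex with hadef
  have ha := Nat.find_spec hex
  have hat : a ≤ t₀ := Nat.find_min' hex hU'
  have ha1 := (mem_stamps_of_twoVertexConnected hs
    (ha a (Finset.mem_Icc.2 ⟨le_rfl, by omega⟩))).1
  obtain ⟨a', ha'⟩ : ∃ a', a = a' + 1 := ⟨a - 1, by omega⟩
  have hfail : ¬ TwoVertexConnected s (G.snapshot a') U := fun hcon => by
    refine Nat.find_min hex (m := a') (by omega) fun t ht => ?_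
    rcases (Finset.mem_Icc.1 ht).1.eq_or_lt with h | h
    · rwa [← h]
    · exact ha t (Finset.mem_Icc.2 ⟨by omega, (Finset.mem_Icc.1 ht).2⟩)
  obtain ⟨e, he⟩ := exists_first_of_onset hfail
    (ha' ▸ ha a (Finset.mem_Icc.2 ⟨le_rfl, by omega⟩))
  rw [← ha'] at he
  -- Enlarging the interval keeps `U` maximal: a superset that works on the longer interval works on
  -- the original one.
  refine ⟨e, t₀ + l, by omega, by rw [he]; exact ha, fun U' hUU' hcon => hmax U' hUU' fun t ht => ?_⟩
  simp only [γ, Finset.mem_filter]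
  refine ⟨hT ht, hcon t ?_⟩
  simp only [Finset.mem_Icc] at ht ⊢
  omega

/-! ### The work list -/

/-- An entry of the work list: a vertex set, as a list, the start of the time intervals that are
considered, and the last time stamp at which one of its supersets in the list was split. -/
structure Item (n : ℕ) where
  verts : List (Fin n)
  start : ℕ
  bar : ℕ

/-- An upper bound for the number of vertices in all descendants of an item. -/
def Item.weight {n : ℕ} (it : Item n) : ℕ := 3 * it.verts.length ^ 2 - 2

/-- Every set that is two-vertex connected from the start of the item up to its bar and shares two
vertices with it is contained in it. -/
structure Item.Valid (G : GraphSequence) (s : ℕ) (it : Item G.n) : Prop where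
  sublist : it.verts.Sublist (List.finRange G.n)
  ne_nil : it.verts ≠ []
  start_eq : ∃ e, it.start = G.first e
  start_le : it.start ≤ it.bar
  bar_le : it.bar ≤ G.tmax + 1
  absorbs : ∀ W : Finset (Fin G.n),
    (∀ t ∈ Finset.Icc it.start it.bar, TwoVertexConnected s (G.snapshot t) W) →
    2 ≤ (W ∩ it.verts.toFinset).card → W ⊆ it.verts.toFinset

/-- The total weight of the items of the work list `I` from item `h` on. -/
def pending {n : ℕ} (I : List (Item n)) (h : ℕ) : ℕ := ((I.drop h).map Item.weight).sum

/-- The state of the enumeration after `h` items of the work list `I` have been processed and the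
sets in `R` have been recorded. -/
structure Progress (G : GraphSequence) (s : ℕ) (I : List (Item G.n)) (h : ℕ)
    (R : List (List (Fin G.n))) : Prop where
  valid : ∀ it ∈ I, it.Valid G s
  nodup : R.Nodup
  sound : ∀ l ∈ R, l.Sublist (List.finRange G.n) ∧ G.IsClosedSubset s l.toFinset
  complete : ∀ e b (U : Finset (Fin G.n)), G.first e ≤ b →
    (∀ t ∈ Finset.Icc (G.first e) b, TwoVertexConnected s (G.snapshot t) U) →
    (∀ U', U ⊂ U' →
      ¬ ∀ t ∈ Finset.Icc (G.first e) b, TwoVertexConnected s (G.snapshot t) U') →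
    (∃ l ∈ R, l.toFinset = U) ∨
      ∃ it ∈ I.drop h, it.start = G.first e ∧ U ⊆ it.verts.toFinset ∧ it.bar ≤ b
  weight : h + pending I h ≤ 3 * G.n ^ 2 * G.m

/-- The initial work list. -/
def roots (G : GraphSequence) : List (Item G.n) :=
  (List.finRange G.m).map fun e => ⟨List.finRange G.n, G.first e, G.first e⟩

theorem progress_roots (G : GraphSequence) (s : ℕ) : G.Progress s G.roots 0 [] where
  valid := by
    simp only [roots, List.mem_map, List.mem_finRange, true_and]
    rintro it ⟨e, rfl⟩
    exact ⟨.refl _, List.ne_nil_of_mem (List.mem_finRange (G.tail e)), ⟨e, rfl⟩, le_rfl,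
      (G.first_le_last e).trans ((G.last_le_tmax e).trans (Nat.le_succ _)),
      fun W _ _ x _ => by simp⟩
  nodup := List.nodup_nil
  sound := by simp
  complete := by
    intro e b U hb _ _
    refine .inr ⟨⟨List.finRange G.n, G.first e, G.first e⟩, ?_, rfl, fun x _ => by simp, hb⟩
    simp only [roots, List.drop_zero, List.mem_map, List.mem_finRange, true_and]
    exact ⟨e, rfl⟩
  weight := by
    simp only [pending, roots, List.drop_zero, List.map_map, zero_add]
    have : (Item.weight ∘ fun e : Fin G.m =>
        (⟨List.finRange G.n, G.first e, G.first e⟩ : Item G.n)) = fun _ => 3 * G.n ^ 2 - 2 := by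
      ext e
      simp [Item.weight]
    rw [this]
    simp only [List.map_const', List.length_finRange, List.sum_replicate, smul_eq_mul]
    rw [mul_comm]
    exact Nat.mul_le_mul_right _ (Nat.sub_le _ _)

/-! ### Weights of items, and closed sets found by splitting -/

theorem Item.Valid.length_le_weight {it : Item G.n} (h : it.Valid G s) :
    it.verts.length ≤ it.weight := by
  have := List.length_pos_iff.2 h.ne_nil
  unfold Item.weight
  have : it.verts.length ^ 2 = it.verts.length * it.verts.length := sq _
  have : it.verts.length ≤ it.verts.length * it.verts.length := Nat.le_mul_self _
  omega

/-- Every waiting item weighs at least 1, so the weight invariant bounds the number of items ever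
created. This determines how many rows the arrays need. -/
theorem Progress.length_le {I : List (Item G.n)} {h : ℕ} {R : List (List (Fin G.n))}
    (hP : G.Progress s I h R) : I.length ≤ 3 * G.n ^ 2 * G.m := by
  have h₁ := hP.weight
  have h₂ : (I.drop h).length • 1 ≤ pending I h := by
    rw [pending, ← List.length_map (f := Item.weight)]
    refine List.card_nsmul_le_sum _ _ fun x hx => ?_
    obtain ⟨it, hit, rfl⟩ := List.mem_map.1 hx
    have hv := hP.valid it (List.mem_of_mem_drop hit)
    have := List.length_pos_iff.2 hv.ne_nil
    have := hv.length_le_weight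
    omega
  simp only [List.length_drop, smul_eq_mul, mul_one] at h₂
  omega

theorem drop_eq_cons {n : ℕ} {I : List (Item n)} {h : ℕ} {it : Item n} (hit : I[h]? = some it) :
    I.drop h = it :: I.drop (h + 1) := by
  obtain ⟨hlt, hget⟩ := List.getElem?_eq_some_iff.1 hit
  rw [List.drop_eq_getElem_cons hlt, hget]

theorem pending_eq_add {n : ℕ} {I : List (Item n)} {h : ℕ} {it : Item n} (hit : I[h]? = some it) :
    pending I h = it.weight + pending I (h + 1) := by
  rw [pending, drop_eq_cons hit, List.map_cons, List.sum_cons, pending]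

theorem pending_append {n : ℕ} {I : List (Item n)} {h : ℕ} {it : Item n} (hit : I[h]? = some it)
    (J : List (Item n)) :
    pending (I ++ J) (h + 1) = pending I (h + 1) + (J.map Item.weight).sum := by
  have := (List.getElem?_eq_some_iff.1 hit).1
  rw [pending, List.drop_append_of_le_length (by omega), List.map_append, List.sum_append, pending]

/-- No two-vertex connected set fits into fewer than `s` vertices, so no closed set is waiting
inside such an item. -/
theorem Progress.skip {I : List (Item G.n)} {h : ℕ} {R : List (List (Fin G.n))} {it : Item G.n}
    (hP : G.Progress s I h R) (hit : I[h]? = some it) (hlen : it.verts.length < s) :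
    G.Progress s I (h + 1) R := by
  have hdrop := drop_eq_cons hit
  refine ⟨hP.valid, hP.nodup, hP.sound, ?_, ?_⟩
  · intro e b U hb hU hmax
    rcases hP.complete e b U hb hU hmax with h' | ⟨it', hit', h'⟩
    · exact .inl h'
    · rw [hdrop] at hit'
      rcases List.mem_cons.1 hit' with rfl | hit'
      · have h₁ := (hU (G.first e) (by simp [hb])).1
        have h₂ := (Finset.card_le_card h'.2.1).trans (List.toFinset_card_le _)
        omega
      · exact .inr ⟨it', hit', h'⟩
  · have h₁ := hP.weight
    have hv := hP.valid it (List.mem_of_getElem? hit)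
    have := List.length_pos_iff.2 hv.ne_nil
    have := hv.length_le_weight
    rw [pending_eq_add hit] at h₁
    omega

/-- Substitute `a = x + 1`, `b = y + 1`, `k = x + y + 1 + z`. In the tight case `z = 0` the parts
overlap in one vertex; both being proper gives `x, y ≥ 1`, and `x + y + 2 ≤ 6xy` is all that is
needed. For `z ≥ 1` the terms containing `z` suffice. -/
theorem weight_add_weight_le {a b k : ℕ} (ha : 1 ≤ a) (hb : 1 ≤ b) (hak : a < k) (hbk : b < k)
    (hab : a + b ≤ k + 1) : (3 * a ^ 2 - 2) + (3 * b ^ 2 - 2) + k ≤ 3 * k ^ 2 - 2 := by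
  obtain ⟨x, rfl⟩ : ∃ x, a = x + 1 := ⟨a - 1, by omega⟩
  obtain ⟨y, rfl⟩ : ∃ y, b = y + 1 := ⟨b - 1, by omega⟩
  obtain ⟨z, rfl⟩ : ∃ z, k = x + y + 1 + z := ⟨k - (x + y + 1), by omega⟩
  have h1 : 3 * (x + 1) ^ 2 - 2 = 3 * x ^ 2 + 6 * x + 1 := by
    have : 3 * (x + 1) ^ 2 = 3 * x ^ 2 + 6 * x + 3 := by ring
    omega
  have h2 : 3 * (y + 1) ^ 2 - 2 = 3 * y ^ 2 + 6 * y + 1 := by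
    have : 3 * (y + 1) ^ 2 = 3 * y ^ 2 + 6 * y + 3 := by ring
    omega
  have h3 : 3 * (x + y + 1 + z) ^ 2 - 2 = 3 * x ^ 2 + 3 * y ^ 2 + 3 * z ^ 2 + 6 * (x * y) +
      6 * (x * z) + 6 * (y * z) + 6 * x + 6 * y + 6 * z + 1 := by
    have : 3 * (x + y + 1 + z) ^ 2 = 3 * x ^ 2 + 3 * y ^ 2 + 3 * z ^ 2 + 6 * (x * y) +
      6 * (x * z) + 6 * (y * z) + 6 * x + 6 * y + 6 * z + 3 := by ring
    omega
  rw [h1, h2, h3]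
  rcases Nat.eq_zero_or_pos z with rfl | hz
  · have hx : 1 ≤ x := by omega
    have hy : 1 ≤ y := by omega
    obtain ⟨p, rfl⟩ : ∃ p, x = p + 1 := ⟨x - 1, by omega⟩
    obtain ⟨q, rfl⟩ : ∃ q, y = q + 1 := ⟨y - 1, by omega⟩
    nlinarith [Nat.zero_le (p * q)]
  · nlinarith [Nat.zero_le (x * y), Nat.mul_le_mul_left x hz, Nat.mul_le_mul_left y hz]

/-- The two parts together weigh less than the item by at least its number of vertices. This surplus
pays for processing the item. -/
theorem pending_split {I : List (Item G.n)} {h : ℕ} {it : Item G.n} (hit : I[h]? = some it)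
    (hv : it.Valid G s) {H : SimpleGraph (Fin G.n)} {A B : List (Fin G.n)} {a b : ℕ}
    (hA : A.Sublist it.verts) (hB : B.Sublist it.verts)
    (hsplit : Splits s H it.verts.toFinset A.toFinset B.toFinset) :
    pending (I ++ [⟨A, a, b⟩, ⟨B, a, b⟩]) (h + 1) + it.verts.length ≤ pending I h := by
  have hnodup : it.verts.Nodup := hv.sublist.nodup (List.nodup_finRange _)
  rw [pending_append hit, pending_eq_add hit]
  simp only [List.map_cons, List.sum_cons, List.map_nil, List.sum_nil, add_zero]
  have e1 := List.toFinset_card_of_nodup hnodup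
  have e2 := List.toFinset_card_of_nodup (hA.nodup hnodup)
  have e3 := List.toFinset_card_of_nodup (hB.nodup hnodup)
  have := weight_add_weight_le (Finset.card_pos.2 hsplit.left_nonempty)
    (Finset.card_pos.2 hsplit.right_nonempty) (Finset.card_lt_card hsplit.left)
    (Finset.card_lt_card hsplit.right) hsplit.card_add_card_le
  rw [e1, e2, e3] at this
  simp only [Item.weight]
  omega

/-- The effect of splitting an item at time stamp `t` on the list of recorded sets. -/
def record {n : ℕ} (R : List (List (Fin n))) (it : Item n) (t : ℕ) : List (List (Fin n)) :=
  if it.bar < t ∧ it.verts ∉ R then R ++ [it.verts] else R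

/-- Take the interval `[start, t - 1]`, which contains `[start, bar]` since `bar < t`. A superset
connected there shares all of the at least two vertices of the item, so `absorbs` forces it back
into the item. -/
theorem Item.Valid.isClosedSubset (hs : 2 ≤ s) {it : Item G.n} (h : it.Valid G s) {t : ℕ}
    (ht : G.FirstFailure s it.verts.toFinset it.start t) (hbar : it.bar < t) :
    G.IsClosedSubset s it.verts.toFinset := by
  classical
  have hst := h.start_le
  have hU : ∀ t' ∈ Finset.Icc it.start (it.start + (t - 1 - it.start)),
      TwoVertexConnected s (G.snapshot t') it.verts.toFinset := fun t' ht' => by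
    rw [Finset.mem_Icc] at ht'
    exact ht.2.1 t' ht'.1 (by omega)
  have hstamps : ∀ t' ∈ Finset.Icc it.start (it.start + (t - 1 - it.start)), t' ∈ G.stamps :=
    fun t' ht' => Finset.mem_Icc.2 (mem_stamps_of_twoVertexConnected hs (hU t' ht'))
  refine ⟨_, ⟨it.start, t - 1 - it.start, rfl⟩, hstamps, fun t' ht' => ?_, fun W hW hcon => ?_⟩
  · simp only [γ, Finset.mem_filter]
    exact ⟨hstamps t' ht', hU t' ht'⟩
  · refine hW.2 (h.absorbs W (fun t' ht' => ?_) ?_)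
    · have : t' ∈ G.γ s W := hcon (by simp only [Finset.mem_Icc] at ht' ⊢; omega)
      simp only [γ, Finset.mem_filter] at this
      exact this.2
    · rw [Finset.inter_eq_right.2 hW.1]
      exact hs.trans (hU it.start (by simp)).1

/-- A set connected up to the new bar lies in the parent by the parent's `absorbs`. It is connected
at `t`, so it lies in `A` or in `B`; the latter is impossible if it shares two vertices with `A`. -/
theorem Item.Valid.child {it : Item G.n} (h : it.Valid G s) {t : ℕ} (hst : it.start ≤ t)
    (htm : t ≤ G.tmax + 1) {A B : List (Fin G.n)}
    (hA : A.Sublist it.verts)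
    (hne : A.toFinset.Nonempty) (hAB : (A.toFinset ∩ B.toFinset).card ≤ 1)
    (href : ∀ W ⊆ it.verts.toFinset, TwoVertexConnected s (G.snapshot t) W →
      W ⊆ A.toFinset ∨ W ⊆ B.toFinset) :
    (Item.mk A it.start (max it.bar t)).Valid G s where
  sublist := hA.trans h.sublist
  ne_nil := by
    rintro rfl
    simp at hne
  start_eq := h.start_eq
  start_le := h.start_le.trans (le_max_left _ _)
  bar_le := max_le h.bar_le htm
  absorbs := by
    intro W hW hcard
    have hAU : A.toFinset ⊆ it.verts.toFinset := fun x hx =>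
      List.mem_toFinset.2 (hA.subset (List.mem_toFinset.1 hx))
    have hWU : W ⊆ it.verts.toFinset := by
      refine h.absorbs W (fun t' ht' => hW t' ?_)
        (hcard.trans (Finset.card_le_card (Finset.inter_subset_inter_left hAU)))
      rw [Finset.mem_Icc] at ht' ⊢
      exact ⟨ht'.1, ht'.2.trans (le_max_left _ _)⟩
    rcases href W hWU (hW t (Finset.mem_Icc.2 ⟨hst, le_max_right _ _⟩)) with h' | h'
    · exact h'
    · have := Finset.card_le_card (Finset.inter_subset_inter_left (s := A.toFinset) h')
      rw [Finset.inter_comm] at this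
      simp only at hcard
      omega

/-- Completeness is the point. A waiting closed set either equals the item, which is then recorded
now or was recorded before, or it moves into one of the two parts. -/
theorem Progress.split (hs : 2 ≤ s) {I : List (Item G.n)} {h : ℕ} {R : List (List (Fin G.n))}
    {it : Item G.n} (hP : G.Progress s I h R) (hit : I[h]? = some it) {t : ℕ}
    (ht : G.FirstFailure s it.verts.toFinset it.start t) (htm : t ≤ G.tmax + 1)
    {A B : List (Fin G.n)}
    (hA : A.Sublist it.verts) (hB : B.Sublist it.verts)
    (hsplit : Splits s (G.snapshot t) it.verts.toFinset A.toFinset B.toFinset) :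
    G.Progress s (I ++ [⟨A, it.start, max it.bar t⟩, ⟨B, it.start, max it.bar t⟩]) (h + 1)
      (record R it t) := by
  have hlt := (List.getElem?_eq_some_iff.1 hit).1
  have hdrop := drop_eq_cons hit
  have hv := hP.valid it (List.mem_of_getElem? hit)
  have hdrop' : ∀ J : List (Item G.n), (I ++ J).drop (h + 1) = I.drop (h + 1) ++ J := fun J =>
    List.drop_append_of_le_length (by omega)
  have hRsub : ∀ l ∈ R, l ∈ record R it t := fun l hl => by
    unfold record
    split_ifs <;> simp [hl]
  refine ⟨?_, ?_, ?_, ?_, ?_⟩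
  · intro it' hit'
    rcases List.mem_append.1 hit' with h' | h'
    · exact hP.valid it' h'
    · simp only [List.mem_cons, List.not_mem_nil, or_false] at h'
      rcases h' with rfl | rfl
      · exact hv.child ht.1 htm hA hsplit.left_nonempty hsplit.inter hsplit.refines
      · exact hv.child ht.1 htm hB hsplit.right_nonempty
          (by rw [Finset.inter_comm]; exact hsplit.inter)
          (fun W hW hW' => (hsplit.refines W hW hW').symm)
  · unfold record
    split_ifs with hrec
    · exact hP.nodup.append (List.nodup_singleton _) (by simpa using hrec.2)
    · exact hP.nodup
  · intro l hl
    unfold record at hl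
    split_ifs at hl with hrec
    · rcases List.mem_append.1 hl with h' | h'
      · exact hP.sound l h'
      · rw [List.mem_singleton.1 h']
        exact ⟨hv.sublist, hv.isClosedSubset hs ht hrec.1⟩
    · exact hP.sound l hl
  · intro e b U hb hU hmax
    rcases hP.complete e b U hb hU hmax with ⟨l, hl, h'⟩ | ⟨it', hit', h₁, h₂, h₃⟩
    · exact .inl ⟨l, hRsub l hl, h'⟩
    rw [hdrop] at hit'
    rw [hdrop']
    rcases List.mem_cons.1 hit' with rfl | hit'
    · by_cases hUeq : U = it'.verts.toFinset
      · left
        -- `U` is connected up to `b`, so its first failure comes after `b`. With `it'.bar ≤ b` this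
        -- gives `it'.bar < t`, the condition for recording.
        have hbt : b < t := by
          by_contra hcon
          refine ht.2.2 (hUeq ▸ hU t (Finset.mem_Icc.2 ⟨h₁ ▸ ht.1, by omega⟩))
        refine ⟨it'.verts, ?_, hUeq.symm⟩
        unfold record
        split_ifs with hrec
        · simp
        · by_contra hcon
          exact hrec ⟨by omega, hcon⟩
      · have hss := Finset.ssubset_iff_subset_ne.2 ⟨h₂, hUeq⟩
        -- Otherwise the item, a proper superset of `U`, would be connected on the whole interval,
        -- against the maximality of `U`.
        have htb : t ≤ b := by
          by_contra hcon
          refine hmax _ hss fun t' ht' => ht.2.1 t' ?_ ?_ <;> rw [Finset.mem_Icc] at ht' <;> omega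
        right
        rcases hsplit.refines U h₂ (hU t (Finset.mem_Icc.2 ⟨h₁ ▸ ht.1, htb⟩)) with h' | h'
        · exact ⟨⟨A, _, _⟩, List.mem_append_right _ List.mem_cons_self, h₁, h', max_le h₃ htb⟩
        · exact ⟨⟨B, _, _⟩, List.mem_append_right _ (List.mem_cons_of_mem _ (by simp)), h₁, h',
            max_le h₃ htb⟩
    · exact .inr ⟨it', List.mem_append_left _ hit', h₁, h₂, h₃⟩
  · have h₁ := hP.weight
    have h₂ := pending_split (a := it.start) (b := max it.bar t) hit hv hA hB hsplit
    have := List.length_pos_iff.2 hv.ne_nil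
    omega

/-- When the work list has been processed, the recorded sets are the closed subsets. -/
theorem Progress.enumerates (hs : 2 ≤ s) {I : List (Item G.n)} {R : List (List (Fin G.n))}
    (hP : G.Progress s I I.length R) : G.Enumerates s (encode R) := by
  refine ⟨R, rfl, fun l hl => (hP.sound l hl).1.nodup (List.nodup_finRange _), ?_, fun U => ?_⟩
  · refine List.Nodup.map_on (fun l hl l' hl' heq => ?_) hP.nodup
    have hsort : ∀ l ∈ R, l.Pairwise (· < ·) := fun l hl =>
      (List.pairwise_lt_finRange G.n).sublist (hP.sound l hl).1
    refine List.Perm.eq_of_pairwise (le := (· < ·)) ?_ (hsort l hl) (hsort l' hl') ?_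
    · exact fun a b _ _ hab hba => absurd hab (lt_asymm hba)
    · exact (List.toFinset_eq_iff_perm_dedup.1 heq).trans (.refl _) |> fun h => by
        rwa [((hP.sound l hl).1.nodup (List.nodup_finRange _)).dedup,
          ((hP.sound l' hl').1.nodup (List.nodup_finRange _)).dedup] at h
  · rw [List.mem_map]
    constructor
    · rintro ⟨l, hl, rfl⟩
      exact (hP.sound l hl).2
    · intro hU
      obtain ⟨e, b, hb, h₁, h₂⟩ := hU.exists_start hs
      rcases hP.complete e b U hb h₁ h₂ with h' | ⟨it, hit, -⟩
      · exact h'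
      · simp at hit

end GraphSequence

namespace GraphSequence

open WordRAM Cmd

/-! ### The program

Registers: `0, 1, 2` input; `3` row width of the two-dimensional arrays; `5` length of the work list;
`6` current item; `7` current search stamp; `8` last trie node; `9`, `10`, `23` length, start and
row of the current item; `11` first failing time stamp found; `12, 16, 20, 25` loop counters; `13`
time stamp tested; `14` outcome of the test; `15` deleted vertex (`0` for none); `17`, `18` end and
front of the search queue; `19, 21, 22` vertex, edge, vertex; `24` current trie node; `26`, `27`,
`28`, `29` lengths, row and bar of the two new items.

Arrays: `0, …, 3` input; `4`, `5` degrees and incident edges of the vertices; `6, 7, 8, 9` vertices,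
length, start and bar of the items; `10` last item that contains a vertex; `11` last search that
reached a vertex; `12` search queue; `13`, `14` children and marks of the trie nodes. -/

namespace Program

/-- Increment a register. -/
def incr (x : ℕ) : Cmd := .set x (.add (.reg x) (.const 1))

/-- The address of column `c` in the row that is held in register `r`. -/
def cell (r : ℕ) (c : Expr) : Expr := .add (.mul (.reg r) (.reg 3)) c

/-- Follow one incident edge of the vertex in register `19`. -/
def visit : Cmd :=
  .seq (.set 21 (.get 5 (cell 19 (.reg 20))))
  (.ite (.lt (.reg 13) (.get 2 (.reg 21))) .skip
  (.ite (.lt (.get 3 (.reg 21)) (.reg 13)) .skip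
  -- The other end of the edge is the sum of both ends minus the end at hand.
  (.seq (.set 22 (.sub (.add (.get 0 (.reg 21)) (.get 1 (.reg 21))) (.reg 19)))
  -- Membership marks are item numbers plus one, as 0 is the initial content of every cell.
  (.ite (.eq (.get 10 (.reg 22)) (.add (.reg 6) (.const 1)))
    (.ite (.eq (.reg 22) (.reg 15)) .skip
    (.ite (.eq (.get 11 (.reg 22)) (.reg 7)) .skip
    (.seq (.put 11 (.reg 22) (.reg 7))
    (.seq (.put 12 (.reg 17) (.reg 22))
    (incr 17)))))
    .skip))))

/-- Choose a first vertex and start a new search. -/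
def searchInit : Cmd :=
  .seq (incr 7)
  -- The search starts from the first vertex of the item, or from the second if the first is the
  -- deleted one.
  (.seq (.ite (.eq (.reg 15) (.get 6 (.reg 23)))
    (.set 22 (.get 6 (.add (.reg 23) (.const 1)))) (.set 22 (.get 6 (.reg 23))))
  (.seq (.put 11 (.reg 22) (.reg 7))
  (.seq (.put 12 (.const 0) (.reg 22))
  (.seq (.set 17 (.const 1)) (.set 18 (.const 0))))))

/-- Scan the incident edges of the front of the queue. -/
def scan : Cmd :=
  .seq (.set 19 (.get 12 (.reg 18)))
  (.seq (.for 20 (.get 4 (.reg 19)) visit)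
  (incr 18))

/-- Search the current vertex set without the vertex in register `15`. -/
def search : Cmd := .seq searchInit (.loop (.lt (.reg 18) (.reg 17)) scan)

/-- Delete one vertex, or none, and test the connectivity of the rest. -/
def testVertex : Cmd :=
  .seq (.ite (.lt (.reg 16) (.reg 9)) (.set 15 (.get 6 (.add (.reg 23) (.reg 16))))
    (.set 15 (.const 0)))
  (.seq search
  -- Reached vertices, plus one if a vertex was deleted, number fewer than the whole set exactly
  -- when the search missed a vertex.
  (.ite (.lt (.add (.reg 17) (.lt (.const 0) (.reg 15))) (.reg 9)) (.set 14 (.const 1)) .skip))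

/-- Test whether the current vertex set is two-vertex connected at the time stamp in
register `13`. -/
def test : Cmd :=
  .seq (.set 14 (.const 0))
  -- The last round deletes no vertex. After a failure the remaining rounds are idle, so the failed
  -- search stays in memory.
  (.for 16 (.add (.reg 9) (.const 1)) (.ite (.reg 14) .skip testVertex))

/-- Test a candidate for the first failing time stamp. -/
def tryStamp : Cmd :=
  .ite (.lt (.reg 13) (.reg 10)) .skip
  (.ite (.lt (.reg 13) (.reg 11))
    (.seq test (.ite (.reg 14) (.set 11 (.reg 13)) .skip)) .skip)

/-- Find the first failing time stamp and repeat the test for it. -/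
def findFailure : Cmd :=
  -- The stamp `tmax + 1` fails for every set and is the initial value of the minimum.
  .seq (.set 11 (.add (.reg 2) (.const 1)))
  (.seq (.set 13 (.reg 10))
  (.seq tryStamp
  (.seq (.for 12 (.reg 1) (.seq (.set 13 (.add (.get 3 (.reg 12)) (.const 1))) tryStamp))
  -- Tests of other candidates may have overwritten the failed search, and splitting needs it.
  (.seq (.set 13 (.reg 11))
  test))))

/-- Load the current item. -/
def load : Cmd :=
  .seq (.set 10 (.get 8 (.reg 6)))
  (.seq (.set 23 (.mul (.reg 6) (.reg 3)))
  (.for 25 (.reg 9) (.put 10 (.get 6 (.add (.reg 23) (.reg 25))) (.add (.reg 6) (.const 1)))))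

/-- Go to the child of the current trie node, and create it if it does not exist. -/
def descend : Cmd :=
  .seq (.set 22 (.get 6 (.add (.reg 23) (.reg 25))))
  (.seq (.ite (.eq (.get 13 (cell 24 (.reg 22))) (.const 0))
    (.seq (incr 8) (.put 13 (cell 24 (.reg 22)) (.reg 8))) .skip)
  (.set 24 (.get 13 (cell 24 (.reg 22)))))

/-- Output the current vertex set. -/
def output : Cmd :=
  .seq (.for 25 (.reg 9) (.emit (.get 6 (.add (.reg 23) (.reg 25)))))
  (.emit (.const 0))

/-- Output the current vertex set unless this has been done before. -/
def recordSet : Cmd :=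
  .seq (.set 24 (.const 1))
  (.seq (.for 25 (.reg 9) descend)
  (.ite (.get 14 (.reg 24)) .skip (.seq (.put 14 (.reg 24) (.const 1)) output)))

/-- Append one vertex of the current set to one or both of the new items. -/
def distribute : Cmd :=
  .seq (.set 22 (.get 6 (.add (.reg 23) (.reg 25))))
  (.seq (.ite (.add (.eq (.reg 22) (.reg 15)) (.eq (.get 11 (.reg 22)) (.reg 7)))
    (.seq (.put 6 (cell 5 (.reg 26)) (.reg 22)) (incr 26)) .skip)
  (.ite (.eq (.get 11 (.reg 22)) (.reg 7)) .skip
    (.seq (.put 6 (cell 28 (.reg 27)) (.reg 22)) (incr 27))))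

/-- Set the entries of a new item apart from its vertices. -/
def header (r len : ℕ) : Cmd :=
  .seq (.put 7 (.reg r) (.reg len)) (.seq (.put 8 (.reg r) (.reg 10)) (.put 9 (.reg r) (.reg 29)))

/-- Split the current item. -/
def split : Cmd :=
  .seq (.set 26 (.const 0))
  (.seq (.set 27 (.const 0))
  (.seq (.set 28 (.add (.reg 5) (.const 1)))
  (.seq (.ite (.lt (.get 9 (.reg 6)) (.reg 11)) (.set 29 (.reg 11)) (.set 29 (.get 9 (.reg 6))))
  (.seq (.for 25 (.reg 9) distribute)
  (.seq (header 5 26)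
  (.seq (header 28 27)
  (.set 5 (.add (.reg 28) (.const 1)))))))))

/-- Process the current item. -/
def process (s : ℕ) : Cmd :=
  .seq (.set 9 (.get 7 (.reg 6)))
  (.ite (.lt (.reg 9) (.const s)) .skip
  (.seq load
  (.seq findFailure
  (.seq (.ite (.lt (.get 9 (.reg 6)) (.reg 11)) recordSet .skip)
  split))))

/-- Append the edge in register `12` to the list of the edges of the vertex in register `19`. -/
def attach : Cmd :=
  .seq (.put 5 (cell 19 (.get 4 (.reg 19))) (.reg 12))
  (.put 4 (.reg 19) (.add (.get 4 (.reg 19)) (.const 1)))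

/-- Build the incidence lists. -/
def incidences : Cmd :=
  .for 12 (.reg 1) (.seq (.set 19 (.get 0 (.reg 12))) (.seq attach
    (.seq (.set 19 (.get 1 (.reg 12))) attach)))

/-- Build the initial work list. -/
def initialItems : Cmd :=
  .for 12 (.reg 1)
  (.seq (.for 25 (.reg 0) (.put 6 (cell 12 (.reg 25)) (.add (.reg 25) (.const 1))))
  (.seq (.put 7 (.reg 12) (.reg 0))
  (.seq (.put 8 (.reg 12) (.get 2 (.reg 12)))
  (.put 9 (.reg 12) (.get 2 (.reg 12))))))

/-- Set up the data structures. -/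
def setup : Cmd :=
  .seq (.set 3 (.add (.add (.reg 0) (.reg 1)) (.const 1)))
  (.seq (.set 8 (.const 1))
  (.seq incidences
  (.seq initialItems
  (.set 5 (.reg 1)))))

/-- The enumeration program. -/
def enumerate (s : ℕ) : Cmd :=
  .seq setup (.loop (.lt (.reg 6) (.reg 5)) (.seq (process s) (incr 6)))

end Program

open Program

/-! ### The representation of the data -/

variable {G : GraphSequence} {w D : ℕ}

/-- The row width of the two-dimensional arrays. -/
def width (G : GraphSequence) : ℕ := G.n + G.m + 1

/-- Words of `w` bits can address two-dimensional arrays with `D` rows. -/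
structure Capacity (G : GraphSequence) (w D : ℕ) : Prop where
  n_le : G.n ≤ D
  m_le : G.m ≤ D
  tmax_le : G.tmax + 1 ≤ D
  lt : (D + 1) * (G.width + 1) < 2 ^ w

theorem Capacity.cell_lt (h : G.Capacity w D) {r c : ℕ} (hr : r ≤ D) (hc : c ≤ G.width) :
    r * G.width + c < 2 ^ w := by
  have h₁ : r * G.width ≤ D * G.width := Nat.mul_le_mul_right _ hr
  have h₂ : (D + 1) * (G.width + 1) = D * G.width + D + G.width + 1 := by ring
  have := h.lt
  omega

theorem Capacity.cell_mod (h : G.Capacity w D) {r c : ℕ} (hr : r ≤ D) (hc : c ≤ G.width) :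
    (r * G.width % 2 ^ w + c) % 2 ^ w = r * G.width + c := by
  have := h.cell_lt hr hc
  rw [Nat.mod_eq_of_lt (a := r * G.width) (by omega), Nat.mod_eq_of_lt this]

theorem Capacity.lt_of_le (h : G.Capacity w D) {r : ℕ} (hr : r ≤ D + 1) : r < 2 ^ w := by
  have h₂ : (D + 1) * (G.width + 1) = (D + 1) * G.width + D + 1 := by ring
  have h₃ : 0 < (D + 1) * G.width := by unfold width; positivity
  have := h.lt
  omega

theorem Capacity.succ_mod (h : G.Capacity w D) {r : ℕ} (hr : r ≤ D) :
    (r + 1) % 2 ^ w = r + 1 := Nat.mod_eq_of_lt (h.lt_of_le (by omega))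

theorem Capacity.one_mod (h : G.Capacity w D) : 1 % 2 ^ w = 1 :=
  Nat.mod_eq_of_lt (h.lt_of_le (by omega))

theorem code_le {n : ℕ} (v : Fin n) : code v ≤ n := v.2

theorem code_pos {n : ℕ} (v : Fin n) : 0 < code v := Nat.succ_pos _

theorem code_injective {n : ℕ} : Function.Injective (code : Fin n → ℕ) := fun a b h => by
  unfold code at h
  exact Fin.ext (by omega)

@[simp] theorem code_inj {n : ℕ} {u v : Fin n} : code u = code v ↔ u = v := code_injective.eq_iff

/-- Cells of different rows or columns have different addresses. -/
theorem cell_inj {W r c r' c' : ℕ} (hc : c < W) (hc' : c' < W) :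
    r * W + c = r' * W + c' ↔ r = r' ∧ c = c' := by
  constructor
  · intro h
    have h₁ : (r * W + c) / W = r := by
      rw [mul_comm, Nat.mul_add_div (by omega), Nat.div_eq_of_lt hc, add_zero]
    have h₂ : (r' * W + c') / W = r' := by
      rw [mul_comm, Nat.mul_add_div (by omega), Nat.div_eq_of_lt hc', add_zero]
    have : r = r' := by rw [← h₁, ← h₂, h]
    subst this
    exact ⟨rfl, by omega⟩
  · rintro ⟨rfl, rfl⟩
    rfl

/-- The edges at a vertex. -/
def incident (G : GraphSequence) (u : Fin G.n) : List (Fin G.m) :=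
  (List.finRange G.m).filter fun e => G.tail e = u ∨ G.head e = u

/-- The input and the incidence lists are in memory. -/
structure Loaded (G : GraphSequence) (σ : State) : Prop where
  n : σ.reg 0 = G.n
  m : σ.reg 1 = G.m
  tmax : σ.reg 2 = G.tmax
  width : σ.reg 3 = G.width
  tail : ∀ e : Fin G.m, σ.arr 0 e = code (G.tail e)
  head : ∀ e : Fin G.m, σ.arr 1 e = code (G.head e)
  first : ∀ e : Fin G.m, σ.arr 2 e = G.first e
  last : ∀ e : Fin G.m, σ.arr 3 e = G.last e
  degree : ∀ u, σ.arr 4 (code u) = (G.incident u).length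
  edge : ∀ (u : Fin G.n) (k : ℕ) (e : Fin G.m), (G.incident u)[k]? = some e → σ.arr 5 (code u * G.width + k) = e

theorem Loaded.congr {σ σ' : State} (h : G.Loaded σ) (hr : ∀ x < 4, σ'.reg x = σ.reg x)
    (ha : ∀ A < 6, σ'.arr A = σ.arr A) : G.Loaded σ' := by
  constructor
  · rw [hr 0 (by omega), h.n]
  · rw [hr 1 (by omega), h.m]
  · rw [hr 2 (by omega), h.tmax]
  · rw [hr 3 (by omega), h.width]
  · rw [ha 0 (by omega)]; exact h.tail
  · rw [ha 1 (by omega)]; exact h.head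
  · rw [ha 2 (by omega)]; exact h.first
  · rw [ha 3 (by omega)]; exact h.last
  · rw [ha 4 (by omega)]; exact h.degree
  · rw [ha 5 (by omega)]; exact h.edge

theorem Loaded.frame {c : Cmd} {σ σ' : State} (h : G.Loaded σ) (hF : Frame c σ σ')
    (hr : ∀ x < 4, x ∉ c.regs) (ha : ∀ A < 6, A ∉ c.arrs) : G.Loaded σ' :=
  h.congr (fun x hx => hF.reg x (hr x hx)) fun A hA => hF.arr A (ha A hA)

/-- The item with number `h` and vertex list `l` is the current one. -/
structure Focus (G : GraphSequence) (l : List (Fin G.n)) (h : ℕ) (σ : State) : Prop where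
  index : σ.reg 6 = h
  length : σ.reg 9 = l.length
  base : σ.reg 23 = h * G.width
  row : ∀ (j : ℕ) (x : Fin G.n), l[j]? = some x → σ.arr 6 (h * G.width + j) = code x
  member : ∀ x : Fin G.n, σ.arr 10 (code x) = h + 1 ↔ x ∈ l

theorem Focus.frame {c : Cmd} {σ σ' : State} {l : List (Fin G.n)} {h : ℕ} (hf : G.Focus l h σ)
    (hF : Frame c σ σ') (hr : ∀ x ∈ [6, 9, 23], x ∉ c.regs) (ha : ∀ A ∈ [6, 10], A ∉ c.arrs) :
    G.Focus l h σ' := by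
  constructor
  · rw [hF.reg 6 (hr 6 (by simp)), hf.index]
  · rw [hF.reg 9 (hr 9 (by simp)), hf.length]
  · rw [hF.reg 23 (hr 23 (by simp)), hf.base]
  · rw [hF.arr 6 (ha 6 (by simp))]; exact hf.row
  · rw [hF.arr 10 (ha 10 (by simp))]; exact hf.member

/-! ### Graph search -/

/-- A step of the search at time stamp `t` in the vertex set `l` without the vertex `v`. -/
def Reaches (G : GraphSequence) (t : ℕ) (l : List (Fin G.n)) (v : ℕ) (x y : Fin G.n) : Prop :=
  (G.snapshot t).Adj x y ∧ y ∈ l ∧ code y ≠ v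

/-- The vertices that the current search has reached are those in `Q`. -/
structure Visited (G : GraphSequence) (Q : List (Fin G.n)) (σ : State) : Prop where
  length : σ.reg 17 = Q.length
  queue : ∀ (j : ℕ) (x : Fin G.n), Q[j]? = some x → σ.arr 12 j = code x
  seen : ∀ x : Fin G.n, σ.arr 11 (code x) = σ.reg 7 ↔ x ∈ Q
  seen_le : ∀ c, σ.arr 11 c ≤ σ.reg 7
  nodup : Q.Nodup

theorem Visited.frame {c : Cmd} {σ σ' : State} {Q : List (Fin G.n)} (hf : G.Visited Q σ)
    (hF : Frame c σ σ') (hr : ∀ x ∈ [7, 17], x ∉ c.regs) (ha : ∀ A ∈ [11, 12], A ∉ c.arrs) :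
    G.Visited Q σ' := by
  obtain ⟨h1, h2, h3, h4, h5⟩ := hf
  rw [← hF.reg 17 (hr 17 (by simp))] at h1
  rw [← hF.arr 12 (ha 12 (by simp))] at h2
  rw [← hF.arr 11 (ha 11 (by simp)), ← hF.reg 7 (hr 7 (by simp))] at h3 h4
  exact ⟨h1, h2, h3, h4, h5⟩

theorem Visited.setReg {σ : State} {Q : List (Fin G.n)} (h : G.Visited Q σ) {x v : ℕ}
    (hx : x ≠ 7) (hx' : x ≠ 17) : G.Visited Q (σ.setReg x v) := by
  obtain ⟨h1, h2, h3, h4, h5⟩ := h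
  constructor <;> simpa [hx.symm, hx'.symm]

theorem length_le_of_nodup {n : ℕ} {Q : List (Fin n)} (h : Q.Nodup) : Q.length ≤ n := by
  simpa using h.length_le_card

theorem length_incident_le (u : Fin G.n) : (G.incident u).length ≤ G.m := by
  simpa [incident] using List.length_filter_le
    (fun e => decide (G.tail e = u ∨ G.head e = u)) (List.finRange G.m)

/-- The queue grows by at most one vertex per incident edge, which later allows its length to be
charged to degrees. What enters is reachable in one step, and what this edge makes reachable is in
the queue afterwards. -/
theorem visit_spec (hC : G.Capacity w D) {σ : State} (hL : G.Loaded σ) {l : List (Fin G.n)}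
    {h : ℕ} (hf : G.Focus l h σ) (hh : h ≤ D) {Q : List (Fin G.n)} (hQ : G.Visited Q σ)
    {u : Fin G.n} {k : ℕ} {e : Fin G.m} (hu : σ.reg 19 = code u) (hk : σ.reg 20 = k)
    (he : (G.incident u)[k]? = some e) :
    WP w visit (fun c σ' => c ≤ 60 ∧ ∃ Q', G.Visited Q' σ' ∧ Q <+: Q' ∧
      Q'.length ≤ Q.length + 1 ∧ (∀ x ∈ Q', x ∈ Q ∨ G.Reaches (σ.reg 13) l (σ.reg 15) u x) ∧
      ∀ x, σ.reg 13 ∈ G.τ e → ((G.tail e = u ∧ G.head e = x) ∨ (G.tail e = x ∧ G.head e = u)) →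
        x ∈ l → code x ≠ σ.reg 15 → x ∈ Q') σ := by
  have hklt : k < (G.incident u).length := (List.getElem?_eq_some_iff.1 he).1
  have hkw : k ≤ G.width := by
    have := length_incident_le u
    unfold width
    omega
  have heu : G.tail e = u ∨ G.head e = u := by
    have := List.mem_of_getElem? he
    simpa [incident] using this
  have h21 : (Expr.get 5 (cell 19 (.reg 20))).eval w σ = e := by
    simp only [Expr.eval, cell, hu, hk, hL.width]
    rw [hC.cell_mod ((code_le u).trans hC.n_le) hkw, hL.edge u k e he]
  obtain ⟨y, hy, hye⟩ : ∃ y, (code (G.tail e) + code (G.head e)) % 2 ^ w - code u = code y ∧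
      ((G.tail e = u ∧ G.head e = y) ∨ (G.tail e = y ∧ G.head e = u)) := by
    -- The sum is at most `2n`, while `D ≥ 1` gives `2 * width < 2 ^ w`.
    have hlt : code (G.tail e) + code (G.head e) < 2 ^ w := by
      have h1 := code_le (G.tail e)
      have h2 := code_le (G.head e)
      have h3 := code_pos (G.head e)
      have h4 : 1 * G.width ≤ D * G.width :=
        Nat.mul_le_mul_right _ (by have := hC.n_le; omega)
      have h5 := hC.cell_lt (r := D) (c := G.width) le_rfl le_rfl
      unfold width at *
      omega
    rw [Nat.mod_eq_of_lt hlt]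
    rcases heu with rfl | rfl
    · exact ⟨_, by omega, .inl ⟨rfl, rfl⟩⟩
    · exact ⟨_, by omega, .inr ⟨rfl, rfl⟩⟩
  -- There are no loops, so an edge at `u` determines its other end.
  have huniq : ∀ x, ((G.tail e = u ∧ G.head e = x) ∨ (G.tail e = x ∧ G.head e = u)) → x = y := by
    have := G.tail_ne_head e
    rintro x (⟨h1, h2⟩ | ⟨h1, h2⟩) <;> rcases hye with ⟨h3, h4⟩ | ⟨h3, h4⟩ <;> simp_all
  have hone := hC.one_mod
  have hsucc := hC.succ_mod hh
  -- Shared by the five branches that leave the queue alone: edge not yet active, edge no longer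
  -- active, other end outside the item, deleted, or already seen.
  have hkeep : ∀ (c : ℕ) (σ' : State), c ≤ 60 → G.Visited Q σ' →
      (σ.reg 13 ∈ G.τ e → y ∈ l → code y ≠ σ.reg 15 → y ∈ Q) →
      c ≤ 60 ∧ ∃ Q', G.Visited Q' σ' ∧ Q <+: Q' ∧
      Q'.length ≤ Q.length + 1 ∧ (∀ x ∈ Q', x ∈ Q ∨ G.Reaches (σ.reg 13) l (σ.reg 15) u x) ∧
      ∀ x, σ.reg 13 ∈ G.τ e → ((G.tail e = u ∧ G.head e = x) ∨ (G.tail e = x ∧ G.head e = u)) →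
        x ∈ l → code x ≠ σ.reg 15 → x ∈ Q' := by
    intro c σ' hc hv hy'
    refine ⟨hc, Q, hv, List.prefix_refl _, by omega, fun x hx => .inl hx, ?_⟩
    intro x ht hx hxl hxv
    obtain rfl := huniq x hx
    exact hy' ht hxl hxv
  have hQ1 := hQ.setReg (x := 21) (v := e) (by decide) (by decide)
  have hQ2 := hQ1.setReg (x := 22) (v := code y) (by decide) (by decide)
  rw [visit, wp_seq, wp_set, h21, wp_ite]
  refine ⟨fun hc => ?_, fun hc1 => ?_⟩
  · rw [wp_skip]
    refine hkeep _ _ (by simp [Expr.cost, cell]) hQ1 fun ht => ?_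
    simp [Expr.eval, hL.first] at hc
    simp [τ] at ht
    omega
  rw [wp_ite]
  refine ⟨fun hc => ?_, fun hc2 => ?_⟩
  · rw [wp_skip]
    refine hkeep _ _ (by simp [Expr.cost, cell]) hQ1 fun ht => ?_
    simp [Expr.eval, hL.last] at hc
    simp [τ] at ht
    omega
  have h22 : (Expr.sub (.add (.get 0 (.reg 21)) (.get 1 (.reg 21))) (.reg 19)).eval w
      (σ.setReg 21 e) = code y := by
    simp [Expr.eval, hL.tail, hL.head, hu, hy]
  rw [wp_seq, wp_set, h22, wp_ite]
  refine ⟨fun hc3 => ?_, fun hc => ?_⟩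
  swap
  · rw [wp_skip]
    refine hkeep _ _ (by simp [Expr.cost, cell]) hQ2 fun ht hyl => ?_
    simp [Expr.eval, hone, hf.index, hsucc, hf.member, hyl] at hc
  rw [wp_ite]
  refine ⟨fun hc => ?_, fun hc4 => ?_⟩
  · rw [wp_skip]
    refine hkeep _ _ (by simp [Expr.cost, cell]) hQ2 fun ht hyl hyv => ?_
    simp [Expr.eval] at hc
    exact absurd hc hyv
  rw [wp_ite]
  refine ⟨fun hc => ?_, fun hc5 => ?_⟩
  · rw [wp_skip]
    refine hkeep _ _ (by simp [Expr.cost, cell]) hQ2 fun ht hyl hyv => ?_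
    simpa [Expr.eval, hQ.seen] using hc
  have hyl : y ∈ l := by
    simpa [Expr.eval, hone, hf.index, hsucc, hf.member] using hc3
  have hyv : code y ≠ σ.reg 15 := by simpa [Expr.eval] using hc4
  have hyQ : y ∉ Q := by simpa [Expr.eval, hQ.seen] using hc5
  have ht : σ.reg 13 ∈ G.τ e := by
    simp [Expr.eval, hL.first] at hc1
    simp [Expr.eval, hL.last] at hc2
    simp [τ, hc1, hc2]
  have hQlen : Q.length ≤ D := (length_le_of_nodup hQ.nodup).trans hC.n_le
  have h17 := hC.succ_mod hQlen
  rw [wp_seq, wp_put, wp_seq, wp_put, incr, wp_set]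
  refine ⟨by simp [Expr.cost, cell], Q ++ [y], ?_, by simp, by simp, ?_, ?_⟩
  · constructor
    · simp [Expr.eval, hQ.length, hone, h17]
    · intro j x hx
      simp only [Expr.eval, State.setReg_arr, State.setArr_arr_self, State.setReg_reg,
        State.setArr_reg]
      simp only [Nat.reduceEqDiff, if_false, if_true, hQ.length]
      split_ifs with hj
      · subst hj
        simpa using hx
      · refine hQ.queue j x ?_
        rwa [List.getElem?_append_left] at hx
        have := (List.getElem?_eq_some_iff.1 hx).1
        simp at this
        omega
    · intro x
      simp only [Expr.eval, State.setReg_arr, State.setReg_reg, State.setArr_reg]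
      rw [State.setArr_arr_ne _ _ _ (by decide), State.setArr_arr_self]
      simp only [Nat.reduceEqDiff, if_false, if_true, State.setReg_arr]
      by_cases hxy : x = y
      · simp [hxy]
      · simp [hxy, hQ.seen]
    · intro c
      simp only [Expr.eval, State.setReg_arr, State.setReg_reg, State.setArr_reg]
      rw [State.setArr_arr_ne _ _ _ (by decide), State.setArr_arr_self]
      simp only [Nat.reduceEqDiff, if_false, if_true, State.setReg_arr]
      split_ifs
      · rfl
      · exact hQ.seen_le c
    · exact hQ.nodup.append (List.nodup_singleton _) (by simpa using hyQ)
  · intro x hx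
    rcases List.mem_append.1 hx with hx | hx
    · exact .inl hx
    · obtain rfl := List.mem_singleton.1 hx
      exact .inr ⟨⟨e, ht, hye⟩, hyl, hyv⟩
  · intro x _ hx _ _
    obtain rfl := huniq x hx
    simp

end GraphSequence

namespace GraphSequence

open WordRAM Cmd
open Program

variable {G : GraphSequence} {w D : ℕ}

/-! ### Breadth-first search in time linear in the number of edges -/

theorem scan_spec (hC : G.Capacity w D) {σ : State} (hL : G.Loaded σ) {l : List (Fin G.n)}
    {h : ℕ} (hf : G.Focus l h σ) (hh : h ≤ D) {Q : List (Fin G.n)} (hQ : G.Visited Q σ)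
    {u : Fin G.n} {i : ℕ} (hi : σ.reg 18 = i) (hu : Q[i]? = some u) :
    WP w scan (fun c σ' => c ≤ 70 * (G.incident u).length + 20 ∧ σ'.reg 18 = i + 1 ∧
      ∃ Q', G.Visited Q' σ' ∧ Q <+: Q' ∧ Q'.length ≤ Q.length + (G.incident u).length ∧
      (∀ x ∈ Q', x ∈ Q ∨ G.Reaches (σ.reg 13) l (σ.reg 15) u x) ∧
      ∀ x, G.Reaches (σ.reg 13) l (σ.reg 15) u x → x ∈ Q') σ := by
  have h19 : (Expr.get 12 (.reg 18)).eval w σ = code u := by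
    simp [Expr.eval, hi, hQ.queue i u hu]
  have hdeg : (G.incident u).length ≤ D := (length_incident_le u).trans hC.m_le
  rw [scan, wp_seq, wp_set, h19, wp_seq]
  have hQ0 : G.Visited Q (σ.setReg 19 (code u)) := hQ.setReg (by decide) (by decide)
  refine (wp_for (fun k σ' => ∃ Q', G.Visited Q' σ' ∧ Q <+: Q' ∧ Q'.length ≤ Q.length + k ∧
      (∀ x ∈ Q', x ∈ Q ∨ G.Reaches (σ.reg 13) l (σ.reg 15) u x) ∧
      ∀ k' e x, k' < k → (G.incident u)[k']? = some e → σ.reg 13 ∈ G.τ e →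
        ((G.tail e = u ∧ G.head e = x) ∨ (G.tail e = x ∧ G.head e = u)) →
        x ∈ l → code x ≠ σ.reg 15 → x ∈ Q') 60 (G.incident u).length
    (hC.lt_of_le (by omega)) (by decide) ?_ ?_ ?_).mono ?_
  · intro σ' hF
    simp only [Expr.eval]
    rw [hF.reg 19 (by decide), hF.arr 4 (by decide)]
    simp [hL.degree]
  · exact ⟨Q, hQ0.setReg (by decide) (by decide), List.prefix_refl _, le_rfl,
      fun x hx => .inl hx, fun k' e x hk' => absurd hk' (by omega)⟩
  · rintro k hk σ' hF hk' ⟨Q₁, hQ₁, hpre, hlen, hfrom, hto⟩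
    have hL' : G.Loaded σ' := Loaded.frame (σ := σ.setReg 19 (code u))
      (hL.congr (fun x hx => by simp; omega) fun _ _ => rfl) hF (by decide) (by decide)
    have hf' : G.Focus l h σ' := Focus.frame (σ := σ.setReg 19 (code u))
      ⟨by simp [hf.index], by simp [hf.length], by simp [hf.base], hf.row, hf.member⟩ hF
      (by decide) (by decide)
    have h13 : σ'.reg 13 = σ.reg 13 := by rw [hF.reg 13 (by decide)]; simp
    have h15 : σ'.reg 15 = σ.reg 15 := by rw [hF.reg 15 (by decide)]; simp
    have h19' : σ'.reg 19 = code u := by rw [hF.reg 19 (by decide)]; simp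
    refine (visit_spec hC hL' hf' hh hQ₁ h19' hk' (List.getElem?_eq_getElem hk)).mono ?_
    rw [h13, h15]
    rintro c σ'' ⟨hc, Q₂, hQ₂, hpre₂, hlen₂, hfrom₂, hto₂⟩
    refine ⟨hc, Q₂, hQ₂.setReg (by decide) (by decide), hpre.trans hpre₂, by omega, ?_, ?_⟩
    · intro x hx
      rcases hfrom₂ x hx with hx | hx
      · exact hfrom x hx
      · exact .inr hx
    · intro k' e x hk' he ht hx hxl hxv
      rcases Nat.lt_succ_iff_lt_or_eq.1 hk' with hk'' | rfl
      · exact hpre₂.subset (hto k' e x hk'' he ht hx hxl hxv)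
      · rw [List.getElem?_eq_getElem hk, Option.some_inj] at he
        subst he
        exact hto₂ x ht hx hxl hxv
  · rintro c σ' ⟨hc, ⟨Q₁, hQ₁, hpre, hlen, hfrom, hto⟩, hF⟩
    have h18 : σ'.reg 18 = i := by rw [hF.reg 18 (by decide)]; simp [hi]
    have hi' : i < Q.length := (List.getElem?_eq_some_iff.1 hu).1
    have hQD := (length_le_of_nodup hQ.nodup).trans hC.n_le
    rw [incr, wp_set]
    refine ⟨?_, ?_, Q₁, hQ₁.setReg (by decide) (by decide), hpre, hlen, hfrom, ?_⟩
    · simp only [Expr.cost] at hc ⊢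
      omega
    · simp [Expr.eval, h18, hC.one_mod, hC.succ_mod (r := i) (by omega)]
    · rintro x ⟨⟨e, ht, hx⟩, hxl, hxv⟩
      have he : e ∈ G.incident u := by
        rcases hx with hx | hx <;> simp [incident, hx]
      obtain ⟨k', hk'⟩ := List.mem_iff_getElem?.1 he
      have hk'' := (List.getElem?_eq_some_iff.1 hk').1
      exact hto k' e x hk'' hk' ht hx hxl hxv

theorem sum_length_incident_le (G : GraphSequence) :
    ∑ u, (G.incident u).length ≤ 2 * G.m := by
  have h₁ : ∀ u, (G.incident u).length ≤
      (Finset.univ.filter fun e => G.tail e = u).card +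
      (Finset.univ.filter fun e => G.head e = u).card := by
    intro u
    rw [incident, ← List.toFinset_card_of_nodup ((List.nodup_finRange _).filter _)]
    refine (Finset.card_le_card fun e he => ?_).trans (Finset.card_union_le _ _)
    simpa using he
  have h₂ : ∀ f : Fin G.m → Fin G.n, ∑ u, (Finset.univ.filter fun e => f e = u).card = G.m := by
    intro f
    rw [← Finset.card_eq_sum_card_fiberwise (fun _ _ => Finset.mem_univ _)]
    simp
  refine (Finset.sum_le_sum fun u _ => h₁ u).trans ?_
  rw [Finset.sum_add_distrib, h₂, h₂]
  omega

/-- The sum of the degrees of the vertices that are not in `L`. -/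
def degreeOutside (G : GraphSequence) (L : List (Fin G.n)) : ℕ :=
  ∑ u ∈ Finset.univ.filter (· ∉ L), (G.incident u).length

theorem degreeOutside_append {L : List (Fin G.n)} {u : Fin G.n} (hu : u ∉ L) :
    G.degreeOutside (L ++ [u]) + (G.incident u).length = G.degreeOutside L := by
  unfold degreeOutside
  rw [add_comm, ← Finset.sum_insert (f := fun u => (G.incident u).length) (a := u) (by simp)]
  congr 1
  ext x
  simp only [Finset.mem_insert, Finset.mem_filter, Finset.mem_univ, true_and, List.mem_append,
    List.mem_singleton]
  by_cases hx : x = u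
  · simp [hx, hu]
  · simp [hx]

theorem degreeOutside_le (G : GraphSequence) (L : List (Fin G.n)) :
    G.degreeOutside L ≤ 2 * G.m :=
  (Finset.sum_le_sum_of_subset (Finset.filter_subset _ _)).trans G.sum_length_incident_le

/-- Two vertices guarantee that one other than the deleted vertex exists. The new search number
exceeds all marks in memory, so all vertices count as unseen without clearing anything. -/
theorem searchInit_spec (hC : G.Capacity w D) {σ : State} {l : List (Fin G.n)}
    {h : ℕ} (hf : G.Focus l h σ) (hh : h ≤ D) (hl : l.Nodup) (h2 : 2 ≤ l.length)
    (hseen : ∀ c, σ.arr 11 c ≤ σ.reg 7) (h7 : σ.reg 7 ≤ D) :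
    WP w searchInit (fun c σ' => c ≤ 40 ∧ σ'.reg 7 = σ.reg 7 + 1 ∧ σ'.reg 18 = 0 ∧
      ∃ x ∈ l, code x ≠ σ.reg 15 ∧ G.Visited [x] σ') σ := by
  obtain ⟨x, y, l', rfl⟩ : ∃ x y l', l = x :: y :: l' := by
    match l, h2 with
    | x :: y :: l', _ => exact ⟨x, y, l', rfl⟩
  have hxy : x ≠ y := by
    rintro rfl
    simp at hl
  have hw : 1 ≤ G.width := by unfold width; omega
  have h6x : σ.arr 6 (h * G.width) = code x := hf.row 0 x rfl
  have h6y : σ.arr 6 (h * G.width + 1) = code y := hf.row 1 y rfl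
  have hmod : (h * G.width + 1) % 2 ^ w = h * G.width + 1 := Nat.mod_eq_of_lt (hC.cell_lt hh hw)
  have h7' := hC.succ_mod h7
  have hone := hC.one_mod
  have hend : ∀ (z : Fin G.n) (k : ℕ), z ∈ x :: y :: l' → code z ≠ σ.reg 15 → k ≤ 20 →
      WP w (.seq (.put 11 (.reg 22) (.reg 7)) (.seq (.put 12 (.const 0) (.reg 22))
        (.seq (.set 17 (.const 1)) (.set 18 (.const 0)))))
        (fun c σ' => k + c ≤ 40 ∧ σ'.reg 7 = σ.reg 7 + 1 ∧ σ'.reg 18 = 0 ∧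
      ∃ q ∈ x :: y :: l', code q ≠ σ.reg 15 ∧ G.Visited [q] σ')
      ((σ.setReg 7 (σ.reg 7 + 1)).setReg 22 (code z)) := by
    intro z k hz hzv hk
    rw [wp_seq, wp_put, wp_seq, wp_put, wp_seq, wp_set, wp_set]
    refine ⟨by simp only [Expr.cost]; omega, by simp, by simp [Expr.eval], z, hz, hzv, ?_⟩
    constructor
    · simp [Expr.eval, hone]
    · intro j v hv
      obtain ⟨rfl, rfl⟩ : j = 0 ∧ z = v := by
        cases j <;> simp_all
      simp [Expr.eval, State.setArr_arr_self]
    · intro v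
      have : σ.arr 11 (code v) ≠ σ.reg 7 + 1 := by
        have := hseen (code v)
        omega
      simp [Expr.eval, State.setArr_arr_ne, State.setArr_arr_self, this]
    · intro c
      have := hseen c
      simp only [Expr.eval, State.setReg_arr, State.setReg_reg, State.setArr_reg]
      rw [State.setArr_arr_ne _ _ _ (by decide), State.setArr_arr_self]
      simp only [State.setReg_arr, Nat.reduceEqDiff, if_false, if_true]
      split_ifs <;> omega
    · simp
  have he7 : (Expr.add (.reg 7) (.const 1)).eval w σ = σ.reg 7 + 1 := by
    simp [Expr.eval, hone, h7']
  rw [searchInit, wp_seq, incr, wp_set, he7, wp_seq, wp_ite]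
  constructor
  · intro hc
    have hv : σ.reg 15 = code x := by simpa [Expr.eval, hf.base, h6x] using hc
    rw [wp_set]
    have : (Expr.get 6 (.add (.reg 23) (.const 1))).eval w (σ.setReg 7 (σ.reg 7 + 1)) =
        code y := by
      simp [Expr.eval, hf.base, hone, hmod, h6y]
    rw [this]
    refine (hend y 19 (by simp) (by simp [hv, hxy.symm]) (by omega)).mono ?_
    rintro k σ' ⟨hk, hrest⟩
    exact ⟨by simp only [Expr.cost]; omega, hrest⟩
  · intro hc
    have hv : σ.reg 15 ≠ code x := by simpa [Expr.eval, hf.base, h6x] using hc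
    rw [wp_set]
    have : (Expr.get 6 (.reg 23)).eval w (σ.setReg 7 (σ.reg 7 + 1)) = code x := by
      simp [Expr.eval, hf.base, h6x]
    rw [this]
    refine (hend x 19 (by simp) hv.symm (by omega)).mono ?_
    rintro k σ' ⟨hk, hrest⟩
    exact ⟨by simp only [Expr.cost]; omega, hrest⟩

/-- The processed prefix of the queue is closed under search steps. Once the whole queue is
processed it is therefore exactly the set reachable from `x₀`. The cost does not involve the number
of vertices, since every queue entry but the first is charged to an edge end. -/
theorem search_spec (hC : G.Capacity w D) {σ : State} (hL : G.Loaded σ) {l : List (Fin G.n)}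
    {h : ℕ} (hf : G.Focus l h σ) (hh : h ≤ D) (hl : l.Nodup) (h2 : 2 ≤ l.length)
    (hseen : ∀ c, σ.arr 11 c ≤ σ.reg 7) (h7 : σ.reg 7 ≤ D) :
    WP w search (fun c σ' => c ≤ 200 * (G.m + 1) ∧ σ'.reg 7 = σ.reg 7 + 1 ∧
      ∃ Q, G.Visited Q σ' ∧ ∃ x₀ ∈ l, code x₀ ≠ σ.reg 15 ∧
        ∀ x, x ∈ Q ↔ Relation.ReflTransGen (G.Reaches (σ.reg 13) l (σ.reg 15)) x₀ x) σ := by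
  rw [search, wp_seq]
  refine (searchInit_spec hC hf hh hl h2 hseen h7).frame.mono ?_
  rintro c₁ σ₁ ⟨⟨hc₁, h7₁, h18, x₀, hx₀, hx₀v, hV⟩, hF₁⟩
  have hL₁ := hL.frame hF₁ (by decide) (by decide)
  have hf₁ := hf.frame hF₁ (by decide) (by decide)
  have h13₁ : σ₁.reg 13 = σ.reg 13 := hF₁.reg 13 (by decide)
  have h15₁ : σ₁.reg 15 = σ.reg 15 := hF₁.reg 15 (by decide)
  set R := G.Reaches (σ.reg 13) l (σ.reg 15) with hR
  refine (wp_loop (fun (a : List (Fin G.n) × ℕ) σ' => G.Visited a.1 σ' ∧ σ'.reg 18 = a.2 ∧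
      a.2 ≤ a.1.length ∧ x₀ ∈ a.1 ∧ (∀ x ∈ a.1, Relation.ReflTransGen R x₀ x) ∧
      ∀ j u x, j < a.2 → a.1[j]? = some u → R u x → x ∈ a.1)
    -- A vertex of degree `d` costs at most `70d + 20` to scan and 4 for the guard, and it adds at
    -- most `d` queue entries worth 24 each: hence 24 per waiting entry and `94 = 70 + 24` per edge
    -- end not yet scanned.
    (fun a => (a.1.length - a.2) * 24 + 94 * G.degreeOutside (a.1.take a.2)) ([x₀], 0)
    ⟨hV, h18, by simp, by simp, ?_, by simp⟩ ?_).mono ?_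
  · intro x hx
    obtain rfl := List.mem_singleton.1 hx
    exact .refl
  · rintro ⟨Q, i⟩ σ₂ hF₂ ⟨hV₂, h18₂, hiQ, hx₀Q, hreach, hclosed⟩ hcond
    dsimp only at *
    have hi : i < Q.length := by
      by_contra hge
      exact hcond (by simp [Expr.eval, h18₂, hV₂.length, hge])
    have hL₂ := hL₁.frame hF₂ (by decide) (by decide)
    have hf₂ := hf₁.frame hF₂ (by decide) (by decide)
    have h13₂ : σ₂.reg 13 = σ.reg 13 := by rw [hF₂.reg 13 (by decide), h13₁]
    have h15₂ : σ₂.reg 15 = σ.reg 15 := by rw [hF₂.reg 15 (by decide), h15₁]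
    have hu : Q[i]? = some Q[i] := List.getElem?_eq_getElem hi
    refine (scan_spec hC hL₂ hf₂ hh hV₂ h18₂ hu).mono ?_
    rw [h13₂, h15₂, ← hR]
    rintro c σ₃ ⟨hc, h18₃, Q', hV₃, ⟨E, rfl⟩, hlen, hfrom, hto⟩
    refine ⟨(Q ++ E, i + 1), ⟨hV₃, h18₃, ?_, by simp [hx₀Q], ?_, ?_⟩, ?_⟩
    · simp only [List.length_append]
      omega
    · intro x hx
      rcases hfrom x hx with hx | hx
      · exact hreach x hx
      · exact (hreach _ (List.getElem_mem hi)).tail hx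
    · intro j u x hj hju hux
      dsimp only at *
      have hjQ : j < Q.length := by omega
      rw [List.getElem?_append_left hjQ] at hju
      rcases Nat.lt_succ_iff_lt_or_eq.1 hj with hj' | rfl
      · exact List.mem_append_left _ (hclosed j u x hj' hju hux)
      · rw [hu, Option.some_inj] at hju
        subst hju
        exact hto x hux
    · have htake : (Q ++ E).take (i + 1) = Q.take i ++ [Q[i]] := by
        rw [List.take_append_of_le_length (by omega), List.take_succ_eq_append_getElem hi]
      have hnotin : Q[i] ∉ Q.take i := by
        intro hmem
        have := (List.nodup_iff_injective_getElem.1 hV₂.nodup)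
        obtain ⟨j, hj, hjeq⟩ := List.mem_iff_getElem.1 hmem
        simp only [List.length_take] at hj
        rw [List.getElem_take] at hjeq
        have := @this ⟨j, by omega⟩ ⟨i, hi⟩ hjeq
        simp only [Fin.mk.injEq] at this
        omega
      have hdeg := degreeOutside_append hnotin
      dsimp only
      rw [htake]
      simp only [List.length_append, Expr.cost] at hlen ⊢
      omega
  · rintro c σ₂ ⟨hc, ⟨⟨Q, i⟩, hV₂, h18₂, hiQ, hx₀Q, hreach, hclosed⟩, hcond, hF₂⟩
    dsimp only at *
    have hi : i = Q.length := by
      simp only [Expr.eval, h18₂, hV₂.length] at hcond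
      split_ifs at hcond
      omega
    refine ⟨?_, ?_, Q, hV₂, x₀, hx₀, hx₀v, fun x => ⟨hreach x, fun hx => ?_⟩⟩
    · have := G.degreeOutside_le []
      simp only [List.length_singleton, Nat.sub_zero, List.take_zero, Expr.cost] at hc
      omega
    · rw [hF₂.reg 7 (by decide), h7₁]
    · induction hx with
      | refl => exact hx₀Q
      | tail _ hbc ih =>
        obtain ⟨j, hj⟩ := List.mem_iff_getElem?.1 ih
        have hj' := (List.getElem?_eq_some_iff.1 hj).1
        exact hclosed j _ _ (hi ▸ hj') hj hbc

end GraphSequence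

namespace GraphSequence

open WordRAM Cmd
open Program

variable {G : GraphSequence} {w D s : ℕ}

/-! ### Testing two-vertex connectivity -/

/-- The number of vertices that remain when the vertex with code `v`, or none, is deleted. -/
theorem card_filter_code_ne {n : ℕ} {l : List (Fin n)} (hl : l.Nodup) {v : ℕ}
    (hv : v = 0 ∨ ∃ z ∈ l, code z = v) :
    (l.toFinset.filter fun x => code x ≠ v).card + (if 0 < v then 1 else 0) = l.length := by
  rcases hv with rfl | ⟨z, hz, rfl⟩
  · rw [Finset.filter_true_of_mem fun x _ => (code_pos x).ne', List.toFinset_card_of_nodup hl]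
    simp
  · have : (l.toFinset.filter fun x => code x ≠ code z) = l.toFinset.erase z := by
      ext x
      simp [and_comm]
    rw [this, Finset.card_erase_of_mem (by simpa using hz), List.toFinset_card_of_nodup hl,
      if_pos (code_pos z)]
    have := List.length_pos_of_mem hz
    omega

/-- The vertices that are reached from `x₀` without passing through `v`. -/
theorem mem_of_reaches {t v : ℕ} {l : List (Fin G.n)} {x₀ x : Fin G.n} (h₀ : x₀ ∈ l)
    (h₀v : code x₀ ≠ v) (h : Relation.ReflTransGen (G.Reaches t l v) x₀ x) :
    x ∈ l ∧ code x ≠ v := by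
  induction h with
  | refl => exact ⟨h₀, h₀v⟩
  | tail _ hbc _ => exact hbc.2

/-- The reached vertices are among the remaining ones, and counting shows that they are all of them.
-/
theorem connected_of_reaches {t v : ℕ} {l Q : List (Fin G.n)} {x₀ : Fin G.n} (hl : l.Nodup)
    (hv : v = 0 ∨ ∃ z ∈ l, code z = v) (h₀ : x₀ ∈ l) (h₀v : code x₀ ≠ v)
    (hQ : ∀ x, x ∈ Q ↔ Relation.ReflTransGen (G.Reaches t l v) x₀ x)
    (hlen : l.length ≤ Q.length + if 0 < v then 1 else 0) (hQn : Q.Nodup) :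
    ((G.snapshot t).induce
      ((l.toFinset.filter fun x => code x ≠ v : Finset (Fin G.n)) : Set (Fin G.n))).Connected := by
  have hsub : Q.toFinset ⊆ l.toFinset.filter fun x => code x ≠ v := fun x hx => by
    simpa using mem_of_reaches h₀ h₀v ((hQ x).1 (List.mem_toFinset.1 hx))
  have heq := Finset.eq_of_subset_of_card_le hsub (by
    have := card_filter_code_ne hl hv
    rw [List.toFinset_card_of_nodup hQn]
    omega)
  refine connected_induce_of_reach (x := x₀) (by simp [h₀, h₀v]) fun y hy => ?_
  have hyQ : y ∈ Q := by
    rw [← List.mem_toFinset, heq]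
    exact hy
  refine ((hQ y).1 hyQ).lift id fun a b hab => ⟨hab.1, ?_⟩
  simp [hab.2]

/-- Being closed under search steps, `Q` has no edge to the rest of the set except possibly to the
deleted vertex, and the count leaves a vertex outside. This is a separation with `S = Q` and `X`
empty or the deleted vertex. -/
theorem splits_of_reaches {t v : ℕ} {l Q : List (Fin G.n)} {x₀ : Fin G.n} (hl : l.Nodup)
    (hv : v = 0 ∨ ∃ z ∈ l, code z = v) (h₀ : x₀ ∈ l) (h₀v : code x₀ ≠ v)
    (hQ : ∀ x, x ∈ Q ↔ Relation.ReflTransGen (G.Reaches t l v) x₀ x)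
    (hlen : (Q.length + if 0 < v then 1 else 0) < l.length) :
    Splits s (G.snapshot t) l.toFinset (l.filter fun x => code x = v ∨ x ∈ Q).toFinset
      (l.filter fun x => x ∉ Q).toFinset := by
  have hmem : ∀ x ∈ Q, x ∈ l ∧ code x ≠ v := fun x hx => mem_of_reaches h₀ h₀v ((hQ x).1 hx)
  have key := splits_of_separation (s := s) (H := G.snapshot t) (U := l.toFinset)
    (S := Q.toFinset) (X := l.toFinset.filter fun x => code x = v) ?_ (Finset.filter_subset _ _)
    (fun x hx => by simpa using (hmem x (List.mem_toFinset.1 hx)).1) ?_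
    ⟨x₀, by simpa using (hQ x₀).2 .refl⟩ ?_ ?_
  · convert key using 1
    · ext x
      simp only [List.mem_toFinset, List.mem_filter, decide_eq_true_eq, Finset.mem_union,
        Finset.mem_filter]
      have := hmem x
      tauto
    · ext x
      simp
  · refine Finset.card_le_one.2 fun a ha b hb => ?_
    simp only [Finset.mem_filter] at ha hb
    exact code_injective (ha.2.trans hb.2.symm)
  · rw [Finset.disjoint_left]
    intro x hx
    have := hmem x (List.mem_toFinset.1 hx)
    simp [this]
  · by_contra! hcon
    have hsub : (l.toFinset.filter fun x => code x ≠ v) ⊆ Q.toFinset := fun x hx => by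
      simp only [Finset.mem_filter] at hx
      by_contra hxQ
      have := hcon x hx.1 hxQ
      simp only [Finset.mem_filter] at this
      exact hx.2 this.2
    have h₁ := Finset.card_le_card hsub
    have h₂ := List.toFinset_card_le Q
    have h₃ := card_filter_code_ne hl hv
    omega
  · intro x hx y hy hyQ hyX hadj
    have hxQ := List.mem_toFinset.1 hx
    refine hyQ (List.mem_toFinset.2 ((hQ y).2 (((hQ x).1 hxQ).tail ⟨hadj, ?_, ?_⟩)))
    · simpa using hy
    · simpa [List.mem_toFinset.1 hy] using hyX

/-- The outcome of a failed test at time stamp `t`: the search that failed is still in memory and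
splits the vertex set `l`. -/
def Separated (G : GraphSequence) (s t : ℕ) (l : List (Fin G.n)) (σ : State) : Prop :=
  ∃ Q, G.Visited Q σ ∧ Splits s (G.snapshot t) l.toFinset
    (l.filter fun x => code x = σ.reg 15 ∨ x ∈ Q).toFinset (l.filter fun x => x ∉ Q).toFinset

/-- The vertex that is deleted in round `i` of the test of `l`. -/
def deleted {n : ℕ} (l : List (Fin n)) (i : ℕ) : ℕ := (l[i]?.map code).getD 0

theorem deleted_eq {n : ℕ} (l : List (Fin n)) (i : ℕ) :
    deleted l i = 0 ∨ ∃ z ∈ l, code z = deleted l i := by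
  unfold deleted
  rcases h : l[i]? with _ | z
  · simp
  · exact .inr ⟨z, List.mem_of_getElem? h, by simp⟩

theorem testVertex_spec (hC : G.Capacity w D) {σ : State} (hL : G.Loaded σ)
    {l : List (Fin G.n)} {h : ℕ} (hf : G.Focus l h σ) (hh : h ≤ D) (hl : l.Nodup)
    (h2 : 2 ≤ l.length) (hseen : ∀ c, σ.arr 11 c ≤ σ.reg 7) (h7 : σ.reg 7 ≤ D)
    (h14 : σ.reg 14 = 0) {i : ℕ} (hi : σ.reg 16 = i) :
    WP w testVertex (fun c σ' => c ≤ 240 * (G.m + 1) ∧ σ'.reg 7 = σ.reg 7 + 1 ∧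
      (∀ c, σ'.arr 11 c ≤ σ'.reg 7) ∧
      ((σ'.reg 14 = 0 ∧ ((G.snapshot (σ.reg 13)).induce ((l.toFinset.filter fun x =>
          code x ≠ deleted l i : Finset (Fin G.n)) : Set (Fin G.n))).Connected) ∨
        (σ'.reg 14 = 1 ∧ G.Separated s (σ.reg 13) l σ'))) σ := by
  have hlen : l.length ≤ G.n := length_le_of_nodup hl
  have hset : WP w (.ite (.lt (.reg 16) (.reg 9)) (.set 15 (.get 6 (.add (.reg 23) (.reg 16))))
      (.set 15 (.const 0))) (fun c σ' => c ≤ 20 ∧ σ' = σ.setReg 15 (deleted l i)) σ := by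
    rw [wp_ite, wp_set, wp_set]
    constructor
    · intro hc
      refine ⟨by simp [Expr.cost], ?_⟩
      have hil : i < l.length := by
        by_contra hge
        exact hc (by simp [Expr.eval, hi, hf.length, hge])
      have hx : l[i]? = some l[i] := List.getElem?_eq_getElem hil
      have hmod : (h * G.width + i) % 2 ^ w = h * G.width + i :=
        Nat.mod_eq_of_lt (hC.cell_lt hh (by unfold width; omega))
      simp [Expr.eval, hf.base, hi, hmod, hf.row i _ hx, deleted, hx]
    · intro hc
      refine ⟨by simp [Expr.cost], ?_⟩
      have hil : l.length ≤ i := by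
        simp only [Expr.eval, hi, hf.length] at hc
        split_ifs at hc
        omega
      simp [Expr.eval, deleted, List.getElem?_eq_none hil]
  have hone := hC.one_mod
  rw [testVertex, wp_seq]
  refine hset.mono ?_
  rintro c₁ _ ⟨hc₁, rfl⟩
  rw [wp_seq]
  refine (search_spec (σ := σ.setReg 15 (deleted l i)) hC
    (hL.congr (fun x hx => by simp; omega) fun _ _ => rfl)
    (h := h) (l := l) ⟨by simp [hf.index], by simp [hf.length], by simp [hf.base], hf.row,
      hf.member⟩ hh hl h2 (by simpa using hseen) (by simpa using h7)).frame.mono ?_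
  simp only [State.setReg_reg, Nat.reduceEqDiff, if_false, if_true]
  rintro c₂ σ₂ ⟨⟨hc₂, h7₂, Q, hQ, x₀, hx₀, hx₀v, hreach⟩, hF⟩
  have h9 : σ₂.reg 9 = l.length := by rw [hF.reg 9 (by decide)]; simp [hf.length]
  have h15 : σ₂.reg 15 = deleted l i := by rw [hF.reg 15 (by decide)]; simp
  have h14₂ : σ₂.reg 14 = 0 := by rw [hF.reg 14 (by decide)]; simp [h14]
  have heval : (Expr.add (.reg 17) (.lt (.const 0) (.reg 15))).eval w σ₂ =
      Q.length + if 0 < deleted l i then 1 else 0 := by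
    simp only [Expr.eval, hQ.length, h15, Nat.zero_mod]
    refine Nat.mod_eq_of_lt (hC.lt_of_le ?_)
    have h₁ := length_le_of_nodup hQ.nodup
    have h₂ := hC.n_le
    split_ifs <;> omega
  rw [wp_ite]
  constructor
  · intro hc
    have hlt : (Q.length + if 0 < deleted l i then 1 else 0) < l.length := by
      by_contra hge
      refine hc ?_
      rw [Expr.eval, heval]
      simp [Expr.eval, h9, hge]
    rw [wp_set]
    refine ⟨by simp only [Expr.cost]; omega, by simp [h7₂], by simpa using hQ.seen_le,
      .inr ⟨by simp [Expr.eval, hone], Q, hQ.setReg (by decide) (by decide), ?_⟩⟩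
    simp only [State.setReg_reg, Nat.reduceEqDiff, if_false, h15]
    exact splits_of_reaches hl (deleted_eq l i) hx₀ hx₀v hreach hlt
  · intro hc
    have hge : l.length ≤ Q.length + if 0 < deleted l i then 1 else 0 := by
      rw [Expr.eval, heval] at hc
      simp only [Expr.eval, h9, ite_eq_right_iff, one_ne_zero, imp_false, not_lt] at hc
      exact hc
    rw [wp_skip]
    exact ⟨by simp only [Expr.cost]; omega, h7₂, hQ.seen_le, .inl ⟨h14₂,
      connected_of_reaches hl (deleted_eq l i) hx₀ hx₀v hreach hge hQ.nodup⟩⟩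

/-- Round `i < l.length` deletes the vertex `l[i]`. In round `l.length` the default value 0 of
`deleted` is no vertex code, so nothing is deleted. -/
theorem twoVertexConnected_of_deleted {t : ℕ} {l : List (Fin G.n)} (hl : l.Nodup)
    (hs : s ≤ l.length)
    (h : ∀ i < l.length + 1, ((G.snapshot t).induce ((l.toFinset.filter fun x =>
      code x ≠ deleted l i : Finset (Fin G.n)) : Set (Fin G.n))).Connected) :
    TwoVertexConnected s (G.snapshot t) l.toFinset := by
  refine ⟨by rwa [List.toFinset_card_of_nodup hl], ?_, ?_⟩
  · have := h l.length (by omega)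
    have hd : deleted l l.length = 0 := by simp [deleted]
    rwa [hd, Finset.filter_true_of_mem fun x _ => (code_pos x).ne'] at this
  · intro v hv
    obtain ⟨i, hi⟩ := List.mem_iff_getElem?.1 (List.mem_toFinset.1 hv)
    have hi' := (List.getElem?_eq_some_iff.1 hi).1
    have := h i (by omega)
    have hd : deleted l i = code v := by simp [deleted, hi]
    rw [hd] at this
    have he : l.toFinset.erase v = l.toFinset.filter fun x => code x ≠ code v := by
      ext x
      simp [and_comm]
    rwa [he]

theorem test_spec (hC : G.Capacity w D) {σ : State} (hL : G.Loaded σ)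
    {l : List (Fin G.n)} {h : ℕ} (hf : G.Focus l h σ) (hh : h ≤ D) (hl : l.Nodup)
    (h2 : 2 ≤ l.length) (hs : s ≤ l.length) (hseen : ∀ c, σ.arr 11 c ≤ σ.reg 7)
    (h7 : σ.reg 7 + l.length ≤ D) :
    WP w test (fun c σ' => c ≤ 800 * (l.length * (G.m + 1)) ∧
      σ'.reg 7 ≤ σ.reg 7 + l.length + 1 ∧ (∀ c, σ'.arr 11 c ≤ σ'.reg 7) ∧
      ((σ'.reg 14 = 0 ∧ TwoVertexConnected s (G.snapshot (σ.reg 13)) l.toFinset) ∨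
        (σ'.reg 14 = 1 ∧ G.Separated s (σ.reg 13) l σ'))) σ := by
  have hlen : l.length ≤ G.n := length_le_of_nodup hl
  have hnD := hC.n_le
  have hone := hC.one_mod
  have hsucc := hC.succ_mod (r := l.length) (by omega)
  have h0 : (Expr.const 0).eval w σ = 0 := by simp [Expr.eval]
  rw [test, wp_seq, wp_set, h0]
  set σ₁ := σ.setReg 14 0 with hσ₁
  have hL₁ : G.Loaded σ₁ := hL.congr (fun x hx => by simp [hσ₁]; omega) fun _ _ => rfl
  have hf₁ : G.Focus l h σ₁ := ⟨by simp [hσ₁, hf.index], by simp [hσ₁, hf.length],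
    by simp [hσ₁, hf.base], hf.row, hf.member⟩
  refine (wp_for (fun i σ' => σ'.reg 7 ≤ σ.reg 7 + i ∧ (∀ c, σ'.arr 11 c ≤ σ'.reg 7) ∧
    ((σ'.reg 14 = 0 ∧ ∀ i' < i, ((G.snapshot (σ.reg 13)).induce ((l.toFinset.filter fun x =>
      code x ≠ deleted l i' : Finset (Fin G.n)) : Set (Fin G.n))).Connected) ∨
      (σ'.reg 14 = 1 ∧ G.Separated s (σ.reg 13) l σ'))) (245 * (G.m + 1)) (l.length + 1)
    (hC.lt_of_le (by omega)) (by decide) ?_ ?_ ?_).mono ?_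
  · intro σ' hF
    have h9 : σ'.reg 9 = l.length := by rw [hF.reg 9 (by decide), hf₁.length]
    simp [Expr.eval, h9, hone, hsucc]
  · exact ⟨by simp [hσ₁], by simpa [hσ₁] using hseen, .inl ⟨by simp [hσ₁], by simp⟩⟩
  · rintro i hi σ' hF h16 ⟨h7', hseen', hor⟩
    have hL' := hL₁.frame hF (by decide) (by decide)
    have hf' := hf₁.frame hF (by decide) (by decide)
    have h13 : σ'.reg 13 = σ.reg 13 := by rw [hF.reg 13 (by decide)]; simp [hσ₁]
    have hsep : ∀ σ'' v, G.Separated s (σ.reg 13) l σ'' →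
        G.Separated s (σ.reg 13) l (σ''.setReg 16 v) := by
      rintro σ'' v ⟨Q, hQ, hsplit⟩
      exact ⟨Q, hQ.setReg (by decide) (by decide), by simpa using hsplit⟩
    rw [wp_ite]
    constructor
    · intro hc
      rw [wp_skip]
      refine ⟨by simp only [Expr.cost]; omega, by simp; omega, by simpa using hseen', ?_⟩
      rcases hor with ⟨h14, -⟩ | ⟨h14, h⟩
      · exact absurd h14 hc
      · exact .inr ⟨by simp [h14], hsep _ _ h⟩
    · intro hc
      have h14 : σ'.reg 14 = 0 := hc
      have hconn := (hor.resolve_right (by simp [h14])).2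
      refine (testVertex_spec (s := s) hC hL' hf' hh hl h2 hseen' (by omega) h14 h16).mono ?_
      rw [h13]
      rintro c σ'' ⟨hc, h7'', hseen'', hor'⟩
      refine ⟨by simp only [Expr.cost]; omega, by simp; omega, by simpa using hseen'', ?_⟩
      rcases hor' with ⟨h14, h⟩ | ⟨h14, h⟩
      · refine .inl ⟨by simp [h14], fun i' hi' => ?_⟩
        rcases Nat.lt_succ_iff_lt_or_eq.1 hi' with hi'' | rfl
        · exact hconn i' hi''
        · exact h
      · exact .inr ⟨by simp [h14], hsep _ _ h⟩
  · rintro c σ' ⟨hc, ⟨h7', hseen', hor⟩, hF⟩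
    refine ⟨?_, by omega, hseen', ?_⟩
    · simp only [Expr.cost] at hc ⊢
      -- The additional round without deletion is absorbed by `2 ≤ l.length`, leaving a multiple of
      -- `l.length * (G.m + 1)`.
      have h₁ : (l.length + 1) * (245 * (G.m + 1) + (1 + 1 + 1) + 7) ≤
          (l.length + 1) * (255 * (G.m + 1)) := Nat.mul_le_mul_left _ (by omega)
      have h₂ : (l.length + 1) * (255 * (G.m + 1)) =
          255 * (l.length * (G.m + 1)) + 255 * (G.m + 1) := by ring
      have h₃ : 2 * (G.m + 1) ≤ l.length * (G.m + 1) := Nat.mul_le_mul_right _ h2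
      omega
    · rcases hor with ⟨h14, h⟩ | h
      · exact .inl ⟨h14, twoVertexConnected_of_deleted hl hs h⟩
      · exact .inr h

/-! ### Finding the first failing time stamp -/

theorem Separated.not_connected {t : ℕ} {l : List (Fin G.n)} {σ : State}
    (h : G.Separated s t l σ) : ¬ TwoVertexConnected s (G.snapshot t) l.toFinset := by
  obtain ⟨Q, -, hQ⟩ := h
  exact hQ.not_connected

/-- Register 11 always holds a failing stamp not before the start. A candidate is tested only if it
could improve on it, so afterwards the candidate is connected, out of range, or not before the
minimum. -/
theorem tryStamp_spec (hC : G.Capacity w D) {σ : State} (hL : G.Loaded σ)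
    {l : List (Fin G.n)} {h : ℕ} (hf : G.Focus l h σ) (hh : h ≤ D) (hl : l.Nodup)
    (h2 : 2 ≤ l.length) (hs : s ≤ l.length) (hseen : ∀ c, σ.arr 11 c ≤ σ.reg 7)
    (h7 : σ.reg 7 + l.length ≤ D)
    (hbest : ¬ TwoVertexConnected s (G.snapshot (σ.reg 11)) l.toFinset)
    (hle : σ.reg 10 ≤ σ.reg 11) :
    WP w tryStamp (fun c σ' => c ≤ 810 * (l.length * (G.m + 1)) ∧
      σ'.reg 7 ≤ σ.reg 7 + l.length + 1 ∧ (∀ c, σ'.arr 11 c ≤ σ'.reg 7) ∧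
      ¬ TwoVertexConnected s (G.snapshot (σ'.reg 11)) l.toFinset ∧
      σ'.reg 11 ≤ σ.reg 11 ∧ σ.reg 10 ≤ σ'.reg 11 ∧
      (σ.reg 10 ≤ σ.reg 13 → σ.reg 13 < σ'.reg 11 →
        TwoVertexConnected s (G.snapshot (σ.reg 13)) l.toFinset)) σ := by
  have h₃ : 2 * 1 ≤ l.length * (G.m + 1) := Nat.mul_le_mul h2 (by omega)
  rw [tryStamp, wp_ite]
  constructor
  · intro hc
    have hlt : σ.reg 13 < σ.reg 10 := Expr.lt_eval_ne_zero.1 hc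
    rw [wp_skip]
    exact ⟨by simp only [Expr.cost]; omega, by omega, hseen, hbest, le_rfl, hle,
      fun h' => absurd h' (by omega)⟩
  intro hc
  rw [wp_ite]
  constructor
  swap
  · intro hc'
    have hge : σ.reg 11 ≤ σ.reg 13 := Expr.lt_eval_eq_zero.1 hc'
    rw [wp_skip]
    exact ⟨by simp only [Expr.cost]; omega, by omega, hseen, hbest, le_rfl, hle,
      fun _ h' => absurd h' (by omega)⟩
  intro hc'
  have hge : σ.reg 10 ≤ σ.reg 13 := Expr.lt_eval_eq_zero.1 hc
  have hlt : σ.reg 13 < σ.reg 11 := Expr.lt_eval_ne_zero.1 hc'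
  rw [wp_seq]
  refine (test_spec hC hL hf hh hl h2 hs hseen h7).frame.mono ?_
  rintro c σ' ⟨⟨hc, h7', hseen', hor⟩, hF⟩
  have h11 : σ'.reg 11 = σ.reg 11 := hF.reg 11 (by decide)
  have h13 : σ'.reg 13 = σ.reg 13 := hF.reg 13 (by decide)
  rw [wp_ite]
  constructor
  · intro hc'
    have hsep := hor.resolve_left (by
      rintro ⟨h14, -⟩
      exact hc' h14)
    rw [wp_set]
    refine ⟨by simp only [Expr.cost]; omega, by simpa using h7', by simpa using hseen', ?_, ?_, ?_,
      ?_⟩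
    · simpa [Expr.eval, h13] using hsep.2.not_connected
    · simp [Expr.eval, h13, hlt.le]
    · simp [Expr.eval, h13, hge]
    · intro _ h'
      simp [Expr.eval, h13] at h'
  · intro hc'
    have hconn := hor.resolve_right (by
      rintro ⟨h14, -⟩
      have : σ'.reg 14 = 0 := hc'
      omega)
    rw [wp_skip]
    exact ⟨by simp only [Expr.cost]; omega, h7', hseen', by rwa [h11], h11.le, by rwa [h11],
      fun _ _ => hconn.2⟩

/-- The `m + 2` tests are those of the start stamp, of the `m` stamps after the ends of edges, and
the repetition for the minimum. Each uses at most `l.length + 1` new search numbers. -/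
theorem findFailure_spec (hs2 : 2 ≤ s) (hC : G.Capacity w D) {σ : State} (hL : G.Loaded σ)
    {l : List (Fin G.n)} {h : ℕ} (hf : G.Focus l h σ) (hh : h ≤ D) (hl : l.Nodup)
    (hs : s ≤ l.length) (hseen : ∀ c, σ.arr 11 c ≤ σ.reg 7)
    (h7 : σ.reg 7 + (G.m + 2) * (l.length + 1) ≤ D) (h10 : σ.reg 10 ≤ G.tmax + 1) :
    WP w findFailure (fun c σ' => c ≤ 4000 * (l.length * (G.m + 1) ^ 2) ∧
      σ'.reg 7 ≤ σ.reg 7 + (G.m + 2) * (l.length + 1) ∧ (∀ c, σ'.arr 11 c ≤ σ'.reg 7) ∧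
      G.FirstFailure s l.toFinset (σ.reg 10) (σ'.reg 11) ∧ σ'.reg 11 ≤ G.tmax + 1 ∧
      G.Separated s (σ'.reg 11) l σ') σ := by
  have h2 : 2 ≤ l.length := hs2.trans hs
  have hone := hC.one_mod
  have htm := hC.succ_mod (r := G.tmax) (by have := hC.tmax_le; omega)
  have hmul : (G.m + 2) * (l.length + 1) = G.m * (l.length + 1) + 2 * (l.length + 1) := by ring
  have hfail : ¬ TwoVertexConnected s (G.snapshot (G.tmax + 1)) l.toFinset := fun hcon => by
    have := (mem_stamps_of_twoVertexConnected hs2 hcon).2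
    omega
  have e11 : (Expr.add (.reg 2) (.const 1)).eval w σ = G.tmax + 1 := by
    simp [Expr.eval, hL.tmax, hone, htm]
  rw [findFailure, wp_seq, wp_set, e11, wp_seq, wp_set]
  have e13 : (Expr.reg 10).eval w (σ.setReg 11 (G.tmax + 1)) = σ.reg 10 := by simp [Expr.eval]
  rw [e13]
  set σ₁ := (σ.setReg 11 (G.tmax + 1)).setReg 13 (σ.reg 10) with hσ₁
  have hL₁ : G.Loaded σ₁ := hL.congr (fun x hx => by
    simp only [hσ₁, State.setReg_reg]
    rw [if_neg (by omega), if_neg (by omega)]) fun _ _ => rfl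
  have hf₁ : G.Focus l h σ₁ := ⟨by simp [hσ₁, hf.index], by simp [hσ₁, hf.length],
    by simp [hσ₁, hf.base], hf.row, hf.member⟩
  rw [wp_seq]
  refine (tryStamp_spec hC hL₁ hf₁ hh hl h2 hs (by simpa [hσ₁] using hseen)
    (by simp [hσ₁]; omega) (by simpa [hσ₁] using hfail) (by simpa [hσ₁] using h10)).frame.mono ?_
  have r7 : σ₁.reg 7 = σ.reg 7 := by simp [hσ₁]
  have r10 : σ₁.reg 10 = σ.reg 10 := by simp [hσ₁]
  have r11 : σ₁.reg 11 = G.tmax + 1 := by simp [hσ₁]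
  have r13 : σ₁.reg 13 = σ.reg 10 := by simp [hσ₁]
  rw [r7, r10, r11, r13]
  rintro c₂ σ₂ ⟨⟨hc₂, h7₂, hseen₂, hbest₂, hle₂, hge₂, ha₂⟩, hF₂⟩
  have hL₂ := hL₁.frame hF₂ (by decide) (by decide)
  have hf₂ := hf₁.frame hF₂ (by decide) (by decide)
  have h10₂ : σ₂.reg 10 = σ.reg 10 := by rw [hF₂.reg 10 (by decide), r10]
  rw [wp_seq]
  refine (wp_for (fun i σ' => σ'.reg 7 ≤ σ.reg 7 + (i + 1) * (l.length + 1) ∧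
      (∀ c, σ'.arr 11 c ≤ σ'.reg 7) ∧
      ¬ TwoVertexConnected s (G.snapshot (σ'.reg 11)) l.toFinset ∧ σ'.reg 11 ≤ σ₂.reg 11 ∧
      σ.reg 10 ≤ σ'.reg 11 ∧
      ∀ e : Fin G.m, e < i → σ.reg 10 ≤ G.last e + 1 → G.last e + 1 < σ'.reg 11 →
        TwoVertexConnected s (G.snapshot (G.last e + 1)) l.toFinset)
    (820 * (l.length * (G.m + 1))) G.m (hC.lt_of_le (by have := hC.m_le; omega)) (by decide)
    ?_ ?_ ?_).mono ?_
  · intro σ' hF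
    simp only [Expr.eval]
    rw [hF.reg 1 (by decide), hL₂.m]
  · exact ⟨by simp; omega, by simpa using hseen₂, by simpa using hbest₂, by simp,
      by simpa using hge₂, fun e he => absurd he (by omega)⟩
  · rintro i hi σ' hF h12 ⟨h7', hseen', hbest', hle', hge', hc'⟩
    have hL' := hL₂.frame hF (by decide) (by decide)
    have hf' := hf₂.frame hF (by decide) (by decide)
    have h10' : σ'.reg 10 = σ.reg 10 := by rw [hF.reg 10 (by decide), h10₂]
    have hlast := hC.succ_mod (r := G.last ⟨i, hi⟩) (by
      have := G.last_le_tmax ⟨i, hi⟩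
      have := hC.tmax_le
      omega)
    have e13 : (Expr.add (.get 3 (.reg 12)) (.const 1)).eval w σ' = G.last ⟨i, hi⟩ + 1 := by
      simp only [Expr.eval, h12, hone]
      rw [show σ'.arr 3 i = G.last ⟨i, hi⟩ from hL'.last ⟨i, hi⟩, hlast]
    rw [wp_seq, wp_set, e13]
    have hi7 : (i + 1) * (l.length + 1) + (l.length + 1) ≤ (G.m + 2) * (l.length + 1) := by
      have : (i + 2) * (l.length + 1) ≤ (G.m + 2) * (l.length + 1) :=
        Nat.mul_le_mul_right _ (by omega)
      have h' : (i + 1) * (l.length + 1) + (l.length + 1) = (i + 2) * (l.length + 1) := by ring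
      omega
    set σ₃ := σ'.setReg 13 (G.last ⟨i, hi⟩ + 1) with hσ₃
    have hL₃ : G.Loaded σ₃ := hL'.congr (fun x hx => by simp [hσ₃]; omega) fun _ _ => rfl
    have hf₃ : G.Focus l h σ₃ := ⟨by simp [hσ₃, hf'.index], by simp [hσ₃, hf'.length],
      by simp [hσ₃, hf'.base], hf'.row, hf'.member⟩
    have q7 : σ₃.reg 7 = σ'.reg 7 := by simp [hσ₃]
    have q10 : σ₃.reg 10 = σ.reg 10 := by simp [hσ₃, h10']
    have q11 : σ₃.reg 11 = σ'.reg 11 := by simp [hσ₃]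
    have q13 : σ₃.reg 13 = G.last ⟨i, hi⟩ + 1 := by simp [hσ₃]
    refine (tryStamp_spec hC hL₃ hf₃ hh hl h2 hs (by simpa [hσ₃] using hseen')
      (by rw [q7]; omega) (by rwa [q11]) (by rwa [q10, q11])).mono ?_
    rw [q7, q10, q11, q13]
    rintro c σ'' ⟨hc, h7'', hseen'', hbest'', hle'', hge'', ha''⟩
    refine ⟨?_, ?_, by simpa using hseen'', by simpa using hbest'', ?_, by simpa using hge'', ?_⟩
    · have h₃ : 2 * 1 ≤ l.length * (G.m + 1) := Nat.mul_le_mul h2 (by omega)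
      simp only [Expr.cost]
      omega
    · have h' : (i + 1 + 1) * (l.length + 1) = (i + 1) * (l.length + 1) + (l.length + 1) := by ring
      simp only [State.setReg_reg, Nat.reduceEqDiff, if_false]
      omega
    · simp only [State.setReg_reg, Nat.reduceEqDiff, if_false]
      omega
    · simp only [State.setReg_reg, Nat.reduceEqDiff, if_false]
      intro e he hle hlt
      rcases Nat.lt_succ_iff_lt_or_eq.1 he with he' | he'
      · exact hc' e he' hle (by omega)
      · obtain rfl : e = ⟨i, hi⟩ := Fin.ext he'
        exact ha'' hle hlt
  · rintro c₄ σ₄ ⟨hc₄, ⟨h7₄, hseen₄, hbest₄, hle₄, hge₄, hall₄⟩, hF₄⟩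
    have hL₄ := hL₂.frame hF₄ (by decide) (by decide)
    have hf₄ := hf₂.frame hF₄ (by decide) (by decide)
    have hmul' : (G.m + 1) * (l.length + 1) = G.m * (l.length + 1) + (l.length + 1) := by ring
    rw [wp_seq, wp_set]
    have e13 : (Expr.reg 11).eval w σ₄ = σ₄.reg 11 := rfl
    rw [e13]
    set σ₅ := σ₄.setReg 13 (σ₄.reg 11) with hσ₅
    have hL₅ : G.Loaded σ₅ := hL₄.congr (fun x hx => by simp [hσ₅]; omega) fun _ _ => rfl
    have hf₅ : G.Focus l h σ₅ := ⟨by simp [hσ₅, hf₄.index], by simp [hσ₅, hf₄.length],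
      by simp [hσ₅, hf₄.base], hf₄.row, hf₄.member⟩
    have q7 : σ₅.reg 7 = σ₄.reg 7 := by simp [hσ₅]
    have q13 : σ₅.reg 13 = σ₄.reg 11 := by simp [hσ₅]
    have q11 : σ₅.reg 11 = σ₄.reg 11 := by simp [hσ₅]
    refine (test_spec hC hL₅ hf₅ hh hl h2 hs (by simpa [hσ₅] using hseen₄)
      (by rw [q7]; omega)).frame.mono ?_
    rw [q7, q13]
    rintro c₆ σ₆ ⟨⟨hc₆, h7₆, hseen₆, hor⟩, hF₆⟩
    have h11 : σ₆.reg 11 = σ₄.reg 11 := by rw [hF₆.reg 11 (by decide), q11]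
    rw [h11]
    -- The repeated test has to fail, because the minimum is a failing stamp by the invariant.
    have hsep := hor.resolve_left fun hcon => hbest₄ hcon.2
    refine ⟨?_, by omega, hseen₆, ?_, by omega, hsep.2⟩
    · have h₁ : G.m * (820 * (l.length * (G.m + 1)) + 1 + 7) ≤
          G.m * (830 * (l.length * (G.m + 1))) := Nat.mul_le_mul_left _ (by
        have h₃ : 2 * 1 ≤ l.length * (G.m + 1) := Nat.mul_le_mul h2 (by omega)
        omega)
      have h₂ : l.length * (G.m + 1) ^ 2 = G.m * (l.length * (G.m + 1)) +
        l.length * (G.m + 1) := by ring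
      have h₂' : G.m * (830 * (l.length * (G.m + 1))) = 830 * (G.m * (l.length * (G.m + 1))) := by
        ring
      have h₃ : 2 * 1 ≤ l.length * (G.m + 1) := Nat.mul_le_mul h2 (by omega)
      simp only [Expr.cost] at hc₄ ⊢
      omega
    · exact firstFailure_of_candidates hge₄ hbest₄ (fun h' => ha₂ le_rfl (by omega))
        fun e h₁ h₂ => hall₄ e e.2 h₁ h₂

end GraphSequence

namespace GraphSequence

open WordRAM Cmd
open Program

variable {G : GraphSequence} {w D s : ℕ}

/-! ### The trie of recorded sets -/

/-- The trie in memory: `node l` is the number of the node with path `l`, or `0` if there is no such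
node, and the marked nodes are those with paths in `R`. -/
structure Trie (G : GraphSequence) (R : List (List (Fin G.n))) (node : List (Fin G.n) → ℕ)
    (σ : State) : Prop where
  root : node [] = 1
  le : ∀ l, node l ≤ σ.reg 8
  inj : ∀ l l', node l = node l' → node l ≠ 0 → l = l'
  closed : ∀ l x, node (l ++ [x]) ≠ 0 → node l ≠ 0
  child : ∀ l x, node l ≠ 0 → σ.arr 13 (node l * G.width + code x) = node (l ++ [x])
  mark : ∀ l, node l ≠ 0 → σ.arr 14 (node l) = if l ∈ R then 1 else 0
  fresh_child : ∀ i c, σ.reg 8 < i → c < G.width → σ.arr 13 (i * G.width + c) = 0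
  fresh_mark : ∀ i, σ.reg 8 < i → σ.arr 14 i = 0
  mem : ∀ l ∈ R, node l ≠ 0

theorem Trie.congr {σ σ' : State} {R : List (List (Fin G.n))} {node : List (Fin G.n) → ℕ}
    (ht : G.Trie R node σ) (h8 : σ'.reg 8 = σ.reg 8) (h13 : σ'.arr 13 = σ.arr 13)
    (h14 : σ'.arr 14 = σ.arr 14) : G.Trie R node σ' := by
  obtain ⟨h1, h2, h3, h4, h5, h6, h7, h8', h9⟩ := ht
  rw [← h8] at h2 h7 h8'
  rw [← h13] at h5 h7
  rw [← h14] at h6 h8'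
  exact ⟨h1, h2, h3, h4, h5, h6, h7, h8', h9⟩

theorem Trie.frame {c : Cmd} {σ σ' : State} {R : List (List (Fin G.n))}
    {node : List (Fin G.n) → ℕ} (ht : G.Trie R node σ) (hF : Frame c σ σ') (hr : 8 ∉ c.regs)
    (ha : ∀ A ∈ [13, 14], A ∉ c.arrs) : G.Trie R node σ' :=
  ht.congr (hF.reg 8 hr) (hF.arr 13 (ha 13 (by simp))) (hF.arr 14 (ha 14 (by simp)))

theorem code_lt_width (x : Fin G.n) : code x < G.width := by
  have := code_le x
  unfold width
  omega

/-- Adding a new child to the trie. -/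
theorem Trie.extend {σ σ' : State} {R : List (List (Fin G.n))} {node : List (Fin G.n) → ℕ}
    (ht : G.Trie R node σ) {p : List (Fin G.n)} {x : Fin G.n} (hp : node p ≠ 0)
    (hpx : node (p ++ [x]) = 0) (h8 : σ'.reg 8 = σ.reg 8 + 1)
    (h13 : σ'.arr 13 =
      Function.update (σ.arr 13) (node p * G.width + code x) (σ.reg 8 + 1))
    (h14 : σ'.arr 14 = σ.arr 14) :
    G.Trie R (Function.update node (p ++ [x]) (σ.reg 8 + 1)) σ' := by
  have hnode : ∀ q, q ≠ p ++ [x] →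
      Function.update node (p ++ [x]) (σ.reg 8 + 1) q = node q := fun q hq => by simp [hq]
  have hself : Function.update node (p ++ [x]) (σ.reg 8 + 1) (p ++ [x]) = σ.reg 8 + 1 := by simp
  constructor
  · rw [hnode _ (by simp), ht.root]
  · intro q
    by_cases hq : q = p ++ [x]
    · rw [hq, hself, h8]
    · rw [hnode q hq, h8]
      exact (ht.le q).trans (Nat.le_succ _)
  · intro q q' heq hne
    by_cases hq : q = p ++ [x] <;> by_cases hq' : q' = p ++ [x]
    · rw [hq, hq']
    · rw [hq, hself, hnode q' hq'] at heq
      have := ht.le q'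
      omega
    · rw [hq', hself, hnode q hq] at heq
      have := ht.le q
      omega
    · rw [hnode q hq] at heq hne
      rw [hnode q' hq'] at heq
      exact ht.inj q q' heq hne
  · intro q y hne
    by_cases hq : q = p ++ [x]
    · rw [hq, hself]
      omega
    · rw [hnode q hq]
      by_cases hqy : q ++ [y] = p ++ [x]
      · have := (List.append_inj_left' hqy rfl)
        rwa [this]
      · rw [hnode _ hqy] at hne
        exact ht.closed q y hne
  · intro q y hne
    rw [h13]
    by_cases hq : q = p ++ [x]
    -- The new node has no children yet: node paths are closed under prefixes, so no extension of
    -- its path has a node, and its row lies beyond the nodes used so far and is still 0.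
    · have hqy : q ++ [y] ≠ p ++ [x] := by
        rw [hq]
        simp
      have h0 : node (q ++ [y]) = 0 := by
        by_contra hcon
        exact ht.closed q y hcon (hq ▸ hpx)
      rw [hnode _ hqy, h0, hq, hself, Function.update_of_ne]
      · exact ht.fresh_child _ _ (Nat.lt_succ_self _) (code_lt_width y)
      · intro h
        have := ((cell_inj (code_lt_width y) (code_lt_width x)).1 h).1
        have := ht.le p
        omega
    · rw [hnode q hq] at hne ⊢
      by_cases hqy : q ++ [y] = p ++ [x]
      · have h1 := List.append_inj_left' hqy rfl
        have h2 : y = x := by simpa [h1] using hqy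
        rw [hqy, hself, h1, h2]
        simp
      · rw [hnode _ hqy, Function.update_of_ne, ht.child q y hne]
        intro h
        have h' := (cell_inj (code_lt_width y) (code_lt_width x)).1 h
        have h1 := ht.inj q p h'.1 hne
        have h2 := code_inj.1 h'.2
        exact hqy (by rw [h1, h2])
  · intro q hne
    rw [h14]
    by_cases hq : q = p ++ [x]
    -- Recorded lists have nodes, so a path without a node is not recorded and its fresh mark 0 is
    -- right.
    · have : q ∉ R := fun hqR => ht.mem q hqR (hq ▸ hpx)
      rw [if_neg this, hq, hself]
      exact ht.fresh_mark _ (Nat.lt_succ_self _)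
    · rw [hnode q hq] at hne ⊢
      exact ht.mark q hne
  · intro i c hi hc
    rw [h13, Function.update_of_ne]
    · exact ht.fresh_child i c (by omega) hc
    · intro h
      have := ((cell_inj hc (code_lt_width x)).1 h).1
      have := ht.le p
      omega
  · intro i hi
    rw [h14]
    exact ht.fresh_mark i (by omega)
  · intro q hq
    by_cases hqp : q = p ++ [x]
    · rw [hqp, hself]
      omega
    · rw [hnode q hqp]
      exact ht.mem q hq

/-- Marking a node of the trie. -/
theorem Trie.insert {σ σ' : State} {R : List (List (Fin G.n))} {node : List (Fin G.n) → ℕ}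
    (ht : G.Trie R node σ) {p : List (Fin G.n)} (hp : node p ≠ 0)
    (h8 : σ'.reg 8 = σ.reg 8) (h13 : σ'.arr 13 = σ.arr 13)
    (h14 : σ'.arr 14 = Function.update (σ.arr 14) (node p) 1) :
    G.Trie (R ++ [p]) node σ' := by
  obtain ⟨h1, h2, h3, h4, h5, h6, h7, h8', h9⟩ := ht
  refine ⟨h1, by rwa [h8], h3, h4, by rwa [h13], ?_, by rwa [h8, h13], ?_, ?_⟩
  · intro q hq
    rw [h14]
    by_cases hqp : q = p
    · simp [hqp]
    · rw [Function.update_of_ne (fun h => hqp (h3 q p h hq)), h6 q hq]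
      simp [hqp]
  · intro i hi
    rw [h8] at hi
    have := h2 p
    rw [h14, Function.update_of_ne (by omega), h8' i hi]
  · intro q hq
    rcases List.mem_append.1 hq with hq | hq
    · exact h9 q hq
    · rwa [List.mem_singleton.1 hq]

/-- Node numbers start at 1, so a child entry 0 means that the child is missing. At most one node is
created per vertex of the list, which limits the total number of nodes. -/
theorem descend_spec (hC : G.Capacity w D) {σ : State} (hL : G.Loaded σ)
    {l : List (Fin G.n)} {h : ℕ} (hf : G.Focus l h σ) (hh : h ≤ D)
    {R : List (List (Fin G.n))} {node : List (Fin G.n) → ℕ} (ht : G.Trie R node σ)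
    (h8 : σ.reg 8 < D) {j : ℕ} {x : Fin G.n} (hj : σ.reg 25 = j) (hx : l[j]? = some x)
    (hjw : j ≤ G.width)
    (h24 : σ.reg 24 = node (l.take j)) (hne : node (l.take j) ≠ 0) :
    WP w descend (fun c σ' => c ≤ 60 ∧ σ'.reg 8 ≤ σ.reg 8 + 1 ∧ ∃ node',
      G.Trie R node' σ' ∧ σ'.reg 24 = node' (l.take (j + 1)) ∧ node' (l.take (j + 1)) ≠ 0) σ := by
  have hone := hC.one_mod
  have hjl := (List.getElem?_eq_some_iff.1 hx).1
  have htake : l.take (j + 1) = l.take j ++ [x] := by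
    rw [List.take_add_one, hx]
    rfl
  have hmod : (h * G.width + j) % 2 ^ w = h * G.width + j := Nat.mod_eq_of_lt (hC.cell_lt hh hjw)
  have h22 : (Expr.get 6 (.add (.reg 23) (.reg 25))).eval w σ = code x := by
    simp [Expr.eval, hf.base, hj, hmod, hf.row j x hx]
  have hcell := hC.cell_mod (r := node (l.take j)) (c := code x) ((ht.le _).trans h8.le)
    (code_lt_width x).le
  rw [descend, wp_seq, wp_set, h22, wp_seq, wp_ite, htake]
  set σ₁ := σ.setReg 22 (code x) with hσ₁
  have e : (cell 24 (.reg 22)).eval w σ₁ = node (l.take j) * G.width + code x := by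
    simp [cell, Expr.eval, hσ₁, h24, hL.width, hcell]
  have hch : σ₁.arr 13 (node (l.take j) * G.width + code x) = node (l.take j ++ [x]) := by
    rw [hσ₁, State.setReg_arr, ht.child _ _ hne]
  constructor
  · intro hc
    have h0 : node (l.take j ++ [x]) = 0 := by
      by_contra hcon
      refine hc ?_
      simp only [Expr.eval, e, hch]
      simp [hcon]
    rw [wp_seq, incr, wp_set, wp_put, wp_set]
    have e8 : (Expr.add (.reg 8) (.const 1)).eval w σ₁ = σ.reg 8 + 1 := by
      simp [Expr.eval, hσ₁, hone, hC.succ_mod h8.le]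
    rw [e8]
    set σ₂ := σ₁.setReg 8 (σ.reg 8 + 1) with hσ₂
    have e₂ : (cell 24 (.reg 22)).eval w σ₂ = node (l.take j) * G.width + code x := by
      simp [cell, Expr.eval, hσ₂, hσ₁, h24, hL.width, hcell]
    have e₂' : (Expr.reg 8).eval w σ₂ = σ.reg 8 + 1 := by simp [Expr.eval, hσ₂]
    rw [e₂, e₂']
    set σ₃ := σ₂.setArr 13 (node (l.take j) * G.width + code x) (σ.reg 8 + 1) with hσ₃
    have e₃ : (cell 24 (.reg 22)).eval w σ₃ = node (l.take j) * G.width + code x := by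
      simp [cell, Expr.eval, hσ₃, hσ₂, hσ₁, h24, hL.width, hcell]
    have e₄ : (Expr.get 13 (cell 24 (.reg 22))).eval w σ₃ = σ.reg 8 + 1 := by
      rw [Expr.eval, e₃, hσ₃, State.setArr_arr_self, if_pos rfl]
    rw [e₄]
    refine ⟨by simp [Expr.cost, cell], by simp [hσ₃, hσ₂], _,
      (ht.extend (x := x) hne h0 (σ' := σ₃) (by simp [hσ₃, hσ₂])
      (by simp [hσ₃, hσ₂, hσ₁, State.setArr_arr]) (by simp [hσ₃, hσ₂, hσ₁, State.setArr_arr])).congr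
      (by simp) (by simp) (by simp), by simp, by simp⟩
  · intro hc
    have h0 : node (l.take j ++ [x]) ≠ 0 := by
      intro hcon
      simp only [Expr.eval, e, hch] at hc
      simp [hcon] at hc
    rw [wp_skip, wp_set]
    have e₄ : (Expr.get 13 (cell 24 (.reg 22))).eval w σ₁ = node (l.take j ++ [x]) := by
      rw [Expr.eval, e, hch]
    rw [e₄]
    exact ⟨by simp [Expr.cost, cell], by simp [hσ₁], node,
      ht.congr (by simp [hσ₁]) (by simp [hσ₁]) (by simp [hσ₁]), by simp, h0⟩

theorem output_spec (hC : G.Capacity w D) {σ : State} {l : List (Fin G.n)} {h : ℕ}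
    (hf : G.Focus l h σ) (hh : h ≤ D) (hl : l.length ≤ G.n) :
    WP w output (fun c σ' => c ≤ 20 * (l.length + 1) ∧
      σ'.out = σ.out ++ (l.map code ++ [0])) σ := by
  have hnD := hC.n_le
  rw [output, wp_seq]
  refine (wp_for (fun j σ' => σ'.out = σ.out ++ (l.take j).map code) 5 l.length
    (hC.lt_of_le (by omega)) (by decide) ?_ ?_ ?_).mono ?_
  · intro σ' hF
    simp only [Expr.eval]
    rw [hF.reg 9 (by decide), hf.length]
  · simp
  · intro j hj σ' hF h25 hout
    have hf' := hf.frame hF (by decide) (by decide)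
    have hmod : (h * G.width + j) % 2 ^ w = h * G.width + j :=
      Nat.mod_eq_of_lt (hC.cell_lt hh (by unfold width; omega))
    have hx : l[j]? = some l[j] := List.getElem?_eq_getElem hj
    rw [wp_emit]
    refine ⟨by simp [Expr.cost], ?_⟩
    rw [State.setReg_out, State.write_out, hout, List.take_succ_eq_append_getElem hj,
      List.map_append, ← List.append_assoc]
    simp only [Expr.eval, hf'.base, h25, hmod, hf'.row j _ hx, List.map_cons, List.map_nil]
  · rintro c σ' ⟨hc, hout, -⟩
    rw [wp_emit]
    refine ⟨?_, ?_⟩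
    · simp only [Expr.cost] at hc ⊢
      omega
    · rw [State.write_out, hout, List.take_length]
      simp [Expr.eval]

theorem encode_append {n : ℕ} (R : List (List (Fin n))) (l : List (Fin n)) :
    encode (R ++ [l]) = encode R ++ (l.map code ++ [0]) := by
  simp [encode]

/-- Membership in `R` is read off the mark at the end of the path of `l`. This takes time linear in
`l`, however many sets have been recorded. -/
theorem recordSet_spec (hC : G.Capacity w D) {σ : State} (hL : G.Loaded σ)
    {l : List (Fin G.n)} {h : ℕ} (hf : G.Focus l h σ) (hh : h ≤ D) (hl : l.length ≤ G.n)
    {R : List (List (Fin G.n))} {node : List (Fin G.n) → ℕ} (ht : G.Trie R node σ)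
    (h8 : σ.reg 8 + l.length ≤ D) (hout : σ.out = encode R) :
    WP w recordSet (fun c σ' => c ≤ 120 * (l.length + 1) ∧ σ'.reg 8 ≤ σ.reg 8 + l.length ∧
      (∃ node', G.Trie (if l ∈ R then R else R ++ [l]) node' σ') ∧
      σ'.out = encode (if l ∈ R then R else R ++ [l])) σ := by
  have hnD := hC.n_le
  have hone := hC.one_mod
  have e1 : (Expr.const 1).eval w σ = 1 := by simp [Expr.eval, hone]
  rw [recordSet, wp_seq, wp_set, e1, wp_seq]
  have hL₁ : G.Loaded (σ.setReg 24 1) := hL.congr (fun x hx => by simp; omega) fun _ _ => rfl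
  have hf₁ : G.Focus l h (σ.setReg 24 1) := ⟨by simp [hf.index], by simp [hf.length],
    by simp [hf.base], hf.row, hf.member⟩
  refine (wp_for (fun j σ' => σ'.reg 8 ≤ σ.reg 8 + j ∧ ∃ node', G.Trie R node' σ' ∧
      σ'.reg 24 = node' (l.take j) ∧ node' (l.take j) ≠ 0) 60 l.length
    (hC.lt_of_le (by omega)) (by decide) ?_ ?_ ?_).mono ?_
  · intro σ' hF
    simp only [Expr.eval]
    rw [hF.reg 9 (by decide), hf₁.length]
  · exact ⟨by simp, node, ht.congr (by simp) (by simp) (by simp), by simp [ht.root],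
      by simp [ht.root]⟩
  · rintro j hj σ' hF h25 ⟨h8', node', ht', h24, hne⟩
    have hL' := hL₁.frame hF (by decide) (by decide)
    have hf' := hf₁.frame hF (by decide) (by decide)
    refine (descend_spec hC hL' hf' hh ht' (by omega) h25 (List.getElem?_eq_getElem hj)
      (by unfold width; omega) h24 hne).mono ?_
    rintro c σ'' ⟨hc, h8'', node'', ht'', h24'', hne''⟩
    exact ⟨hc, by simp; omega, node'', ht''.congr (by simp) (by simp) (by simp),
      by simpa using h24'', hne''⟩
  · rintro c σ' ⟨hc, ⟨h8', node', ht', h24, hne⟩, hF⟩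
    have hf' := hf₁.frame hF (by decide) (by decide)
    have hout' : σ'.out = encode R := by
      rw [hF.out (by decide), State.setReg_out, hout]
    rw [List.take_length] at h24 hne
    have em : (Expr.get 14 (.reg 24)).eval w σ' = if l ∈ R then 1 else 0 := by
      simp [Expr.eval, h24, ht'.mark l hne]
    rw [wp_ite, em]
    constructor
    · intro hlR
      have hlR' : l ∈ R := by
        by_contra hcon
        exact hlR (by simp [hcon])
      rw [wp_skip]
      simp only [hlR', if_true]
      refine ⟨?_, h8', ⟨node', ht'⟩, hout'⟩
      simp only [Expr.cost] at hc ⊢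
      omega
    · intro hlR
      have hlR' : l ∉ R := by
        intro hcon
        simp [hcon] at hlR
      rw [wp_seq, wp_put]
      have e1 : (Expr.const 1).eval w σ' = 1 := by simp [Expr.eval, hone]
      have e24 : (Expr.reg 24).eval w σ' = node' l := h24
      rw [e1, e24]
      set σ₂ := σ'.setArr 14 (node' l) 1 with hσ₂
      have hf₂ : G.Focus l h σ₂ := ⟨hf'.index, hf'.length, hf'.base,
        by rw [hσ₂, State.setArr_arr_ne _ _ _ (by decide)]; exact hf'.row,
        by rw [hσ₂, State.setArr_arr_ne _ _ _ (by decide)]; exact hf'.member⟩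
      have ht₂ : G.Trie (R ++ [l]) node' σ₂ := ht'.insert hne (by simp [hσ₂])
        (by simp [hσ₂, State.setArr_arr]) (by simp [hσ₂, State.setArr_arr])
      refine (output_spec hC hf₂ hh hl).frame.mono ?_
      rintro c₂ σ₃ ⟨⟨hc₂, hout₃⟩, hF₃⟩
      simp only [hlR', if_false]
      refine ⟨?_, ?_, ⟨node', ht₂.frame hF₃ (by decide) (by decide)⟩, ?_⟩
      · simp only [Expr.cost] at hc ⊢
        omega
      · rw [hF₃.reg 8 (by decide)]
        exact h8'
      · rw [hout₃, encode_append, hσ₂, State.setArr_out, hout']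

end GraphSequence

namespace GraphSequence

open WordRAM Cmd
open Program

variable {G : GraphSequence} {w D s : ℕ}

/-! ### The work list in memory -/

/-- Row `r` of the two-dimensional array `a` starts with the list `L`. -/
def RowHolds (G : GraphSequence) (a : ℕ → ℕ) (r : ℕ) (L : List (Fin G.n)) : Prop :=
  ∀ (j : ℕ) (x : Fin G.n), L[j]? = some x → a (r * G.width + j) = code x

theorem RowHolds.append {a : ℕ → ℕ} {r : ℕ} {L : List (Fin G.n)} (h : G.RowHolds a r L)
    (x : Fin G.n) :
    G.RowHolds (Function.update a (r * G.width + L.length) (code x)) r (L ++ [x]) := by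
  intro j y hy
  by_cases hj : j = L.length
  · subst hj
    simp_all
  · have hjl : j < L.length := by
      have := (List.getElem?_eq_some_iff.1 hy).1
      simp at this
      omega
    rw [Function.update_of_ne (by omega)]
    exact h j y (by rwa [List.getElem?_append_left hjl] at hy)

theorem RowHolds.update {a : ℕ → ℕ} {r : ℕ} {L : List (Fin G.n)} (h : G.RowHolds a r L)
    (hL : L.length ≤ G.width) {r' k v : ℕ} (hr : r ≠ r') (hk : k < G.width) :
    G.RowHolds (Function.update a (r' * G.width + k) v) r L := by
  intro j y hy
  have hj := (List.getElem?_eq_some_iff.1 hy).1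
  rw [Function.update_of_ne]
  · exact h j y hy
  · intro heq
    exact hr ((cell_inj (by omega) hk).1 heq).1

/-- The work list `I` is in memory. -/
structure Stored (G : GraphSequence) (I : List (Item G.n)) (σ : State) : Prop where
  count : σ.reg 5 = I.length
  length : ∀ (i : ℕ) (it : Item G.n), I[i]? = some it → σ.arr 7 i = it.verts.length
  start : ∀ (i : ℕ) (it : Item G.n), I[i]? = some it → σ.arr 8 i = it.start
  bar : ∀ (i : ℕ) (it : Item G.n), I[i]? = some it → σ.arr 9 i = it.bar
  row : ∀ (i : ℕ) (it : Item G.n), I[i]? = some it → G.RowHolds (σ.arr 6) i it.verts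

theorem Stored.frame {c : Cmd} {σ σ' : State} {I : List (Item G.n)} (h : G.Stored I σ)
    (hF : Frame c σ σ') (hr : 5 ∉ c.regs) (ha : ∀ A ∈ [6, 7, 8, 9], A ∉ c.arrs) :
    G.Stored I σ' := by
  obtain ⟨h1, h2, h3, h4, h5⟩ := h
  rw [← hF.reg 5 hr] at h1
  rw [← hF.arr 7 (ha 7 (by simp))] at h2
  rw [← hF.arr 8 (ha 8 (by simp))] at h3
  rw [← hF.arr 9 (ha 9 (by simp))] at h4
  rw [← hF.arr 6 (ha 6 (by simp))] at h5
  exact ⟨h1, h2, h3, h4, h5⟩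

theorem getElem?_snoc {α : Type*} {I : List α} {i : ℕ} {a b : α}
    (h : (I ++ [a])[i]? = some b) : I[i]? = some b ∨ (i = I.length ∧ b = a) := by
  rcases lt_or_ge i I.length with hi | hi
  · rw [List.getElem?_append_left hi] at h
    exact .inl h
  · rw [List.getElem?_append_right hi] at h
    have h' := (List.getElem?_eq_some_iff.1 h).1
    have h0 : i - I.length = 0 := by simpa using h'
    rw [h0] at h
    exact .inr ⟨by omega, by simpa using h.symm⟩

/-- Appending an item to the work list. -/
theorem Stored.append {σ σ' : State} {I : List (Item G.n)} (h : G.Stored I σ) (it : Item G.n)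
    (h5 : σ'.reg 5 = I.length + 1)
    (h7 : σ'.arr 7 = Function.update (σ.arr 7) I.length it.verts.length)
    (h8 : σ'.arr 8 = Function.update (σ.arr 8) I.length it.start)
    (h9 : σ'.arr 9 = Function.update (σ.arr 9) I.length it.bar)
    (h6 : ∀ (i : ℕ) (it' : Item G.n), I[i]? = some it' → G.RowHolds (σ'.arr 6) i it'.verts)
    (h6' : G.RowHolds (σ'.arr 6) I.length it.verts) : G.Stored (I ++ [it]) σ' := by
  refine ⟨by simp [h5], ?_, ?_, ?_, ?_⟩
  · intro i it' hi
    rcases getElem?_snoc hi with hi | ⟨rfl, rfl⟩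
    · have := (List.getElem?_eq_some_iff.1 hi).1
      rw [h7, Function.update_of_ne (by omega), h.length i it' hi]
    · simp [h7]
  · intro i it' hi
    rcases getElem?_snoc hi with hi | ⟨rfl, rfl⟩
    · have := (List.getElem?_eq_some_iff.1 hi).1
      rw [h8, Function.update_of_ne (by omega), h.start i it' hi]
    · simp [h8]
  · intro i it' hi
    rcases getElem?_snoc hi with hi | ⟨rfl, rfl⟩
    · have := (List.getElem?_eq_some_iff.1 hi).1
      rw [h9, Function.update_of_ne (by omega), h.bar i it' hi]
    · simp [h9]
  · intro i it' hi
    rcases getElem?_snoc hi with hi | ⟨rfl, rfl⟩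
    · exact h6 i it' hi
    · exact h6'

/-- All earlier marks are at most `h`, so writing `h + 1` makes exactly the vertices of the current
item members, and marks of older items need not be erased. -/
theorem load_spec (hC : G.Capacity w D) {σ : State} (hL : G.Loaded σ) {I : List (Item G.n)}
    (hI : G.Stored I σ) {h : ℕ} {it : Item G.n} (hit : I[h]? = some it) (hh : h ≤ D)
    (hlen : it.verts.length ≤ G.n)
    (h6 : σ.reg 6 = h) (h9 : σ.reg 9 = it.verts.length) (hmem : ∀ c, σ.arr 10 c ≤ h) :
    WP w load (fun c σ' => c ≤ 40 * (it.verts.length + 1) ∧ G.Focus it.verts h σ' ∧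
      σ'.reg 10 = it.start ∧ ∀ c, σ'.arr 10 c ≤ h + 1) σ := by
  have hnD := hC.n_le
  have hone := hC.one_mod
  have hh1 := hC.succ_mod hh
  have hbase : h * G.width % 2 ^ w = h * G.width :=
    Nat.mod_eq_of_lt (by simpa using hC.cell_lt hh (Nat.zero_le _))
  have e10 : (Expr.get 8 (.reg 6)).eval w σ = it.start := by
    simp [Expr.eval, h6, hI.start h it hit]
  rw [load, wp_seq, wp_set, e10, wp_seq, wp_set]
  have e23 : (Expr.mul (.reg 6) (.reg 3)).eval w (σ.setReg 10 it.start) = h * G.width := by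
    simp [Expr.eval, h6, hL.width, hbase]
  rw [e23]
  set σ₁ := (σ.setReg 10 it.start).setReg 23 (h * G.width) with hσ₁
  have r6 : σ₁.reg 6 = h := by simp [hσ₁, h6]
  have r9 : σ₁.reg 9 = it.verts.length := by simp [hσ₁, h9]
  have r23 : σ₁.reg 23 = h * G.width := by simp [hσ₁]
  have hrow : G.RowHolds (σ₁.arr 6) h it.verts := by
    rw [hσ₁]
    exact hI.row h it hit
  refine (wp_for (fun j σ' => (∀ x : Fin G.n, σ'.arr 10 (code x) = h + 1 ↔ x ∈ it.verts.take j) ∧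
      ∀ c, σ'.arr 10 c ≤ h + 1) 15 it.verts.length (hC.lt_of_le (by omega)) (by decide)
      ?_ ?_ ?_).mono ?_
  · intro σ' hF
    simp only [Expr.eval]
    rw [hF.reg 9 (by decide), r9]
  · refine ⟨fun x => ?_, fun c => ?_⟩
    · have := hmem (code x)
      simp [hσ₁]
      omega
    · have := hmem c
      simp [hσ₁]
      omega
  · rintro j hj σ' hF h25 ⟨hm, hle⟩
    have hmod : (h * G.width + j) % 2 ^ w = h * G.width + j :=
      Nat.mod_eq_of_lt (hC.cell_lt hh (by unfold width; omega))
    have hx : it.verts[j]? = some it.verts[j] := List.getElem?_eq_getElem hj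
    have e1 : (Expr.get 6 (.add (.reg 23) (.reg 25))).eval w σ' = code it.verts[j] := by
      simp only [Expr.eval]
      rw [hF.reg 23 (by decide), r23, h25, hmod, hF.arr 6 (by decide), hrow j _ hx]
    have e2 : (Expr.add (.reg 6) (.const 1)).eval w σ' = h + 1 := by
      simp only [Expr.eval]
      rw [hF.reg 6 (by decide), r6, hone, hh1]
    rw [wp_put, e1, e2]
    refine ⟨by simp [Expr.cost], fun x => ?_, fun c => ?_⟩
    · rw [State.setReg_arr, State.setArr_arr_self, List.take_succ_eq_append_getElem hj,
        List.mem_append, List.mem_singleton]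
      by_cases hxj : x = it.verts[j]
      · simp [hxj]
      · simp only [code_inj, hxj, if_false, or_false, hm]
    · rw [State.setReg_arr, State.setArr_arr_self]
      split_ifs
      · exact le_rfl
      · exact hle c
  · rintro c σ' ⟨hc, ⟨hm, hle⟩, hF⟩
    rw [List.take_length] at hm
    refine ⟨?_, ⟨?_, ?_, ?_, ?_, hm⟩, ?_, hle⟩
    · simp only [Expr.cost] at hc ⊢
      omega
    · rw [hF.reg 6 (by decide), r6]
    · rw [hF.reg 9 (by decide), r9]
    · rw [hF.reg 23 (by decide), r23]
    · rw [hF.arr 6 (by decide)]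
      exact hrow
    · rw [hF.reg 10 (by decide)]
      simp [hσ₁]

theorem filter_take_succ {α : Type*} (p : α → Prop) [DecidablePred p] {l : List α} {j : ℕ}
    (hj : j < l.length) : (l.take (j + 1)).filter p =
      (l.take j).filter p ++ if p l[j] then [l[j]] else [] := by
  rw [List.take_succ_eq_append_getElem hj, List.filter_append]
  congr 1
  by_cases h : p l[j] <;> simp [h]

/-- The rows of the new items `k` and `k + 1` hold `A` and `B`, and the rows before them are as in
`σ₀`. -/
structure Distributed (G : GraphSequence) (A B : List (Fin G.n)) (k : ℕ) (σ₀ σ : State) :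
    Prop where
  left_length : σ.reg 26 = A.length
  right_length : σ.reg 27 = B.length
  left : G.RowHolds (σ.arr 6) k A
  right : G.RowHolds (σ.arr 6) (k + 1) B
  other : ∀ r L, r < k → L.length ≤ G.width → G.RowHolds (σ₀.arr 6) r L →
    G.RowHolds (σ.arr 6) r L

/-- The deleted vertex is sent to both parts: to the first explicitly, to the second because the
search did not reach it. -/
theorem distribute_spec (hC : G.Capacity w D) {σ₀ σ : State} (hL : G.Loaded σ)
    {l : List (Fin G.n)} {h k j : ℕ} (hf : G.Focus l h σ) (hh : h ≤ D) (hkD : k + 1 ≤ D)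
    (hl : l.length ≤ G.n)
    {Q : List (Fin G.n)} (hQ : G.Visited Q σ) (h5 : σ.reg 5 = k) (h28 : σ.reg 28 = k + 1)
    (hj : j < l.length) (h25 : σ.reg 25 = j)
    (hd : G.Distributed ((l.take j).filter fun x => code x = σ.reg 15 ∨ x ∈ Q)
      ((l.take j).filter fun x => x ∉ Q) k σ₀ σ) :
    WP w distribute (fun c σ' => c ≤ 70 ∧
      G.Distributed ((l.take (j + 1)).filter fun x => code x = σ.reg 15 ∨ x ∈ Q)
      ((l.take (j + 1)).filter fun x => x ∉ Q) k σ₀ σ') σ := by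
  have hone := hC.one_mod
  have hnD := hC.n_le
  set A := (l.take j).filter fun x => code x = σ.reg 15 ∨ x ∈ Q with hA
  set B := (l.take j).filter fun x => x ∉ Q with hB
  have hAj : A.length ≤ j := (List.length_filter_le _ _).trans (by simp)
  have hBj : B.length ≤ j := (List.length_filter_le _ _).trans (by simp)
  have hw : G.n < G.width := by unfold width; omega
  have hmod : (h * G.width + j) % 2 ^ w = h * G.width + j :=
    Nat.mod_eq_of_lt (hC.cell_lt hh (by omega))
  have hx : l[j]? = some l[j] := List.getElem?_eq_getElem hj
  rw [filter_take_succ _ hj, filter_take_succ _ hj, ← hA, ← hB]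
  generalize l[j] = x at hx
  have e22 : (Expr.get 6 (.add (.reg 23) (.reg 25))).eval w σ = code x := by
    simp [Expr.eval, hf.base, h25, hmod, hf.row j x hx]
  have hcA := hC.cell_mod (r := k) (c := A.length) (by omega) (by omega)
  have hcB := hC.cell_mod (r := k + 1) (c := B.length) (by omega) (by omega)
  have hsA := hC.succ_mod (r := A.length) (by omega)
  have hsB := hC.succ_mod (r := B.length) (by omega)
  rw [distribute, wp_seq, wp_set, e22, wp_seq]
  -- The decision about the second part does not depend on the one about the first; `c₀` is the cost
  -- already incurred.
  have hsecond : ∀ (c₀ : ℕ) (A' : List (Fin G.n)) (σ₁ : State), c₀ ≤ 40 → A'.length ≤ j + 1 →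
      σ₁.reg 22 = code x → σ₁.reg 28 = k + 1 → σ₁.reg 3 = G.width → σ₁.reg 7 = σ.reg 7 →
      σ₁.arr 11 = σ.arr 11 → G.Distributed A' B k σ₀ σ₁ →
      WP w (.ite (.eq (.get 11 (.reg 22)) (.reg 7)) .skip
        (.seq (.put 6 (cell 28 (.reg 27)) (.reg 22)) (incr 27)))
        (fun c σ' => c₀ + c ≤ 70 ∧
          G.Distributed A' (B ++ if x ∉ Q then [x] else []) k σ₀ σ') σ₁ := by
    intro c₀ A' σ₁ hc₀ hA' r22 r28 r3 r7 a11 hd₁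
    have eseen : (Expr.eq (.get 11 (.reg 22)) (.reg 7)).eval w σ₁ = if x ∈ Q then 1 else 0 := by
      simp only [Expr.eval, r22, r7, a11, hQ.seen]
    rw [wp_ite, eseen]
    constructor
    · intro hc
      have hxQ : x ∈ Q := by
        by_contra hcon
        simp [hcon] at hc
      rw [wp_skip]
      refine ⟨by simp only [Expr.cost]; omega, by simpa [hxQ] using hd₁⟩
    · intro hc
      have hxQ : x ∉ Q := by
        intro hcon
        simp [hcon] at hc
      have ecell : (cell 28 (.reg 27)).eval w σ₁ = (k + 1) * G.width + B.length := by
        simp only [cell, Expr.eval, r28, r3, hd₁.right_length, hcB]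
      have e22 : (Expr.reg 22).eval w σ₁ = code x := r22
      rw [wp_seq, wp_put, ecell, e22, incr, wp_set, if_pos hxQ]
      refine ⟨by simp only [Expr.cost, cell]; omega, ?_, ?_, ?_, ?_, ?_⟩
      · simp [hd₁.left_length]
      · simp [Expr.eval, hd₁.right_length, hone, hsB]
      · rw [State.setReg_arr, State.setArr_arr, if_pos rfl]
        exact hd₁.left.update (by omega) (by omega) (by omega)
      · rw [State.setReg_arr, State.setArr_arr, if_pos rfl]
        exact hd₁.right.append x
      · intro r L hr hLw hrow
        rw [State.setReg_arr, State.setArr_arr, if_pos rfl]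
        exact (hd₁.other r L hr hLw hrow).update hLw (by omega) (by omega)
  -- The sum of two truth values serves as their disjunction; it is at most 2 and does not wrap.
  have hcond : (Expr.add (.eq (.reg 22) (.reg 15)) (.eq (.get 11 (.reg 22)) (.reg 7))).eval w
      (σ.setReg 22 (code x)) ≠ 0 ↔ (code x = σ.reg 15 ∨ x ∈ Q) := by
    have h2 : 1 + 1 < 2 ^ w := hC.lt_of_le (by omega)
    have hs : σ.arr 11 (code x) = σ.reg 7 ↔ x ∈ Q := hQ.seen x
    simp only [Expr.eval, State.setReg_reg, State.setReg_arr, if_true, Nat.reduceEqDiff, if_false,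
      hs]
    rw [Nat.mod_eq_of_lt (by split_ifs <;> omega)]
    by_cases h1 : code x = σ.reg 15 <;> by_cases h2 : x ∈ Q <;> simp [h1, h2]
  rw [wp_ite]
  constructor
  · intro hc
    have hxA := hcond.1 hc
    rw [if_pos hxA]
    set σ₁ := σ.setReg 22 (code x) with hσ₁
    have ecell : (cell 5 (.reg 26)).eval w σ₁ = k * G.width + A.length := by
      simp [cell, Expr.eval, hσ₁, h5, hL.width, hd.left_length, hcA]
    have e22 : (Expr.reg 22).eval w σ₁ = code x := by simp [Expr.eval, hσ₁]
    rw [wp_seq, wp_put, ecell, e22, incr, wp_set]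
    refine (hsecond 40 (A ++ [x]) _ le_rfl (by simp; omega) (by simp [hσ₁])
      (by simp [hσ₁, h28]) (by simp [hσ₁, hL.width]) (by simp [hσ₁])
      (by simp [hσ₁, State.setArr_arr]) ⟨?_, ?_, ?_, ?_, ?_⟩).mono ?_
    · simp [Expr.eval, hσ₁, hd.left_length, hone, hsA]
    · simp [hσ₁, hd.right_length]
    · rw [State.setReg_arr, State.setArr_arr, if_pos rfl]
      exact hd.left.append x
    · rw [State.setReg_arr, State.setArr_arr, if_pos rfl]
      exact hd.right.update (by omega) (by omega) (by omega)
    · intro r L hr hLw hrow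
      rw [State.setReg_arr, State.setArr_arr, if_pos rfl]
      exact (hd.other r L hr hLw hrow).update hLw (by omega) (by omega)
    · rintro c σ' ⟨hc, hd'⟩
      exact ⟨by simp only [Expr.cost, cell]; omega, hd'⟩
  · intro hc
    have hxA : ¬ (code x = σ.reg 15 ∨ x ∈ Q) := fun h => hcond.2 h hc
    rw [if_neg hxA, List.append_nil, wp_skip]
    refine (hsecond 30 A _ (by omega) (by omega) (by simp) (by simp [h28]) (by simp [hL.width])
      (by simp) (by simp) ⟨by simp [hd.left_length], by simp [hd.right_length],
        by simpa using hd.left, by simpa using hd.right, by simpa using hd.other⟩).mono ?_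
    rintro c σ' ⟨hc, hd'⟩
    exact ⟨by simp only [Expr.cost]; omega, hd'⟩

theorem header_spec {r len : ℕ} {σ : State} :
    WP w (header r len) (fun c σ' => c ≤ 20 ∧ σ'.reg = σ.reg ∧
      σ'.arr 6 = σ.arr 6 ∧
      σ'.arr 7 = Function.update (σ.arr 7) (σ.reg r) (σ.reg len) ∧
      σ'.arr 8 = Function.update (σ.arr 8) (σ.reg r) (σ.reg 10) ∧
      σ'.arr 9 = Function.update (σ.arr 9) (σ.reg r) (σ.reg 29)) σ := by
  rw [header, wp_seq, wp_put, wp_seq, wp_put, wp_put]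
  simp [Expr.eval, Expr.cost, State.setArr_arr]

theorem split_spec (hC : G.Capacity w D) {σ : State} (hL : G.Loaded σ) {I : List (Item G.n)}
    (hI : G.Stored I σ) (hIn : ∀ it ∈ I, it.verts.length ≤ G.n) (hID : I.length + 2 ≤ D) {h : ℕ}
    {it : Item G.n} (hit : I[h]? = some it) (hf : G.Focus it.verts h σ)
    {Q : List (Fin G.n)} (hQ : G.Visited Q σ) (h10 : σ.reg 10 = it.start) :
    WP w split (fun c σ' => c ≤ 200 * (it.verts.length + 1) ∧
      G.Stored (I ++ [⟨it.verts.filter fun x => code x = σ.reg 15 ∨ x ∈ Q, it.start,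
        max it.bar (σ.reg 11)⟩, ⟨it.verts.filter fun x => x ∉ Q, it.start,
        max it.bar (σ.reg 11)⟩]) σ') σ := by
  have hone := hC.one_mod
  have hnD := hC.n_le
  have hhI : h < I.length := (List.getElem?_eq_some_iff.1 hit).1
  have hlen := hIn it (List.mem_of_getElem? hit)
  have hw : G.n < G.width := by unfold width; omega
  have e0 : ∀ σ, (Expr.const 0).eval w σ = 0 := fun σ => by simp [Expr.eval]
  rw [split, wp_seq, wp_set, e0, wp_seq, wp_set, e0, wp_seq, wp_set]
  have e28 : (Expr.add (.reg 5) (.const 1)).eval w ((σ.setReg 26 0).setReg 27 0) =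
      I.length + 1 := by
    simp [Expr.eval, hI.count, hone, hC.succ_mod (r := I.length) (by omega)]
  rw [e28, wp_seq]
  have hbar : WP w (.ite (.lt (.get 9 (.reg 6)) (.reg 11)) (.set 29 (.reg 11))
      (.set 29 (.get 9 (.reg 6)))) (fun c σ' => c ≤ 10 ∧
        σ' = (((σ.setReg 26 0).setReg 27 0).setReg 28 (I.length + 1)).setReg 29
          (max it.bar (σ.reg 11))) (((σ.setReg 26 0).setReg 27 0).setReg 28 (I.length + 1)) := by
    have e9 : (Expr.get 9 (.reg 6)).eval w
        (((σ.setReg 26 0).setReg 27 0).setReg 28 (I.length + 1)) = it.bar := by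
      simp [Expr.eval, hf.index, hI.bar h it hit]
    have e11 : (Expr.reg 11).eval w
        (((σ.setReg 26 0).setReg 27 0).setReg 28 (I.length + 1)) = σ.reg 11 := by
      simp [Expr.eval]
    rw [wp_ite, wp_set, wp_set, Expr.lt_eval_ne_zero, Expr.lt_eval_eq_zero, e9, e11]
    refine ⟨fun hlt => ⟨by simp [Expr.cost], ?_⟩, fun hge => ⟨by simp [Expr.cost], ?_⟩⟩
    · rw [max_eq_right hlt.le]
    · rw [max_eq_left hge]
  refine hbar.mono ?_
  rintro c₁ σ₁ ⟨hc₁, hσ₁⟩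
  have r5 : σ₁.reg 5 = I.length := by simp [hσ₁, hI.count]
  have r10 : σ₁.reg 10 = it.start := by simp [hσ₁, h10]
  have r15 : σ₁.reg 15 = σ.reg 15 := by simp [hσ₁]
  have r26 : σ₁.reg 26 = 0 := by simp [hσ₁]
  have r27 : σ₁.reg 27 = 0 := by simp [hσ₁]
  have r28 : σ₁.reg 28 = I.length + 1 := by simp [hσ₁]
  have r29 : σ₁.reg 29 = max it.bar (σ.reg 11) := by simp [hσ₁]
  have harr : σ₁.arr = σ.arr := by simp [hσ₁]
  have hL₁ : G.Loaded σ₁ := hL.congr (fun x hx => by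
    simp only [hσ₁, State.setReg_reg]
    rw [if_neg (by omega), if_neg (by omega), if_neg (by omega), if_neg (by omega)])
    fun A _ => by rw [harr]
  have hf₁ : G.Focus it.verts h σ₁ := ⟨by simp [hσ₁, hf.index], by simp [hσ₁, hf.length],
    by simp [hσ₁, hf.base], by rw [harr]; exact hf.row, by rw [harr]; exact hf.member⟩
  have hQ₁ : G.Visited Q σ₁ := by
    rw [hσ₁]
    exact (((hQ.setReg (by decide) (by decide)).setReg (by decide) (by decide)).setReg
      (by decide) (by decide)).setReg (by decide) (by decide)
  have hI₁ : G.Stored I σ₁ := ⟨r5, by rw [harr]; exact hI.length, by rw [harr]; exact hI.start,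
    by rw [harr]; exact hI.bar, by rw [harr]; exact hI.row⟩
  clear hσ₁
  rw [← r15, ← r29]
  rw [wp_seq]
  refine (wp_for (fun j σ' => G.Distributed
      ((it.verts.take j).filter fun x => code x = σ₁.reg 15 ∨ x ∈ Q)
      ((it.verts.take j).filter fun x => x ∉ Q) I.length σ₁ σ') 70 it.verts.length
      (hC.lt_of_le (by omega)) (by decide) ?_ ?_ ?_).mono ?_
  · intro σ' hF
    simp only [Expr.eval]
    rw [hF.reg 9 (by decide), hf₁.length]
  · exact ⟨by simp [r26], by simp [r27], fun j x hx => by simp at hx, fun j x hx => by simp at hx,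
      fun r L _ _ hrow => hrow⟩
  · intro j hj σ' hF h25 hd
    have hL' := hL₁.frame hF (by decide) (by decide)
    have hQ' := hQ₁.frame hF (by decide) (by decide)
    have h15 : σ'.reg 15 = σ₁.reg 15 := hF.reg 15 (by decide)
    have hf' : G.Focus it.verts h σ' := ⟨by rw [hF.reg 6 (by decide), hf₁.index],
      by rw [hF.reg 9 (by decide), hf₁.length], by rw [hF.reg 23 (by decide), hf₁.base],
      hd.other h _ hhI (by omega) hf₁.row, by rw [hF.arr 10 (by decide)]; exact hf₁.member⟩
    rw [← h15] at hd ⊢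
    refine (distribute_spec hC hL' hf' (by omega) (by omega) hlen hQ'
      (by rw [hF.reg 5 (by decide), r5]) (by rw [hF.reg 28 (by decide), r28]) hj h25 hd).mono ?_
    rintro c σ'' ⟨hc, hd''⟩
    exact ⟨hc, by simp [hd''.left_length], by simp [hd''.right_length], hd''.left, hd''.right,
      hd''.other⟩
  · rintro c₂ σ₂ ⟨hc₂, hd, hF₂⟩
    rw [List.take_length] at hd
    rw [wp_seq]
    refine header_spec.mono ?_
    rintro c₃ σ₃ ⟨hc₃, hr₃, h6₃, h7₃, h8₃, h9₃⟩
    rw [wp_seq]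
    refine header_spec.mono ?_
    rintro c₄ σ₄ ⟨hc₄, hr₄, h6₄, h7₄, h8₄, h9₄⟩
    rw [hr₃] at h7₄ h8₄ h9₄ hr₄
    have q5 : σ₂.reg 5 = I.length := by rw [hF₂.reg 5 (by decide), r5]
    have q28 : σ₂.reg 28 = I.length + 1 := by rw [hF₂.reg 28 (by decide), r28]
    have q10 : σ₂.reg 10 = it.start := by rw [hF₂.reg 10 (by decide), r10]
    have q29 : σ₂.reg 29 = σ₁.reg 29 := hF₂.reg 29 (by decide)
    rw [q5, hd.left_length, hF₂.arr 7 (by decide)] at h7₃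
    rw [q5, q10, hF₂.arr 8 (by decide)] at h8₃
    rw [q5, q29, hF₂.arr 9 (by decide)] at h9₃
    rw [q28, hd.right_length] at h7₄
    rw [q28, q10] at h8₄
    rw [q28, q29] at h9₄
    rw [h6₃] at h6₄
    have hrows : ∀ (i : ℕ) (it' : Item G.n), I[i]? = some it' →
        G.RowHolds (σ₂.arr 6) i it'.verts := fun i it' hi =>
      hd.other i _ (List.getElem?_eq_some_iff.1 hi).1
        ((hIn it' (List.mem_of_getElem? hi)).trans hw.le) (hI₁.row i it' hi)
    set itA : Item G.n := ⟨it.verts.filter fun x => code x = σ₁.reg 15 ∨ x ∈ Q, it.start,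
      σ₁.reg 29⟩ with hitA
    set itB : Item G.n := ⟨it.verts.filter fun x => x ∉ Q, it.start, σ₁.reg 29⟩ with hitB
    -- An auxiliary state that does not occur in the run: register 5 is raised by two only at the
    -- end, but this lets the two items be appended one at a time.
    have hA : G.Stored (I ++ [itA]) (σ₃.setReg 5 (I.length + 1)) :=
      hI₁.append itA (by simp) h7₃ h8₃ h9₃ (by rw [State.setReg_arr, h6₃]; exact hrows)
        (by rw [State.setReg_arr, h6₃]; exact hd.left)
    rw [wp_set]
    have e5 : (Expr.add (.reg 28) (.const 1)).eval w σ₄ = I.length + 2 := by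
      simp only [Expr.eval, hr₄, q28, hone]
      rw [hC.succ_mod (by omega)]
    rw [e5]
    refine ⟨?_, ?_⟩
    · simp only [Expr.cost] at hc₂ ⊢
      omega
    · have hB := hA.append (σ' := σ₄.setReg 5 (I.length + 2)) itB (by simp)
        (by simpa only [State.setReg_arr, List.length_append, List.length_singleton] using h7₄) (by simpa using h8₄) (by simpa using h9₄)
        (by
          rw [State.setReg_arr, h6₄]
          have := hA.row
          rwa [State.setReg_arr, h6₃] at this)
        (by
          rw [State.setReg_arr, h6₄, List.length_append, List.length_singleton]
          exact hd.right)
      rwa [List.append_assoc] at hB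

end GraphSequence

namespace GraphSequence

open WordRAM Cmd
open Program

variable {G : GraphSequence} {w D s : ℕ}

/-! ### Processing an item -/

/-- The state of the machine after `h` items of the work list `I` have been processed and the sets
in `R` have been output. -/
structure Running (G : GraphSequence) (s : ℕ) (I : List (Item G.n)) (h : ℕ)
    (R : List (List (Fin G.n))) (σ : State) : Prop where
  loaded : G.Loaded σ
  stored : G.Stored I σ
  index : σ.reg 6 = h
  member_le : ∀ c, σ.arr 10 c ≤ h
  seen_le : ∀ c, σ.arr 11 c ≤ σ.reg 7
  stamp_le : σ.reg 7 ≤ h * ((G.m + 2) * (G.n + 1))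
  trie : ∃ node, G.Trie R node σ
  node_le : σ.reg 8 ≤ 1 + h * G.n
  out : σ.out = encode R
  progress : G.Progress s I h R

theorem Item.Valid.nodup {it : Item G.n} (h : it.Valid G s) : it.verts.Nodup :=
  h.sublist.nodup (List.nodup_finRange _)

theorem Item.Valid.length_le {it : Item G.n} (h : it.Valid G s) : it.verts.length ≤ G.n :=
  length_le_of_nodup h.nodup

theorem maybeRecord_spec (hC : G.Capacity w D) {σ : State} (hL : G.Loaded σ)
    {it : Item G.n} {h t : ℕ} (hf : G.Focus it.verts h σ) (hh : h ≤ D)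
    (hl : it.verts.length ≤ G.n) {R : List (List (Fin G.n))}
    (ht : ∃ node, G.Trie R node σ)
    (h8 : σ.reg 8 + it.verts.length ≤ D) (hout : σ.out = encode R)
    (hbar : σ.arr 9 h = it.bar) (h11 : σ.reg 11 = t) :
    WP w (.ite (.lt (.get 9 (.reg 6)) (.reg 11)) recordSet .skip)
      (fun c σ' => c ≤ 130 * (it.verts.length + 1) ∧ σ'.reg 8 ≤ σ.reg 8 + it.verts.length ∧
      (∃ node', G.Trie (record R it t) node' σ') ∧ σ'.out = encode (record R it t)) σ := by
  obtain ⟨node, ht⟩ := ht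
  have e9 : (Expr.get 9 (.reg 6)).eval w σ = it.bar := by simp [Expr.eval, hf.index, hbar]
  have e11 : (Expr.reg 11).eval w σ = t := h11
  rw [wp_ite, Expr.lt_eval_ne_zero, Expr.lt_eval_eq_zero, e9, e11]
  constructor
  · intro hlt
    refine (recordSet_spec hC hL hf hh hl ht h8 hout).mono ?_
    rintro c σ' ⟨hc, h8', ht', hout'⟩
    have hrec : record R it t = if it.verts ∈ R then R else R ++ [it.verts] := by
      unfold record
      by_cases hR : it.verts ∈ R <;> simp [hR, hlt]
    rw [hrec]
    exact ⟨by simp only [Expr.cost]; omega, h8', ht', hout'⟩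
  · intro hge
    have hrec : record R it t = R := by
      unfold record
      rw [if_neg]
      rintro ⟨hlt, -⟩
      omega
    rw [wp_skip, hrec]
    exact ⟨by simp only [Expr.cost]; omega, by omega, ⟨node, ht⟩, hout⟩

/-- An item with `k` vertices costs at most a constant times `k * (m + 1) ^ 2`, and splitting
releases weight at least `k`. A skipped item costs a constant and releases weight at least 1. The
term 8 pays for advancing to the next item and for the guard of the main loop. -/
theorem process_spec (hs : 2 ≤ s) (hs3 : s ≤ 3) (hC : G.Capacity w D)
    (hD : 3 * G.n ^ 2 * G.m * ((G.m + 2) * (G.n + 1)) + 3 * G.n ^ 2 * G.m + 3 ≤ D)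
    {I : List (Item G.n)} {h : ℕ} {R : List (List (Fin G.n))} {σ : State}
    (hr : G.Running s I h R σ) {it : Item G.n} (hit : I[h]? = some it) :
    WP w (process s) (fun c σ' => ∃ I' R', I.length ≤ I'.length ∧
      G.Running s I' (h + 1) R' (σ'.setReg 6 (h + 1)) ∧
      c + 8 + 6000 * (G.m + 1) ^ 2 * pending I' (h + 1) ≤
        6000 * (G.m + 1) ^ 2 * pending I h) σ := by
  have hv := hr.progress.valid it (List.mem_of_getElem? hit)
  have hpos := List.length_pos_iff.2 hv.ne_nil
  have hln := hv.length_le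
  have hhI := (List.getElem?_eq_some_iff.1 hit).1
  have hIT := hr.progress.length_le
  set T := 3 * G.n ^ 2 * G.m with hT
  -- Per item, `(m + 2) * (n + 1)` search numbers and `n` trie nodes suffice. With at most `T`
  -- items, all of these numbers stay within `D`.
  have hhT : (h + 1) * ((G.m + 2) * (G.n + 1)) ≤ T * ((G.m + 2) * (G.n + 1)) :=
    Nat.mul_le_mul_right _ (by omega)
  have hexp : (h + 1) * ((G.m + 2) * (G.n + 1)) =
      h * ((G.m + 2) * (G.n + 1)) + (G.m + 2) * (G.n + 1) := by ring
  have hnode : (h + 1) * G.n ≤ T * ((G.m + 2) * (G.n + 1)) := by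
    refine Nat.mul_le_mul (by omega) ?_
    have : 1 * (G.n + 1) ≤ (G.m + 2) * (G.n + 1) := Nat.mul_le_mul_right _ (by omega)
    omega
  have hnexp : (h + 1) * G.n = h * G.n + G.n := by ring
  have hln1 : (G.m + 2) * (it.verts.length + 1) ≤ (G.m + 2) * (G.n + 1) :=
    Nat.mul_le_mul_left _ (by omega)
  have hsw : s % 2 ^ w = s := Nat.mod_eq_of_lt (hC.lt_of_le (by omega))
  have e9 : (Expr.get 7 (.reg 6)).eval w σ = it.verts.length := by
    simp [Expr.eval, hr.index, hr.stored.length h it hit]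
  have hK : 1 ≤ (G.m + 1) ^ 2 := Nat.one_le_pow _ _ (by omega)
  have hlK : it.verts.length * 1 ≤ it.verts.length * (G.m + 1) ^ 2 := Nat.mul_le_mul_left _ hK
  rw [process, wp_seq, wp_set, e9]
  -- Only the footprint of this command matters, namely register 9; the constant is arbitrary.
  have hF₁ : Frame (.set 9 (.const 0)) σ (σ.setReg 9 it.verts.length) :=
    ⟨fun x hx => by
      have : x ≠ 9 := by simpa [Cmd.regs] using hx
      simp [this], fun _ _ => rfl, fun _ => rfl⟩
  set σ₁ := σ.setReg 9 it.verts.length with hσ₁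
  have r9 : σ₁.reg 9 = it.verts.length := by simp [hσ₁]
  have es : (Expr.const s).eval w σ₁ = s := hsw
  have er9 : (Expr.reg 9).eval w σ₁ = it.verts.length := r9
  have hL₁ := hr.loaded.frame hF₁ (by decide) (by decide)
  have hI₁ := hr.stored.frame hF₁ (by decide) (by decide)
  obtain ⟨node, ht⟩ := hr.trie
  have ht₁ := ht.frame hF₁ (by decide) (by decide)
  have r6 : σ₁.reg 6 = h := by rw [hF₁.reg 6 (by decide), hr.index]
  have r7 : σ₁.reg 7 = σ.reg 7 := hF₁.reg 7 (by decide)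
  have r8 : σ₁.reg 8 = σ.reg 8 := hF₁.reg 8 (by decide)
  rw [wp_ite, Expr.lt_eval_ne_zero, Expr.lt_eval_eq_zero, es, er9]
  constructor
  · intro hlt
    rw [wp_skip]
    refine ⟨I, R, le_rfl, ⟨hL₁.congr (fun x hx => by simp; omega) fun _ _ => rfl,
      ⟨by simp [hI₁.count], hI₁.length, hI₁.start, hI₁.bar, hI₁.row⟩, by simp,
      fun c => (hr.member_le c).trans (Nat.le_succ _), fun c => by
        rw [State.setReg_reg, if_neg (by decide), r7]
        exact hr.seen_le c, ?_,
      ⟨node, ht₁.congr (by simp) rfl rfl⟩, ?_, hr.out, hr.progress.skip hit hlt⟩, ?_⟩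
    · have := hr.stamp_le
      simp only [State.setReg_reg, Nat.reduceEqDiff, if_false, r7]
      omega
    · have := hr.node_le
      simp only [State.setReg_reg, Nat.reduceEqDiff, if_false, r8]
      omega
    · have h₁ := hv.length_le_weight
      have h₂ : 6000 * (G.m + 1) ^ 2 * 1 ≤ 6000 * (G.m + 1) ^ 2 * it.weight :=
        Nat.mul_le_mul_left _ (by omega)
      rw [pending_eq_add hit, Nat.mul_add]
      simp only [Expr.cost]
      omega
  intro hsl
  rw [wp_seq]
  refine (load_spec hC hL₁ hI₁ hit (by omega) hln r6 r9 hr.member_le).frame.mono ?_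
  rintro c₂ σ₂ ⟨⟨hc₂, hf₂, h10₂, hmem₂⟩, hF₂⟩
  have hL₂ := hL₁.frame hF₂ (by decide) (by decide)
  have hI₂ := hI₁.frame hF₂ (by decide) (by decide)
  have ht₂ := ht₁.frame hF₂ (by decide) (by decide)
  have r7₂ : σ₂.reg 7 = σ.reg 7 := by rw [hF₂.reg 7 (by decide), r7]
  have r8₂ : σ₂.reg 8 = σ.reg 8 := by rw [hF₂.reg 8 (by decide), r8]
  have hst := hr.stamp_le
  have hnl := hr.node_le
  rw [wp_seq]
  refine (findFailure_spec hs hC hL₂ hf₂ (by omega) hv.nodup hsl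
    (by rw [hF₂.arr 11 (by decide), r7₂]; exact hr.seen_le) (by rw [r7₂]; omega)
    (by rw [h10₂]; exact hv.start_le.trans hv.bar_le)).frame.mono ?_
  rintro c₃ σ₃ ⟨⟨hc₃, h7₃, hseen₃, hfail, htm, hsep⟩, hF₃⟩
  rw [h10₂] at hfail
  rw [r7₂] at h7₃
  obtain ⟨Q, hQ₃, hsplit⟩ := hsep
  have hL₃ := hL₂.frame hF₃ (by decide) (by decide)
  have hI₃ := hI₂.frame hF₃ (by decide) (by decide)
  have ht₃ := ht₂.frame hF₃ (by decide) (by decide)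
  have hf₃ := hf₂.frame hF₃ (by decide) (by decide)
  have r8₃ : σ₃.reg 8 = σ.reg 8 := by rw [hF₃.reg 8 (by decide), r8₂]
  have hout₃ : σ₃.out = encode R := by
    rw [hF₃.out (by decide), hF₂.out (by decide), hF₁.out (by decide), hr.out]
  rw [wp_seq]
  refine (maybeRecord_spec hC hL₃ hf₃ (by omega) hln ⟨node, ht₃⟩ (by rw [r8₃]; omega) hout₃
    (hI₃.bar h it hit) rfl).frame.mono ?_
  rintro c₄ σ₄ ⟨⟨hc₄, h8₄, ⟨node', ht₄⟩, hout₄⟩, hF₄⟩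
  have hL₄ := hL₃.frame hF₄ (by decide) (by decide)
  have hI₄ := hI₃.frame hF₄ (by decide) (by decide)
  have hf₄ := hf₃.frame hF₄ (by decide) (by decide)
  have hQ₄ := hQ₃.frame hF₄ (by decide) (by decide)
  have r15₄ : σ₄.reg 15 = σ₃.reg 15 := hF₄.reg 15 (by decide)
  have r11₄ : σ₄.reg 11 = σ₃.reg 11 := hF₄.reg 11 (by decide)
  refine (split_spec hC hL₄ hI₄ (fun it' h' => (hr.progress.valid it' h').length_le) (by omega)
    hit hf₄ hQ₄ (by rw [hF₄.reg 10 (by decide), hF₃.reg 10 (by decide), h10₂])).frame.mono ?_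
  rw [r15₄, r11₄]
  rintro c₅ σ₅ ⟨⟨hc₅, hI₅⟩, hF₅⟩
  have hL₅ := hL₄.frame hF₅ (by decide) (by decide)
  have ht₅ := ht₄.frame hF₅ (by decide) (by decide)
  have r7₅ : σ₅.reg 7 = σ₃.reg 7 := by rw [hF₅.reg 7 (by decide), hF₄.reg 7 (by decide)]
  have r8₅ : σ₅.reg 8 = σ₄.reg 8 := hF₅.reg 8 (by decide)
  have hA := List.filter_sublist (l := it.verts)
    (p := fun x => decide (code x = σ₃.reg 15 ∨ x ∈ Q))
  have hB := List.filter_sublist (l := it.verts) (p := fun x => decide (x ∉ Q))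
  refine ⟨_, record R it (σ₃.reg 11), ?_, ⟨hL₅.congr (fun x hx => by simp; omega) fun _ _ => rfl,
    ⟨by simpa using hI₅.count, hI₅.length, hI₅.start, hI₅.bar, hI₅.row⟩, by simp, ?_, ?_, ?_,
    ⟨node', ht₅.congr (by simp) rfl rfl⟩, ?_, ?_,
    hr.progress.split hs hit hfail htm hA hB hsplit⟩, ?_⟩
  · simp
  · rw [State.setReg_arr, hF₅.arr 10 (by decide), hF₄.arr 10 (by decide), hF₃.arr 10 (by decide)]
    exact hmem₂
  · simp only [State.setReg_arr, State.setReg_reg, Nat.reduceEqDiff, if_false, r7₅]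
    rw [hF₅.arr 11 (by decide), hF₄.arr 11 (by decide)]
    exact hseen₃
  · simp only [State.setReg_reg, Nat.reduceEqDiff, if_false, r7₅]
    omega
  · simp only [State.setReg_reg, Nat.reduceEqDiff, if_false, r8₅]
    omega
  · rw [State.setReg_out, hF₅.out (by decide), hout₄]
  · have h₁ := pending_split (a := it.start) (b := max it.bar (σ₃.reg 11)) hit hv hA hB hsplit
    have h₂ := Nat.mul_le_mul_left (6000 * (G.m + 1) ^ 2) h₁
    rw [Nat.mul_add] at h₂
    have h₃ : 6000 * (G.m + 1) ^ 2 * it.verts.length =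
        6000 * (it.verts.length * (G.m + 1) ^ 2) := by ring
    simp only [Expr.cost]
    omega

/-! ### Setting up the data structures -/

/-- The incidence lists `L` are in memory. -/
structure Incidence (G : GraphSequence) (L : Fin G.n → List (Fin G.m)) (σ : State) : Prop where
  degree : ∀ u, σ.arr 4 (code u) = (L u).length
  edge : ∀ (u : Fin G.n) (k : ℕ) (e : Fin G.m), (L u)[k]? = some e →
    σ.arr 5 (code u * G.width + k) = e

/-- Lists of length at most `m` stay within their rows, so writing to the row of `u` leaves the
other lists intact. -/
theorem attach_spec (hC : G.Capacity w D) {σ : State} {L : Fin G.n → List (Fin G.m)}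
    (hI : G.Incidence L σ) (hlen : ∀ u, (L u).length ≤ G.m) {u : Fin G.n} {e : Fin G.m}
    (h3 : σ.reg 3 = G.width) (h19 : σ.reg 19 = code u) (h12 : σ.reg 12 = e) :
    WP w attach (fun c σ' => c ≤ 30 ∧
      G.Incidence (Function.update L u (L u ++ [e])) σ') σ := by
  have hone := hC.one_mod
  have hmD := hC.m_le
  have hmw : G.m < G.width := by unfold width; omega
  have hcell := hC.cell_mod (r := code u) (c := (L u).length) ((code_le u).trans hC.n_le)
    ((hlen u).trans hmw.le)
  have e1 : (cell 19 (.get 4 (.reg 19))).eval w σ = code u * G.width + (L u).length := by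
    simp [cell, Expr.eval, h19, h3, hI.degree, hcell]
  have e2 : (Expr.reg 12).eval w σ = e := h12
  rw [attach, wp_seq, wp_put, e1, e2, wp_put]
  have e3 : (Expr.reg 19).eval w (σ.setArr 5 (code u * G.width + (L u).length) e) = code u := h19
  have e4 : (Expr.add (.get 4 (.reg 19)) (.const 1)).eval w
      (σ.setArr 5 (code u * G.width + (L u).length) e) = (L u).length + 1 := by
    have := hC.succ_mod (r := (L u).length) ((hlen u).trans hmD)
    simp [Expr.eval, State.setArr_arr_ne, h19, hI.degree, hone, this]
  rw [e3, e4]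
  refine ⟨by simp [Expr.cost, cell], fun v => ?_, fun v k f hf => ?_⟩
  · rw [State.setArr_arr_self, State.setArr_arr_ne _ _ _ (by decide)]
    by_cases hvu : v = u
    · subst hvu
      simp
    · simp [hvu, hI.degree]
  · rw [State.setArr_arr_ne _ _ _ (by decide), State.setArr_arr_self]
    by_cases hvu : v = u
    · subst hvu
      rw [Function.update_self] at hf
      rcases getElem?_snoc hf with hf | ⟨rfl, rfl⟩
      · have := (List.getElem?_eq_some_iff.1 hf).1
        rw [if_neg (by omega), hI.edge v k f hf]
      · simp
    · rw [Function.update_of_ne hvu] at hf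
      have hk := (List.getElem?_eq_some_iff.1 hf).1
      have := hlen v
      have := hlen u
      rw [if_neg, hI.edge v k f hf]
      intro heq
      exact hvu (code_inj.1 ((cell_inj (by omega) (by omega)).1 heq).1)

/-- The registers and arrays hold the input, and register `3` the row width. -/
structure Input (G : GraphSequence) (σ : State) : Prop where
  n : σ.reg 0 = G.n
  m : σ.reg 1 = G.m
  tmax : σ.reg 2 = G.tmax
  width : σ.reg 3 = G.width
  tail : ∀ e : Fin G.m, σ.arr 0 e = code (G.tail e)
  head : ∀ e : Fin G.m, σ.arr 1 e = code (G.head e)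
  first : ∀ e : Fin G.m, σ.arr 2 e = G.first e
  last : ∀ e : Fin G.m, σ.arr 3 e = G.last e

theorem Input.frame {c : Cmd} {σ σ' : State} (h : G.Input σ) (hF : Frame c σ σ')
    (hr : ∀ x < 4, x ∉ c.regs) (ha : ∀ A < 4, A ∉ c.arrs) : G.Input σ' := by
  constructor
  · rw [hF.reg 0 (hr 0 (by omega)), h.n]
  · rw [hF.reg 1 (hr 1 (by omega)), h.m]
  · rw [hF.reg 2 (hr 2 (by omega)), h.tmax]
  · rw [hF.reg 3 (hr 3 (by omega)), h.width]
  · rw [hF.arr 0 (ha 0 (by omega))]; exact h.tail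
  · rw [hF.arr 1 (ha 1 (by omega))]; exact h.head
  · rw [hF.arr 2 (ha 2 (by omega))]; exact h.first
  · rw [hF.arr 3 (ha 3 (by omega))]; exact h.last

theorem incidences_spec (hC : G.Capacity w D) {σ : State} (hI : G.Input σ)
    (h4 : ∀ c, σ.arr 4 c = 0) :
    WP w incidences (fun c σ' => c ≤ 100 * (G.m + 1) ∧ G.Loaded σ') σ := by
  rw [incidences]
  refine (wp_for (fun i σ' => G.Incidence (fun u => ((List.finRange G.m).take i).filter fun e =>
    G.tail e = u ∨ G.head e = u) σ') 80 G.m (hC.lt_of_le (by have := hC.m_le; omega)) (by decide)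
    ?_ ?_ ?_).mono ?_
  · intro σ' hF
    simp only [Expr.eval]
    rw [hF.reg 1 (by decide), hI.m]
  · exact ⟨fun u => by simp [h4], fun u k e he => by simp at he⟩
  · intro i hi σ' hF h12 hinc
    have hin := hI.frame hF (by decide) (by decide)
    set L : Fin G.n → List (Fin G.m) := fun u => ((List.finRange G.m).take i).filter fun e =>
      G.tail e = u ∨ G.head e = u with hL
    set e : Fin G.m := ⟨i, hi⟩ with he
    have hlen : ∀ u, (L u).length ≤ i := fun u =>
      (List.length_filter_le _ _).trans (by simp)
    have e1 : (Expr.get 0 (.reg 12)).eval w σ' = code (G.tail e) := by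
      simp only [Expr.eval, h12]
      exact hin.tail e
    rw [wp_seq, wp_set, e1, wp_seq]
    refine (attach_spec hC (σ := σ'.setReg 19 (code (G.tail e))) (L := L) (u := G.tail e) (e := e)
      ⟨hinc.degree, hinc.edge⟩ (fun u => (hlen u).trans hi.le) (by simp [hin.width]) (by simp)
      (by simp [h12, he])).frame.mono ?_
    rintro c₁ σ₁ ⟨⟨hc₁, hinc₁⟩, hF₁⟩
    have e2 : (Expr.get 1 (.reg 12)).eval w σ₁ = code (G.head e) := by
      simp only [Expr.eval]
      rw [hF₁.reg 12 (by decide), hF₁.arr 1 (by decide)]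
      simp only [State.setReg_reg, Nat.reduceEqDiff, if_false, h12]
      exact hin.head e
    rw [wp_seq, wp_set, e2]
    refine (attach_spec hC (σ := σ₁.setReg 19 (code (G.head e))) (u := G.head e) (e := e)
      ⟨hinc₁.degree, hinc₁.edge⟩ (fun u => ?_) ?_ (by simp) ?_).mono ?_
    · by_cases hu : u = G.tail e
      · subst hu
        have := hlen (G.tail e)
        simp
        omega
      · have := hlen u
        simp [hu]
        omega
    · simp only [State.setReg_reg, Nat.reduceEqDiff, if_false]
      rw [hF₁.reg 3 (by decide)]
      simp [hin.width]
    · simp only [State.setReg_reg, Nat.reduceEqDiff, if_false]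
      rw [hF₁.reg 12 (by decide)]
      simp [h12, he]
    · rintro c₂ σ₂ ⟨hc₂, hinc₂⟩
      refine ⟨by simp only [Expr.cost]; omega, ?_⟩
      have hne := G.tail_ne_head e
      -- As the ends of `e` differ, the two updates concern different lists and each receives `e`
      -- once.
      have heq : (Function.update (Function.update L (G.tail e) (L (G.tail e) ++ [e])) (G.head e)
          (Function.update L (G.tail e) (L (G.tail e) ++ [e]) (G.head e) ++ [e])) =
          fun u => ((List.finRange G.m).take (i + 1)).filter fun e =>
            G.tail e = u ∨ G.head e = u := by
        funext u
        rw [filter_take_succ (fun e => G.tail e = u ∨ G.head e = u) (by simpa using hi)]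
        have hget : (List.finRange G.m)[i]'(by simpa using hi) = e := by simp [he]
        rw [hget]
        by_cases h1 : u = G.head e
        · subst h1
          simp [Function.update_of_ne hne.symm, hL]
        · by_cases h2 : u = G.tail e
          · subst h2
            simp [Function.update_of_ne hne, hL]
          · simp [h1, h2, Ne.symm h1, Ne.symm h2, hL]
      rw [heq] at hinc₂
      exact ⟨hinc₂.degree, hinc₂.edge⟩
  · rintro c σ' ⟨hc, hinc, hF⟩
    have hin := hI.frame hF (by decide) (by decide)
    have htake : (List.finRange G.m).take G.m = List.finRange G.m :=
      List.take_of_length_le (by simp)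
    rw [htake] at hinc
    refine ⟨?_, hin.n, hin.m, hin.tmax, hin.width, hin.tail, hin.head, hin.first, hin.last,
      hinc.degree, hinc.edge⟩
    simp only [Expr.cost] at hc
    omega

theorem initialItems_spec (hC : G.Capacity w D) {σ : State} (hL : G.Loaded σ) :
    WP w initialItems (fun c σ' => c ≤ 100 * (G.m * (G.n + 1) + 1) ∧
      G.Stored G.roots (σ'.setReg 5 G.m)) σ := by
  have hone := hC.one_mod
  have hnD := hC.n_le
  have hmD := hC.m_le
  have hw : G.n < G.width := by unfold width; omega
  have hroots : G.roots.length = G.m := by simp [roots]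
  rw [initialItems]
  -- The length of the work list is written only after this loop, so the invariant speaks of the
  -- state with `i` put into register 5.
  refine (wp_for (fun i σ' => G.Stored (G.roots.take i) (σ'.setReg 5 i)) (20 * G.n + 40) G.m
    (hC.lt_of_le (by omega)) (by decide) ?_ ?_ ?_).mono ?_
  · intro σ' hF
    simp only [Expr.eval]
    rw [hF.reg 1 (by decide), hL.m]
  · refine ⟨by simp, ?_, ?_, ?_, ?_⟩ <;> simp
  · intro i hi σ' hF h12 hst
    have hL' := hL.frame hF (by decide) (by decide)
    set e : Fin G.m := ⟨i, hi⟩ with he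
    rw [wp_seq]
    refine (wp_for (fun j σ'' => (∀ x : Fin G.n, (x : ℕ) < j →
        σ''.arr 6 (i * G.width + x) = code x) ∧
        ∀ r (L : List (Fin G.n)), r < i → L.length ≤ G.width → G.RowHolds (σ'.arr 6) r L →
          G.RowHolds (σ''.arr 6) r L) 10 G.n
      (hC.lt_of_le (by omega)) (by decide) ?_ ?_ ?_).mono ?_
    · intro σ'' hF'
      simp only [Expr.eval]
      rw [hF'.reg 0 (by decide), hL'.n]
    · exact ⟨fun x hx => absurd hx (by omega), fun r L _ _ h => h⟩
    · rintro j hj σ'' hF' h25 ⟨hrow, hoth⟩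
      have ec : (cell 12 (.reg 25)).eval w σ'' = i * G.width + j := by
        simp only [cell, Expr.eval]
        rw [hF'.reg 12 (by decide), hF'.reg 3 (by decide), h12, hL'.width, h25,
          hC.cell_mod (by omega) (by omega)]
      have ev : (Expr.add (.reg 25) (.const 1)).eval w σ'' = code (⟨j, hj⟩ : Fin G.n) := by
        simp only [Expr.eval, h25, hone]
        rw [hC.succ_mod (by omega)]
        rfl
      rw [wp_put, ec, ev]
      refine ⟨by simp [Expr.cost, cell], fun x hx => ?_, fun r L hr hLw h => ?_⟩
      · rw [State.setReg_arr, State.setArr_arr_self]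
        rcases Nat.lt_succ_iff_lt_or_eq.1 hx with hx' | hx'
        · rw [if_neg (by omega), hrow x hx']
        · rw [if_pos (by omega)]
          congr 1
          exact Fin.ext hx'.symm
      · rw [State.setReg_arr, State.setArr_arr, if_pos rfl]
        exact (hoth r L hr hLw h).update hLw (by omega) (by omega)
    · rintro c₁ σ₁ ⟨hc₁, ⟨hrow, hoth⟩, hF₁⟩
      have r12 : σ₁.reg 12 = i := by rw [hF₁.reg 12 (by decide), h12]
      have r0 : σ₁.reg 0 = G.n := by rw [hF₁.reg 0 (by decide), hL'.n]
      have a2 : σ₁.arr 2 i = G.first e := by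
        rw [hF₁.arr 2 (by decide)]
        exact hL'.first e
      rw [wp_seq, wp_put, wp_seq, wp_put, wp_put]
      refine ⟨?_, ?_⟩
      · simp only [Expr.cost] at hc₁ ⊢
        omega
      · have htake : G.roots.take (i + 1) = G.roots.take i ++
            [⟨List.finRange G.n, G.first e, G.first e⟩] := by
          rw [List.take_succ_eq_append_getElem (by omega)]
          simp [roots, he]
        have hlen : (G.roots.take i).length = i := by simp [hroots, hi.le]
        rw [htake]
        refine hst.append _ (by simp; omega) ?_ ?_ ?_ ?_ ?_
        · simp [State.setArr_arr, Expr.eval, r12, r0, hF₁.arr 7 (by decide), hlen]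
        · simp [State.setArr_arr, Expr.eval, r12, a2, hF₁.arr 8 (by decide), hlen]
        · simp [State.setArr_arr, Expr.eval, r12, a2, hF₁.arr 9 (by decide), hlen]
        · intro k it hk
          have hki := (List.getElem?_eq_some_iff.1 hk).1
          have hvl : it.verts.length = G.n := by
            have := List.mem_of_mem_take (List.mem_of_getElem? hk)
            simp only [roots, List.mem_map] at this
            obtain ⟨f, -, rfl⟩ := this
            simp
          have := hoth k it.verts (by omega) (by omega) (hst.row k it hk)
          simpa [State.setArr_arr] using this
        · rw [hlen]
          intro j x hx
          obtain ⟨hj, hxj⟩ := List.getElem?_eq_some_iff.1 hx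
          have hxv : (x : ℕ) = j := by
            rw [← hxj]
            simp
          simp only [State.setReg_arr, State.setArr_arr]
          simp only [Nat.reduceEqDiff, if_false]
          rw [← hxv]
          exact hrow x x.2
  · rintro c σ' ⟨hc, hst, hF⟩
    rw [List.take_of_length_le hroots.le] at hst
    refine ⟨?_, hst⟩
    have h₁ : G.m * (20 * G.n + 40 + 1 + 7) ≤ G.m * (100 * (G.n + 1)) :=
      Nat.mul_le_mul_left _ (by omega)
    have h₂ : G.m * (100 * (G.n + 1)) = 100 * (G.m * (G.n + 1)) := by ring
    simp only [Expr.cost] at hc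
    omega

theorem setup_spec (hC : G.Capacity w D) (s : ℕ) :
    WP w setup (fun c σ' => c ≤ 300 * (G.m * (G.n + 1) + 1) ∧
      G.Running s G.roots 0 [] σ') G.input := by
  have hone := hC.one_mod
  rw [setup, wp_seq, wp_set]
  have hwd : G.n + G.m + 1 < 2 ^ w := by
    have := hC.cell_lt (r := 0) (c := G.width) (by omega) le_rfl
    unfold width at this
    omega
  have e3 : (Expr.add (.add (.reg 0) (.reg 1)) (.const 1)).eval w G.input = G.width := by
    simp only [Expr.eval, hone]
    change ((G.n + G.m) % 2 ^ w + 1) % 2 ^ w = G.width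
    rw [Nat.mod_eq_of_lt (a := G.n + G.m) (by omega), Nat.mod_eq_of_lt hwd, width]
  have e8 : (Expr.const 1).eval w (G.input.setReg 3 G.width) = 1 := hone
  rw [e3, wp_seq, wp_set, e8, wp_seq]
  set σ₁ := (G.input.setReg 3 G.width).setReg 8 1 with hσ₁
  have hin : G.Input σ₁ := ⟨by simp [hσ₁]; rfl, by simp [hσ₁]; rfl, by simp [hσ₁]; rfl,
    by simp [hσ₁], fun e => by simp [hσ₁, input, toArray], fun e => by simp [hσ₁, input, toArray],
    fun e => by simp [hσ₁, input, toArray], fun e => by simp [hσ₁, input, toArray]⟩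
  have hzero : ∀ A, 4 ≤ A → ∀ c, σ₁.arr A c = 0 := by
    intro A hA c
    rw [hσ₁, State.setReg_arr, State.setReg_arr]
    obtain ⟨B, rfl⟩ : ∃ B, A = B + 4 := ⟨A - 4, by omega⟩
    rfl
  refine (incidences_spec hC hin (hzero 4 le_rfl)).frame.mono ?_
  rintro c₂ σ₂ ⟨⟨hc₂, hL₂⟩, hF₂⟩
  rw [wp_seq]
  refine (initialItems_spec hC hL₂).frame.mono ?_
  rintro c₃ σ₃ ⟨⟨hc₃, hst⟩, hF₃⟩
  have hL₃ := hL₂.frame hF₃ (by decide) (by decide)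
  have e5 : (Expr.reg 1).eval w σ₃ = G.m := hL₃.m
  rw [wp_set, e5]
  have z : ∀ A, 10 ≤ A → A < 15 → ∀ c, σ₃.arr A c = 0 := by
    intro A hA hA' c
    have h1 : A ∉ initialItems.arrs := by
      interval_cases A <;> decide
    have h2 : A ∉ incidences.arrs := by
      interval_cases A <;> decide
    rw [hF₃.arr A h1, hF₂.arr A h2, hzero A (by omega)]
  have r6 : σ₃.reg 6 = 0 := by
    rw [hF₃.reg 6 (by decide), hF₂.reg 6 (by decide)]
    simp [hσ₁]
    rfl
  have r8 : σ₃.reg 8 = 1 := by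
    rw [hF₃.reg 8 (by decide), hF₂.reg 8 (by decide)]
    simp [hσ₁]
  have r7 : σ₃.reg 7 = 0 := by
    rw [hF₃.reg 7 (by decide), hF₂.reg 7 (by decide)]
    simp [hσ₁]
    rfl
  refine ⟨?_, ?_⟩
  · have h₁ : G.m * 1 ≤ G.m * (G.n + 1) := Nat.mul_le_mul_left _ (by omega)
    simp only [Expr.cost]
    omega
  refine ⟨hL₃.congr (fun x hx => by simp; omega) fun _ _ => rfl, hst, by simp [r6],
    fun c => by simp [z], fun c => by simp [z], by simp [r7],
    -- The initial trie consists of the root alone, with number 1.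
    ⟨fun l => if l = [] then 1 else 0, by simp, fun l => ?_, fun l l' heq hne => ?_, fun l x => ?_,
      fun l x _ => by simp [z], fun l _ => by simp [z], fun _ _ _ _ => by simp [z],
      fun _ _ => by simp [z], by simp⟩,
    by simp [r8], ?_, progress_roots G s⟩
  · simp only [State.setReg_reg, Nat.reduceEqDiff, if_false, r8]
    split_ifs <;> omega
  · by_cases h1 : l = [] <;> by_cases h2 : l' = [] <;> simp_all
  · simp
  · rw [State.setReg_out, hF₃.out (by decide), hF₂.out (by decide)]
    rfl

/-! ### Total cost, sufficient word length, and the final bound -/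

theorem enumerate_spec (hs : 2 ≤ s) (hs3 : s ≤ 3) (hC : G.Capacity w D)
    (hD : 3 * G.n ^ 2 * G.m * ((G.m + 2) * (G.n + 1)) + 3 * G.n ^ 2 * G.m + 3 ≤ D) :
    WP w (enumerate s) (fun c σ => c ≤ 300 * (G.m * (G.n + 1) + 1) +
      6000 * (G.m + 1) ^ 2 * (3 * G.n ^ 2 * G.m) + 10 ∧ G.Enumerates s σ.out) G.input := by
  rw [enumerate, wp_seq]
  refine (setup_spec hC s).mono ?_
  rintro c₁ σ₁ ⟨hc₁, hr₁⟩
  refine (wp_loop (fun (a : List (Item G.n) × ℕ × List (List (Fin G.n))) σ =>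
      a.2.1 ≤ a.1.length ∧ G.Running s a.1 a.2.1 a.2.2 σ)
    -- The waiting weight is the potential of the main loop; initially it is at most `3n²m`.
    (fun a => 6000 * (G.m + 1) ^ 2 * pending a.1 a.2.1) (G.roots, 0, [])
    ⟨Nat.zero_le _, hr₁⟩ ?_).mono ?_
  · rintro ⟨I, h, R⟩ σ - ⟨hle, hr⟩ hcond
    dsimp only at *
    have hlt : h < I.length := by
      have := Expr.lt_eval_ne_zero.1 hcond
      simpa [Expr.eval, hr.index, hr.stored.count] using this
    have hhD : h ≤ D := by
      have := hr.progress.length_le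
      omega
    rw [wp_seq]
    refine (process_spec hs hs3 hC hD hr (List.getElem?_eq_getElem hlt)).frame.mono ?_
    rintro c σ' ⟨⟨I', R', hlen, hr', hc⟩, hF⟩
    rw [incr, wp_set]
    have hmem : (6 : ℕ) ∉ (process s).regs := by
      simp [process, load, findFailure, tryStamp, test, testVertex, search, searchInit, scan, visit,
        recordSet, descend, output, split, distribute, header, incr, Cmd.for, Cmd.regs]
    have e6 : (Expr.add (.reg 6) (.const 1)).eval w σ' = h + 1 := by
      simp only [Expr.eval]
      rw [hF.reg 6 hmem, hr.index, hC.one_mod, hC.succ_mod hhD]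
    rw [e6]
    exact ⟨(I', h + 1, R'), ⟨by dsimp only; omega, hr'⟩, by simp only [Expr.cost]; omega⟩
  · rintro c σ ⟨hc, ⟨⟨I, h, R⟩, hle, hr⟩, hcond, -⟩
    dsimp only at *
    have hge : I.length ≤ h := by
      have := Expr.lt_eval_eq_zero.1 hcond
      simpa [Expr.eval, hr.index, hr.stored.count] using this
    obtain rfl : h = I.length := by omega
    refine ⟨?_, ?_⟩
    · have h₁ := hr₁.progress.weight
      have h₂ := Nat.mul_le_mul_left (6000 * (G.m + 1) ^ 2)
        (show pending G.roots 0 ≤ 3 * G.n ^ 2 * G.m by omega)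
      simp only [Expr.cost] at hc
      omega
    · rw [hr.out]
      exact hr.progress.enumerates hs

theorem capacity_of_le {N : ℕ} (hN : N = G.n + G.m + G.tmax + 1) (h : 50 * N ^ 50 ≤ 2 ^ w) :
    ∃ D, G.Capacity w D ∧
      3 * G.n ^ 2 * G.m * ((G.m + 2) * (G.n + 1)) + 3 * G.n ^ 2 * G.m + 3 ≤ D := by
  have h1 : 1 ≤ N := by omega
  have hpow : ∀ k, 1 ≤ N ^ k := fun k => Nat.one_le_pow _ _ h1
  have hT : 3 * G.n ^ 2 * G.m ≤ 3 * N ^ 3 := by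
    have : G.n ^ 2 * G.m ≤ N ^ 2 * N :=
      Nat.mul_le_mul (Nat.pow_le_pow_left (by omega) 2) (by omega)
    have e : N ^ 3 = N ^ 2 * N := by ring
    rw [mul_assoc, e]
    omega
  have h2 : (G.m + 2) * (G.n + 1) ≤ 2 * N * N := Nat.mul_le_mul (by omega) (by omega)
  have h3 : 3 * G.n ^ 2 * G.m * ((G.m + 2) * (G.n + 1)) ≤ 3 * N ^ 3 * (2 * N * N) :=
    Nat.mul_le_mul hT h2
  have e5 : 3 * N ^ 3 * (2 * N * N) = 6 * N ^ 5 := by ring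
  have h35 : N ^ 3 ≤ N ^ 5 := Nat.pow_le_pow_right h1 (by omega)
  have h15 : N ^ 1 ≤ N ^ 5 := Nat.pow_le_pow_right h1 (by omega)
  rw [pow_one] at h15
  have h05 := hpow 5
  -- The three summands are at most `6N⁵`, `3N⁵` and `3N⁵`. The capacity condition then needs only
  -- `26N⁶ < 2 ^ w`.
  refine ⟨12 * N ^ 5, ⟨by omega, by omega, by omega, ?_⟩, by omega⟩
  have h4 : (12 * N ^ 5 + 1) * (G.width + 1) ≤ (13 * N ^ 5) * (2 * N) :=
    Nat.mul_le_mul (by omega) (by unfold width; omega)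
  have e6 : 13 * N ^ 5 * (2 * N) = 26 * N ^ 6 := by ring
  have h6 : N ^ 6 ≤ N ^ 50 := Nat.pow_le_pow_right h1 (by omega)
  have := hpow 6
  omega

/-- Without edges the cost is constant, which the summand 1 covers. Otherwise an edge has an end, so
`n ≥ 1` and every term is dominated by `n²m³`. -/
theorem cost_bound (G : GraphSequence) :
    300 * (G.m * (G.n + 1) + 1) + 6000 * (G.m + 1) ^ 2 * (3 * G.n ^ 2 * G.m) + 10 ≤
      100000 * (G.n ^ 2 * G.m ^ 3 + 1) := by
  rcases Nat.eq_zero_or_pos G.m with hm | hm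
  · simp [hm]
  · have hn : 1 ≤ G.n := (G.tail ⟨0, hm⟩).pos
    have h1 : G.m * (G.n + 1) ≤ 2 * (G.n ^ 2 * G.m ^ 3) := by
      calc G.m * (G.n + 1) ≤ G.m ^ 3 * (2 * G.n ^ 2) := by
            refine Nat.mul_le_mul (Nat.le_self_pow (by omega) _) ?_
            have : G.n ≤ G.n ^ 2 := Nat.le_self_pow (by omega) _
            omega
        _ = 2 * (G.n ^ 2 * G.m ^ 3) := by ring
    have h2 : 6000 * (G.m + 1) ^ 2 * (3 * G.n ^ 2 * G.m) ≤ 72000 * (G.n ^ 2 * G.m ^ 3) := by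
      calc 6000 * (G.m + 1) ^ 2 * (3 * G.n ^ 2 * G.m)
          ≤ 6000 * (2 * G.m) ^ 2 * (3 * G.n ^ 2 * G.m) := by
            refine Nat.mul_le_mul_right _ (Nat.mul_le_mul_left _ (Nat.pow_le_pow_left ?_ 2))
            omega
        _ = 72000 * (G.n ^ 2 * G.m ^ 3) := by ring
    omega

end GraphSequence

theorem mainTheorem4 (s : ℕ) (hs : s = 2 ∨ s = 3) :
    ∃ (P : WordRAM.Cmd) (C c : ℕ), ∀ (G : GraphSequence) (w : ℕ),
      c * (G.n + G.m + G.tmax + 1) ^ c ≤ 2 ^ w →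
      ∃ (k : ℕ) (σ : WordRAM.State), WordRAM.Exec w P G.input k σ ∧
        k ≤ C * (G.n ^ 2 * G.m ^ 3 + 1) ∧ G.Enumerates s σ.out := by
  refine ⟨GraphSequence.Program.enumerate s, 100000, 50, fun G w hw => ?_⟩
  obtain ⟨D, hC, hD⟩ := GraphSequence.capacity_of_le rfl hw
  obtain ⟨k, σ, hrun, hk, hout⟩ :=
    GraphSequence.enumerate_spec (s := s) (by omega) (by omega) hC hD
  exact ⟨k, σ, hrun, hk.trans G.cost_bound, hout⟩
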